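/- Let $k$ be an algebraically closed field of characteristic $2$, let $N\geq 3$ be an odd integer, and let $Z\subset\mathbb{P}^N_k$ be a smooth complete intersection of two quadrics, i.e. a smooth closed subscheme of codimension $2$ defined by two quadratic forms. Let $\mathrm{Aut}_k(Z,\mathcal{O}(1))$ be the $k$-group scheme whose points over a $k$-scheme $T$ are the $T$-automorphisms $f$ of $Z_T=Z\times_k T$ that preserve the class of $\mathcal{O}(1)$ in the relative Picard group $\mathrm{Pic}(Z_T)/\mathrm{Pic}(T)$, i.e. such that $f^*\mathcal{O}(1)\simeq\mathcal{O}(1)\otimes\mathcal{L}_{Z_T}$ for some line bundle $\mathcal{L}$ on $T$. Then the tangent space of $\mathrm{Aut}_k(Z,\mathcal{O}(1))$ at the identity, i.e. the $k$-vector space of those elements of $\mathrm{Aut}_k(Z,\mathcal{O}(1))(k[\varepsilon]/\varepsilon^2)$ that reduce to the identity modulo $\varepsilon$, has dimension $\geq\frac{N-1}{2}$. -/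

import Mathlib

open CategoryTheory CategoryTheory.Limits AlgebraicGeometry

universe u

noncomputable section

/-! ### Line bundles, given by transition functions -/

namespace AlgebraicGeometry

/-- Restriction of invertible functions. -/
def Scheme.resUnits (X : Scheme.{u}) {U V : X.Opens} (h : V ≤ U) : Γ(X, U)ˣ →* Γ(X, V)ˣ :=
  Units.map (X.presheaf.map (homOfLE h).op).hom.toMonoidHom

/-- A line bundle on a scheme `X`, given by a trivialising open cover `U i` and transition functions
`g i j` on `U i ⊓ U j`: a section is a family of functions `s i` on `U i` with `s i = g i j * s j`. -/
structure LineBundle (X : Scheme.{u}) where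
  /-- the index type of the cover -/
  ι : Type u
  /-- the trivialising cover -/
  U : ι → X.Opens
  cover : ⨆ i, U i = ⊤
  /-- the transition functions -/
  g : ∀ i j, Γ(X, U i ⊓ U j)ˣ
  cocycle : ∀ i j l,
    X.resUnits (V := U i ⊓ U j ⊓ U l) inf_le_left (g i j) *
      X.resUnits (le_inf (inf_le_left.trans inf_le_right) inf_le_right) (g j l) =
    X.resUnits (le_inf (inf_le_left.trans inf_le_left) inf_le_right) (g i l)

namespace LineBundle

variable {X Y : Scheme.{u}}

/-- Two line bundles are isomorphic: there are invertible functions `u i j` on `U i ⊓ U' j`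
(the matrix `s' j = u i j * s i` of the isomorphism in the given trivialisations) which are
compatible with the transition functions. -/
def Isomorphic (L L' : LineBundle X) : Prop :=
  ∃ u : ∀ (i : L.ι) (j : L'.ι), Γ(X, L.U i ⊓ L'.U j)ˣ,
    ∀ (i i' : L.ι) (j j' : L'.ι) (W : X.Opens) (hi : W ≤ L.U i) (hi' : W ≤ L.U i')
      (hj : W ≤ L'.U j) (hj' : W ≤ L'.U j'),
      X.resUnits (le_inf hi' hj') (u i' j') =
        X.resUnits (le_inf hj' hj) (L'.g j' j) * X.resUnits (le_inf hi hj) (u i j) *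
          X.resUnits (le_inf hi hi') (L.g i i')

lemma resUnits_resUnits {U V W : X.Opens} (h : V ≤ U) (h' : W ≤ V) (a : Γ(X, U)ˣ) :
    X.resUnits h' (X.resUnits h a) = X.resUnits (h'.trans h) a := by
  ext
  simp only [Scheme.resUnits, Units.coe_map]
  exact congr($((X.presheaf.map_comp (homOfLE h).op (homOfLE h').op).symm) a.1)

/-- The cocycle relation on any smaller open set. -/
lemma cocycle_le (L : LineBundle X) (i j l : L.ι) {W : X.Opens} (hi : W ≤ L.U i) (hj : W ≤ L.U j)
    (hl : W ≤ L.U l) :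
    X.resUnits (le_inf hi hj) (L.g i j) * X.resUnits (le_inf hj hl) (L.g j l) =
      X.resUnits (le_inf hi hl) (L.g i l) := by
  have := congrArg (X.resUnits (V := W) (le_inf (le_inf hi hj) hl)) (L.cocycle i j l)
  simpa only [map_mul, resUnits_resUnits] using this

/-- Pullback of invertible functions along `f : Y ⟶ X`. -/
def pullUnits (f : Y ⟶ X) (U : X.Opens) : Γ(X, U)ˣ →* Γ(Y, f ⁻¹ᵁ U)ˣ :=
  Units.map (f.app U).hom.toMonoidHom

lemma pullUnits_resUnits (f : Y ⟶ X) {U V : X.Opens} (h : V ≤ U) (a : Γ(X, U)ˣ) :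
    pullUnits f V (X.resUnits h a) =
      Y.resUnits (show f ⁻¹ᵁ V ≤ f ⁻¹ᵁ U from fun _ hx => h hx) (pullUnits f U a) := by
  ext
  simp only [Scheme.resUnits, pullUnits, Units.coe_map]
  exact congr($(f.naturality (homOfLE h).op) a.1)

/-- The pullback `f^* L`. -/
def pullback (f : Y ⟶ X) (L : LineBundle X) : LineBundle Y where
  ι := L.ι
  U i := f ⁻¹ᵁ L.U i
  cover := by
    rw [← Scheme.Hom.preimage_iSup, L.cover]; rfl
  g i j := pullUnits f _ (L.g i j)
  cocycle i j l := by
    have := congrArg (pullUnits f _) (L.cocycle i j l)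
    simp only [map_mul, pullUnits_resUnits] at this
    exact this

/-- The tensor product `L ⊗ M`. -/
def tensor (L M : LineBundle X) : LineBundle X where
  ι := L.ι × M.ι
  U p := L.U p.1 ⊓ M.U p.2
  cover := by
    rw [iSup_prod]
    simp only [← inf_iSup_eq, M.cover, L.cover, inf_top_eq]
  g p q :=
    X.resUnits (le_inf (inf_le_left.trans inf_le_left) (inf_le_right.trans inf_le_left))
        (L.g p.1 q.1) *
      X.resUnits (le_inf (inf_le_left.trans inf_le_right) (inf_le_right.trans inf_le_right))
        (M.g p.2 q.2)
  cocycle p q r := by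
    simp only [map_mul, resUnits_resUnits]
    rw [mul_mul_mul_comm,
      L.cocycle_le p.1 q.1 r.1 ((inf_le_left.trans inf_le_left).trans inf_le_left)
        ((inf_le_left.trans inf_le_right).trans inf_le_left) (inf_le_right.trans inf_le_left),
      M.cocycle_le p.2 q.2 r.2 ((inf_le_left.trans inf_le_left).trans inf_le_right)
        ((inf_le_left.trans inf_le_right).trans inf_le_right) (inf_le_right.trans inf_le_right)]

end LineBundle

/-! ### Projective space and `O(1)` -/

/-- The grading of `k[X_0, …, X_N]` by degree. -/
abbrev polyGrading (N : ℕ) (k : Type u) [Field k] :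
    ℕ → Submodule k (MvPolynomial (Fin (N + 1)) k) :=
  MvPolynomial.homogeneousSubmodule (Fin (N + 1)) k

instance (N : ℕ) (k : Type u) [Field k] : GradedAlgebra (polyGrading N k) :=
  MvPolynomial.gradedAlgebra

/-- Projective space `ℙ^N_k = Proj k[X_0, …, X_N]`. -/
abbrev ProjSpace (N : ℕ) (k : Type u) [Field k] : Scheme.{u} := Proj (polyGrading N k)

namespace ProjSpace

variable (N : ℕ) (k : Type u) [Field k]

/-- The structure morphism `ℙ^N_k ⟶ Spec k`. -/
def toSpec : ProjSpace N k ⟶ Spec (.of k) :=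
  Proj.toSpecZero (polyGrading N k) ≫
    Spec.map (CommRingCat.ofHom (algebraMap k (polyGrading N k 0)))

variable {k}

lemma X_mem (j : Fin (N + 1)) : (MvPolynomial.X j : MvPolynomial (Fin (N + 1)) k) ∈
    polyGrading N k 1 := MvPolynomial.isHomogeneous_X k j

variable (k) in
/-- The standard open set `D₊(X_j)`. -/
def chart (j : Fin (N + 1)) : (ProjSpace N k).Opens :=
  Proj.basicOpen (polyGrading N k) (MvPolynomial.X j)

variable {N}

lemma isAffineOpen_chart (j : Fin (N + 1)) : IsAffineOpen (chart N k j) :=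
  Proj.isAffineOpen_basicOpen _ _ (X_mem N j) one_pos

/-- The function `F / X_j ^ d` on `D₊(X_j)`, for `F` homogeneous of degree `d`. -/
def dehomog {d : ℕ} (F : MvPolynomial (Fin (N + 1)) k) (hF : F ∈ polyGrading N k d)
    (j : Fin (N + 1)) : Γ(ProjSpace N k, chart N k j) :=
  (Proj.awayToSection (polyGrading N k) (MvPolynomial.X j)).hom
    (HomogeneousLocalization.Away.mk (polyGrading N k) (X_mem N j) d F (by simpa using hF))

/-- The function `X_l / X_j` on `D₊(X_j)`. -/
def ratio (l j : Fin (N + 1)) : Γ(ProjSpace N k, chart N k j) := dehomog (.X l) (X_mem N l) j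

lemma res_ratio_apply (l j : Fin (N + 1)) {W : (ProjSpace N k).Opens} (h : W ≤ chart N k j)
    (p : W) :
    ((((ProjSpace N k).presheaf.map (homOfLE h).op).hom (ratio l j)).1 p).val =
      Localization.mk (.X l) ⟨.X j, h p.2⟩ := by
  have := ProjectiveSpectrum.Proj.awayToSection_apply (polyGrading N k) (MvPolynomial.X j)
    (HomogeneousLocalization.Away.mk (polyGrading N k) (X_mem N j) 1 (MvPolynomial.X l)
      (by simpa using X_mem N l)) ⟨p.1, h p.2⟩
  refine this.trans ?_
  rw [HomogeneousLocalization.Away.val_mk, Localization.mk_eq_mk', IsLocalization.map_mk',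
    Localization.mk_eq_mk']
  simp

/-- `(X_j / X_i) * (X_l / X_j) = X_l / X_i`. -/
lemma ratio_mul_ratio (i j l : Fin (N + 1)) {W : (ProjSpace N k).Opens} (hi : W ≤ chart N k i)
    (hj : W ≤ chart N k j) :
    ((ProjSpace N k).presheaf.map (homOfLE hi).op).hom (ratio j i) *
      ((ProjSpace N k).presheaf.map (homOfLE hj).op).hom (ratio l j) =
    ((ProjSpace N k).presheaf.map (homOfLE hi).op).hom (ratio l i) := by
  refine Subtype.ext (funext fun p => HomogeneousLocalization.val_injective _ ?_)
  refine (HomogeneousLocalization.val_mul _ _).trans ?_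
  refine (congrArg₂ (· * ·) (res_ratio_apply j i hi p) (res_ratio_apply l j hj p)).trans
    (Eq.trans ?_ (res_ratio_apply l i hi p).symm)
  simp only [Localization.mk_mul, Localization.mk_eq_mk_iff, Localization.r_iff_exists]
  refine ⟨1, ?_⟩
  change 1 * (MvPolynomial.X i * (MvPolynomial.X j * MvPolynomial.X l)) =
    1 * (MvPolynomial.X i * MvPolynomial.X j * MvPolynomial.X l)
  ring

lemma ratio_self (i : Fin (N + 1)) : ratio (k := k) i i = 1 := by
  have : HomogeneousLocalization.Away.mk (polyGrading N k) (X_mem N i) 1 (MvPolynomial.X i)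
      (by simpa using X_mem N i) = 1 := by
    refine HomogeneousLocalization.val_injective _ ?_
    rw [HomogeneousLocalization.Away.val_mk, HomogeneousLocalization.val_one]
    simp
  rw [ratio, dehomog, this]
  exact map_one _

variable (N k) in
lemma iSup_chart : ⨆ j : ULift.{u} (Fin (N + 1)), chart N k j.down = ⊤ := by
  refine Proj.iSup_basicOpen_eq_top' _ (fun j : ULift.{u} (Fin (N + 1)) => MvPolynomial.X j.down)
    (fun j => ⟨1, X_mem N j.down⟩) ?_
  refine eq_top_iff.2 fun p _ => ?_
  induction p using MvPolynomial.induction_on with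
  | C a =>
    exact Subalgebra.algebraMap_mem _
      (⟨MvPolynomial.C a, MvPolynomial.isHomogeneous_C _ a⟩ : polyGrading N k 0)
  | add p q hp hq => exact add_mem (hp trivial) (hq trivial)
  | mul_X p j hp => exact mul_mem (hp trivial) (Algebra.subset_adjoin ⟨⟨j⟩, rfl⟩)

variable (N k) in
/-- The line bundle `O(1)` on `ℙ^N_k`: it is trivialised by `X_i` on `D₊(X_i)`, so that its
transition functions are `g i j = X_j / X_i`. -/
def O1 : LineBundle (ProjSpace N k) where
  ι := ULift.{u} (Fin (N + 1))
  U j := chart N k j.down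
  cover := iSup_chart N k
  g i j :=
    { val := ((ProjSpace N k).presheaf.map (homOfLE inf_le_left).op).hom (ratio j.down i.down)
      inv := ((ProjSpace N k).presheaf.map (homOfLE inf_le_right).op).hom (ratio i.down j.down)
      val_inv := by rw [ratio_mul_ratio, ratio_self, map_one]
      inv_val := by rw [ratio_mul_ratio, ratio_self, map_one] }
  cocycle i j l := by
    ext
    simp only [Scheme.resUnits, Units.val_mul, Units.coe_map]
    have hi : chart N k i.down ⊓ chart N k j.down ⊓ chart N k l.down ≤ chart N k i.down :=
      inf_le_left.trans inf_le_left
    have hj : chart N k i.down ⊓ chart N k j.down ⊓ chart N k l.down ≤ chart N k j.down :=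
      inf_le_left.trans inf_le_right
    exact ratio_mul_ratio i.down j.down l.down hi hj

end ProjSpace

/-! ### Smooth complete intersections of two quadrics -/

/-- `i : Z ⟶ ℙ^N_k` is a closed subscheme whose ideal sheaf is generated by two quadratic forms
`q`, `q'`, and `Z` is smooth over `k` of dimension `N - 2`, i.e. of codimension `2`. -/
structure IsSmoothIntersectionOfTwoQuadrics {N : ℕ} {k : Type u} [Field k] {Z : Scheme.{u}}
    (i : Z ⟶ ProjSpace N k) : Prop where
  isClosedImmersion : IsClosedImmersion i
  exists_equations : ∃ (q q' : MvPolynomial (Fin (N + 1)) k) (hq : q ∈ polyGrading N k 2)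
    (hq' : q' ∈ polyGrading N k 2), ∀ j : Fin (N + 1),
      i.ker.ideal ⟨ProjSpace.chart N k j, ProjSpace.isAffineOpen_chart j⟩ =
        Ideal.span {ProjSpace.dehomog q hq j, ProjSpace.dehomog q' hq' j}
  smooth : SmoothOfRelativeDimension (N - 2) (i ≫ ProjSpace.toSpec N k)

/-! ### The automorphism functor of a polarised scheme -/

section Aut

variable {S : Scheme.{u}}

/-- `Z_T = Z ×_S T`, as a `T`-scheme. -/
abbrev overProd (Z T : Over S) : Over T.left := Over.mk (pullback.snd Z.hom T.hom)

/-- The projection `Z_T ⟶ Z`. -/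
abbrev overProdFst (Z T : Over S) : (overProd Z T).left ⟶ Z.left := pullback.fst Z.hom T.hom

/-- The map `Z_{T'} ⟶ Z_T` induced by `σ : T' ⟶ T`. -/
abbrev overProdMap (Z : Over S) {T T' : Over S} (σ : T' ⟶ T) :
    (overProd Z T').left ⟶ (overProd Z T).left :=
  pullback.map Z.hom T'.hom Z.hom T.hom (𝟙 _) σ.left (𝟙 _) (by simp) (by simp)

/-- The base change `f_{T'} : Z_{T'} ⟶ Z_{T'}` of a `T`-morphism `f : Z_T ⟶ Z_T` along
`σ : T' ⟶ T`. -/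
def baseChangeHom (Z : Over S) {T T' : Over S} (σ : T' ⟶ T) (f : overProd Z T ⟶ overProd Z T) :
    overProd Z T' ⟶ overProd Z T' :=
  Over.homMk (pullback.lift (overProdMap Z σ ≫ f.left ≫ overProdFst Z T) (pullback.snd _ _) (by
      have hf : f.left ≫ pullback.snd Z.hom T.hom = pullback.snd Z.hom T.hom := Over.w f
      rw [Category.assoc, Category.assoc, pullback.condition, reassoc_of% hf,
        pullback.lift_snd_assoc, Category.assoc, Over.w σ])) (by
    simp only [Over.mk_hom]
    exact pullback.lift_snd _ _ _)

lemma baseChangeHom_fst (Z : Over S) {T T' : Over S} (σ : T' ⟶ T)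
    (f : overProd Z T ⟶ overProd Z T) :
    (baseChangeHom Z σ f).left ≫ pullback.fst Z.hom T'.hom =
      overProdMap Z σ ≫ f.left ≫ overProdFst Z T :=
  pullback.lift_fst _ _ _

lemma baseChangeHom_snd (Z : Over S) {T T' : Over S} (σ : T' ⟶ T)
    (f : overProd Z T ⟶ overProd Z T) :
    (baseChangeHom Z σ f).left ≫ pullback.snd Z.hom T'.hom = pullback.snd Z.hom T'.hom :=
  pullback.lift_snd _ _ _

lemma baseChangeHom_map (Z : Over S) {T T' : Over S} (σ : T' ⟶ T)
    (f : overProd Z T ⟶ overProd Z T) :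
    (baseChangeHom Z σ f).left ≫ overProdMap Z σ = overProdMap Z σ ≫ f.left := by
  have hf : f.left ≫ pullback.snd Z.hom T.hom = pullback.snd Z.hom T.hom := Over.w f
  apply pullback.hom_ext
  · rw [Category.assoc, Category.assoc, pullback.lift_fst, Category.comp_id, baseChangeHom_fst]
  · rw [Category.assoc, Category.assoc, pullback.lift_snd, ← Category.assoc, baseChangeHom_snd, hf,
      pullback.lift_snd]

lemma baseChangeHom_id (Z : Over S) {T T' : Over S} (σ : T' ⟶ T) :
    baseChangeHom Z σ (𝟙 _) = 𝟙 _ := by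
  apply Over.OverMorphism.ext
  apply pullback.hom_ext
  · rw [baseChangeHom_fst, Over.id_left, Over.id_left, Category.id_comp, Category.id_comp,
      pullback.lift_fst, Category.comp_id]
  · rw [baseChangeHom_snd]; simp

lemma baseChangeHom_comp (Z : Over S) {T T' : Over S} (σ : T' ⟶ T)
    (f g : overProd Z T ⟶ overProd Z T) :
    baseChangeHom Z σ (f ≫ g) = baseChangeHom Z σ f ≫ baseChangeHom Z σ g := by
  apply Over.OverMorphism.ext
  apply pullback.hom_ext
  · rw [baseChangeHom_fst, Over.comp_left, Over.comp_left, Category.assoc, Category.assoc,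
      baseChangeHom_fst, ← Category.assoc (baseChangeHom Z σ f).left, baseChangeHom_map,
      Category.assoc]
  · rw [baseChangeHom_snd, Over.comp_left, Category.assoc, baseChangeHom_snd, baseChangeHom_snd]

/-- The functoriality in `T` of the functor of automorphisms `T ↦ Aut_T(Z_T)`:
the group homomorphism `Aut_T(Z_T) ⟶ Aut_{T'}(Z_{T'})` given by base change along `σ`. -/
def autBaseChange (Z : Over S) {T T' : Over S} (σ : T' ⟶ T) :
    Aut (overProd Z T) →* Aut (overProd Z T') where
  toFun f :=
    { hom := baseChangeHom Z σ f.hom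
      inv := baseChangeHom Z σ f.inv
      hom_inv_id := by rw [← baseChangeHom_comp, f.hom_inv_id, baseChangeHom_id]
      inv_hom_id := by rw [← baseChangeHom_comp, f.inv_hom_id, baseChangeHom_id] }
  map_one' := by
    ext1
    exact baseChangeHom_id Z σ
  map_mul' f g := by
    ext1
    exact baseChangeHom_comp Z σ g.hom f.hom

/-- The `T`-points of `Aut_S(Z, L)`: the `T`-automorphisms `f` of `Z_T` which preserve the class
of `L` in the relative Picard group `Pic(Z_T) / Pic(T)`, that is such that
`f^* L_T ≃ L_T ⊗ M_{Z_T}` for some line bundle `M` on `T`. -/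
def polarizedAut (Z : Over S) (L : LineBundle Z.left) (T : Over S) : Set (Aut (overProd Z T)) :=
  {f | ∃ M : LineBundle T.left,
    ((L.pullback (overProdFst Z T)).pullback f.hom.left).Isomorphic
      ((L.pullback (overProdFst Z T)).tensor (M.pullback (overProd Z T).hom))}

end Aut

/-! ### The tangent space at the identity -/

section Tangent

variable {k : Type u} [Field k]

/-- `Spec R` as a `k`-scheme. -/
abbrev specOver (k : Type u) [Field k] (R : Type u) [CommRing R] [Algebra k R] :
    Over (Spec (.of k)) :=
  Over.mk (Spec.map (CommRingCat.ofHom (algebraMap k R)))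

/-- The morphism of `k`-schemes `Spec R' ⟶ Spec R` given by `φ : R →ₐ[k] R'`. -/
abbrev specOverMap {R R' : Type u} [CommRing R] [CommRing R'] [Algebra k R] [Algebra k R']
    (φ : R →ₐ[k] R') : specOver k R' ⟶ specOver k R :=
  Over.homMk (Spec.map (CommRingCat.ofHom φ.toRingHom)) (by
    simp only [Over.mk_hom]
    rw [← Spec.map_comp, ← CommRingCat.ofHom_comp, AlgHom.toRingHom_eq_coe, φ.comp_algebraMap])

/-- The endomorphism `ε ↦ a ε` of the `k`-algebra of dual numbers `k[ε]`. -/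
def dualScale (a : k) : DualNumber k →ₐ[k] DualNumber k :=
  TrivSqZeroExt.map (a • LinearMap.id)

/-- The tangent space at the identity of `Aut_k(Z, L)`: the elements of `Aut_k(Z, L)(k[ε])` that
specialise to the identity at `ε = 0`. -/
def polarizedAutTangent (Z : Over (Spec (.of k))) (L : LineBundle Z.left) :
    Set (Aut (overProd Z (specOver k (DualNumber k)))) :=
  {f | f ∈ polarizedAut Z L (specOver k (DualNumber k)) ∧
    autBaseChange Z (specOverMap (TrivSqZeroExt.fstHom k k k)) f = 1}

/-- The dimension of the tangent space at the identity of `Aut_k(Z, L)`. As for every group functor,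
the addition of tangent vectors is the group law, and the product with a scalar `a` is
induced by `ε ↦ a ε`. The dimension is the largest `m` such that `k ^ m` embeds linearly. -/
def polarizedAutTangentDim (Z : Over (Spec (.of k))) (L : LineBundle Z.left) : ℕ∞ :=
  ⨆ (m : ℕ) (_ : ∃ φ : (Fin m → k) → Aut (overProd Z (specOver k (DualNumber k))),
    Function.Injective φ ∧
    (∀ v, φ v ∈ polarizedAutTangent Z L) ∧
    (∀ v w, φ (v + w) = φ v * φ w) ∧
    (∀ (a : k) v, φ (a • v) = autBaseChange Z (specOverMap (dualScale a)) (φ v))), (m : ℕ∞)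

end Tangent

end AlgebraicGeometry
end

/-! Write $Z=\{q=q'=0\}$ in $V=k^{N+1}$, and let $\beta,\beta'$ be the polar forms of $q,q'$. In
characteristic $2$ they are alternating, and $\dim V=N+1$ is even. If $\beta$ is nondegenerate, let
$A$ be the operator with $\beta(Ax,y)=\beta'(x,y)$. It is self-adjoint for $\beta$, and since
$\beta$ and $\beta'$ are alternating, $\beta(x,P(A)x)=\beta'(x,P(A)x)=0$ for every polynomial $P$
(`polar_self_aeval`, `polar_self_aeval'`). Hence $x\mapsto x+\varepsilon P(A)x$ preserves $q$ and
$q'$, and it defines an automorphism of $Z$ over $k[\varepsilon]$ that fixes the class of $O(1)$ and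
reduces to the identity. The tangent vectors used are those with $P$ of degree at most $(N-1)/2$ and
without constant term, since scalar operators act trivially.

Such a tangent vector is trivial only if every vector of the base locus $q=q'=0$ is an eigenvector
of $P(A)$. This forces $P$ to be constant when $2\deg P<\dim V$
(`IsNonsingularPencil.eq_C_of_forall_eigenvector`). The eigenspaces of $A$ are the radicals of the
degenerate members of the pencil: their dimension is at least $2$ by parity and at most $2$ by
smoothness. Translation by such a radical moves any vector into the base locus, so $P(A)$ is a
scalar $c$ on all of $V$, whereas $\ker(P(A)-c)$ has dimension at most $2\deg P$ for nonconstant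
$P$.

Two inputs remain. Smoothness has to be turned into the Jacobian criterion for the pencil
(`IsSmoothIntersectionOfTwoQuadrics.isNonsingularPencil`), and some member of the pencil must have a
nondegenerate polar form (`IsNonsingularPencil.exists_nondegenerate`). If none had, the generic
member would have a radical of dimension at least $2$. After the substitution $X\mapsto X^2$ it
would contain an isotropic polynomial vector, whose values and coefficients yield a singular point
of the base locus. -/

noncomputable section

/-! ### Alternating forms in characteristic two: the rank is even. -/

section Alternating

variable {K V : Type*} [Field K] [CharP K 2] [AddCommGroup V] [Module K V]

/-- In characteristic two, alternating matrices of odd size are singular. -/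
lemma Matrix.det_eq_zero_of_alternating_of_odd {ι : Type*} [Fintype ι] [DecidableEq ι]
    (A : Matrix ι ι K) (hs : A.IsSymm) (hd : ∀ i, A i i = 0) (hodd : Odd (Fintype.card ι)) :
    A.det = 0 := by
  rw [Matrix.det_apply]
  -- By symmetry of the matrix, $\sigma$ and $\sigma^{-1}$ contribute equal terms, which cancel in
  -- characteristic $2$. A permutation with $\sigma=\sigma^{-1}$ of a set of odd size has a fixed
  -- point, so its term contains a diagonal entry and vanishes.
  refine Finset.sum_involution (fun σ _ => σ⁻¹) ?_ ?_ (fun _ _ => Finset.mem_univ _)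
    (fun σ _ => inv_inv σ)
  · intro σ _
    have : ∏ i, A (σ⁻¹ i) i = ∏ i, A (σ i) i := by
      rw [← Equiv.prod_comp σ (fun i => A (σ⁻¹ i) i)]
      exact Finset.prod_congr rfl fun i _ => by simp [hs.apply]
    rw [this, Equiv.Perm.sign_inv]
    exact CharTwo.add_self_eq_zero _
  · intro σ _ h hσ
    apply h
    obtain ⟨i, hi⟩ : ∃ i, σ i = i := by
      have h2 : σ ^ 2 ^ 1 = 1 := by
        rw [pow_one, pow_two]; nth_rw 1 [← hσ]; simp
      exact Equiv.Perm.exists_fixed_point_of_prime (p := 2) (n := 1)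
        (by simpa [← even_iff_two_dvd] using hodd) h2
    rw [Finset.prod_eq_zero (Finset.mem_univ i) (by rw [hi, hd]), smul_zero]

lemma LinearMap.BilinForm.isSymm_of_isAlt {B : LinearMap.BilinForm K V} (hB : B.IsAlt) :
    LinearMap.IsSymm B :=
  ⟨fun x y => by simpa [CharTwo.neg_eq] using LinearMap.IsAlt.neg hB x y⟩

variable [FiniteDimensional K V]

/-- In odd dimension the Gram matrix would be singular. The usual argument $\det A=\det A^T=-\det A$
says nothing in characteristic $2$, hence the expansion over permutations above. -/
lemma LinearMap.BilinForm.even_finrank_of_isAlt {B : LinearMap.BilinForm K V} (hB : B.IsAlt)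
    (hn : B.Nondegenerate) : Even (Module.finrank K V) := by
  by_contra hodd
  rw [Nat.not_even_iff_odd] at hodd
  have b := Module.finBasis K V
  refine (LinearMap.BilinForm.nondegenerate_iff_det_ne_zero b).1 hn ?_
  refine Matrix.det_eq_zero_of_alternating_of_odd _ ?_ ?_ (by simpa using hodd)
  · ext i j
    simpa [LinearMap.BilinForm.toMatrix_apply] using (LinearMap.BilinForm.isSymm_of_isAlt hB).eq (b
      j) (b i)
  · intro i
    simpa [LinearMap.BilinForm.toMatrix_apply] using hB (b i)

/-- The rank of an alternating form is even. -/
lemma LinearMap.BilinForm.even_finrank_add_finrank_ker {B : LinearMap.BilinForm K V}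
    (hB : B.IsAlt) : Even (Module.finrank K V + Module.finrank K (LinearMap.ker B)) := by
  -- The form is nondegenerate on a complement $W$ of its kernel, so $\dim W$ is even, and the sum
  -- in question is $\dim W+2\dim\ker B$.
  obtain ⟨W, hW⟩ := (LinearMap.ker B).exists_isCompl
  have h := (LinearMap.BilinForm.isSymm_of_isAlt hB).nondegenerate_restrict_of_isCompl_ker hW.symm
  have hev := LinearMap.BilinForm.even_finrank_of_isAlt (B := B.domRestrict₁₂ W W)
    (fun x => hB x.1) h
  have := Submodule.finrank_add_eq_of_isCompl hW
  rw [← this, add_comm, ← add_assoc]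
  exact Even.add ⟨_, rfl⟩ hev

/-- A degenerate alternating form on a space of even dimension has a kernel of dimension `≥ 2`. -/
lemma LinearMap.BilinForm.two_le_finrank_ker {B : LinearMap.BilinForm K V} (hB : B.IsAlt)
    (hV : Even (Module.finrank K V)) (hk : LinearMap.ker B ≠ ⊥) :
    2 ≤ Module.finrank K (LinearMap.ker B) := by
  have h1 : Even (Module.finrank K (LinearMap.ker B)) :=
    (Nat.even_add.1 (LinearMap.BilinForm.even_finrank_add_finrank_ker hB)).1 hV
  have h2 : Module.finrank K (LinearMap.ker B) ≠ 0 := by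
    rwa [Ne, Submodule.finrank_eq_zero]
  obtain ⟨r, hr⟩ := h1
  omega

end Alternating
end

/-! ### Nonsingular pencils of quadratic forms and their self-adjoint operator. -/

noncomputable section

section Pencil

open QuadraticMap Polynomial

variable {k V : Type*} [Field k] [AddCommGroup V] [Module k V]

/-- The Jacobian criterion for the intersection of the quadrics `q = 0` and `q' = 0`. -/
def IsNonsingularPencil (q q' : QuadraticForm k V) : Prop :=
  ∀ (x : V) (a c : k), a ≠ 0 ∨ c ≠ 0 → q x = 0 → q' x = 0 →
    (∀ y, a * polar q x y + c * polar q' x y = 0) → x = 0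

lemma IsNonsingularPencil.symm {q q' : QuadraticForm k V} (h : IsNonsingularPencil q q') :
    IsNonsingularPencil q' q := fun x a c hac hq hq' hp =>
  h x c a hac.symm hq' hq fun y => by rw [add_comm, hp y]

lemma QuadraticForm.polar_add_smul (q q' : QuadraticForm k V) (t : k) (x y : V) :
    polar (q + t • q') x y = polar q x y + t * polar q' x y := by
  simp only [polar, add_apply, smul_apply, smul_eq_mul]
  ring

/-- The base locus depends only on the pencil, and the multipliers $(a,c)$ of the new generators
correspond to $(a+ct,c)$ for the old ones. -/
lemma IsNonsingularPencil.add_smul {q q' : QuadraticForm k V} (h : IsNonsingularPencil q q')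
    (t : k) : IsNonsingularPencil q (q' + t • q) := by
  intro x a c hac hq hq' hp
  refine h x (a + c * t) c ?_ hq (by simpa [hq] using hq') fun y => ?_
  · by_cases hc : c = 0
    · simpa [hc] using hac
    · exact Or.inr hc
  · rw [← hp y, QuadraticForm.polar_add_smul]
    ring

lemma exists_quadratic_root [IsAlgClosed k] {a : k} (b c : k) (ha : a ≠ 0) :
    ∃ t, a * t ^ 2 + b * t + c = 0 := by
  obtain ⟨t, ht⟩ := IsAlgClosed.exists_root (C a * X ^ 2 + C b * X + C c)
    (by rw [degree_quadratic ha]; decide)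
  exact ⟨t, by simpa using ht⟩

lemma QuadraticForm.map_add_smul (q : QuadraticForm k V) (x y : V) (t : k) :
    q (x + t • y) = q y * t ^ 2 + polar q x y * t + q x := by
  rw [QuadraticMap.map_add q, polar_smul_right, QuadraticMap.map_smul]
  simp only [smul_eq_mul]
  ring

lemma QuadraticForm.polar_self_of_charTwo [CharP k 2] (q : QuadraticForm k V) (x : V) : polar q x x
    = 0 := by
  rw [polar_self, nsmul_eq_mul, Nat.cast_ofNat, CharTwo.two_eq_zero, zero_mul]

lemma le_finrank_ker_add_one [FiniteDimensional k V] {W : Submodule k V} (ρ : W →ₗ[k] k) :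
    Module.finrank k W ≤ Module.finrank k (LinearMap.ker ρ) + 1 := by
  rw [← ρ.finrank_range_add_finrank_ker, add_comm]
  gcongr
  exact (Submodule.finrank_le _).trans (Module.finrank_self k).le

variable {q q' : QuadraticForm k V} {A : Module.End k V}

/-- Nondegeneracy identifies $V$ with its dual through the polar form of $q$, and $A$ is the polar
form of $q'$ read through this identification. -/
lemma exists_polar_operator [FiniteDimensional k V]
    (hq : ∀ x, (∀ y, polar q x y = 0) → x = 0) (q' : QuadraticForm k V) :
    ∃ A : Module.End k V, ∀ x y, polar q (A x) y = polar q' x y := by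
  have hinj : Function.Injective (polarBilin q) :=
    (injective_iff_map_eq_zero _).2 fun x hx => hq x fun y => LinearMap.congr_fun hx y
  let e := LinearMap.linearEquivOfInjective (polarBilin q) hinj Subspace.dual_finrank_eq.symm
  refine ⟨e.symm.toLinearMap ∘ₗ polarBilin q', fun x y => ?_⟩
  exact LinearMap.congr_fun (e.apply_symm_apply (polarBilin q' x)) y

lemma polar_pow_left (hA : ∀ x y, polar q (A x) y = polar q' x y) (j : ℕ) (x y : V) :
    polar q ((A ^ j) x) y = polar q x ((A ^ j) y) := by
  induction j generalizing x y with
  | zero => rfl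
  | succ j ih =>
    rw [pow_succ, Module.End.mul_apply, Module.End.mul_apply, ih, hA, polar_comm, ← hA, polar_comm,
      ← Module.End.mul_apply, ← Module.End.mul_apply, ← pow_succ, ← pow_succ']

/-- The map $g$ sends $\ker(fg)$ into $\ker f$, with kernel contained in $\ker g$. -/
lemma LinearMap.finrank_ker_mul_le [FiniteDimensional k V] (f g : Module.End k V) :
    Module.finrank k (LinearMap.ker (f * g)) ≤
      Module.finrank k (LinearMap.ker f) + Module.finrank k (LinearMap.ker g) := by
  have hg : ∀ x ∈ LinearMap.ker (f * g), g x ∈ LinearMap.ker f := fun x hx => hx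
  have h := (g.restrict hg).finrank_range_add_finrank_ker
  rw [← h]
  gcongr
  · exact Submodule.finrank_le _
  · refine LinearMap.finrank_le_finrank_of_injective
      (f := ((LinearMap.ker (f * g)).subtype ∘ₗ (LinearMap.ker (g.restrict hg)).subtype).codRestrict
        (LinearMap.ker g) fun x => congrArg Subtype.val (LinearMap.mem_ker.1 x.2)) ?_
    exact fun x y hxy => Subtype.ext (Subtype.ext (Subtype.ext_iff.1 hxy :))

/-- The radical of the member `q' + t q` of the pencil is the eigenspace of `A` for `t`. -/
lemma polar_eq_zero_of_mem_ker [CharP k 2] (hA : ∀ x y, polar q (A x) y = polar q' x y)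
    (t : k) (x : V) (hx : x ∈ LinearMap.ker (A - algebraMap k _ t)) (y : V) : polar (q' + t • q) x
      y = 0 := by
  have hx' : A x = t • x := by
    simpa [sub_eq_zero, Module.algebraMap_end_apply] using hx
  rw [QuadraticForm.polar_add_smul, ← hA, hx', polar_smul_left, smul_eq_mul]
  exact CharTwo.add_self_eq_zero _

/-- This is the source of the infinitesimal automorphisms. By self-adjointness
$\beta(x,A^{2i}x)=\beta(A^ix,A^ix)$ and $\beta(x,A^{2i+1}x)=\beta'(A^ix,A^ix)$, and both vanish
because polar forms are alternating in characteristic $2$. -/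
lemma polar_self_aeval [CharP k 2] (hA : ∀ x y, polar q (A x) y = polar q' x y) (P : k[X]) (x : V) :
    polar q x (aeval A P x) = 0 := by
  induction P using Polynomial.induction_on' with
  | add P Q hP hQ => rw [map_add, LinearMap.add_apply, polar_add_right, hP, hQ, add_zero]
  | monomial n a =>
    rw [aeval_monomial, ← Algebra.smul_def, LinearMap.smul_apply, polar_smul_right]
    obtain ⟨i, rfl | rfl⟩ := Nat.even_or_odd' n
    · rw [two_mul, pow_add, Module.End.mul_apply, ← polar_pow_left hA,
        QuadraticForm.polar_self_of_charTwo, smul_zero]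
    · rw [two_mul, add_assoc, pow_add, pow_succ', Module.End.mul_apply, ← polar_pow_left hA,
        polar_comm, Module.End.mul_apply, hA, QuadraticForm.polar_self_of_charTwo, smul_zero]

/-- Here $\beta'(x,P(A)x)=\beta(x,AP(A)x)$, which is the preceding case for the polynomial $XP$. -/
lemma polar_self_aeval' [CharP k 2] (hA : ∀ x y, polar q (A x) y = polar q' x y) (P : k[X]) (x : V)
    :
    polar q' x (aeval A P x) = 0 := by
  rw [← hA, ← pow_one A, polar_pow_left hA, pow_one, ← Module.End.mul_apply]
  have : aeval A (X * P) = A * aeval A P := by rw [map_mul, aeval_X]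
  rw [← this]
  exact polar_self_aeval hA (X * P) x

/-- Over an algebraically closed field $P$ splits, and kernel dimensions are subadditive under
products of operators. -/
lemma finrank_ker_aeval_le [IsAlgClosed k] [FiniteDimensional k V] {d : ℕ}
    (hd : ∀ t : k, Module.finrank k (LinearMap.ker (A - algebraMap k _ t)) ≤ d) (P : k[X])
    (hP : P ≠ 0) : Module.finrank k (LinearMap.ker (aeval A P)) ≤ d * P.natDegree := by
  induction hn : P.natDegree generalizing P with
  | zero =>
    obtain ⟨c, rfl⟩ := natDegree_eq_zero.1 hn
    have hc : c ≠ 0 := by rintro rfl; simp at hP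
    have : LinearMap.ker (aeval A (C c)) = ⊥ := by
      refine LinearMap.ker_eq_bot'.2 fun x hx => ?_
      rw [aeval_C, Module.algebraMap_end_apply] at hx
      exact (smul_eq_zero.1 hx).resolve_left hc
    rw [this, finrank_bot]; simp
  | succ n ih =>
    obtain ⟨t, ht⟩ := IsAlgClosed.exists_root P fun h => by
      rw [natDegree_eq_zero_iff_degree_le_zero.2 h.le] at hn; omega
    obtain ⟨Q, rfl⟩ := dvd_iff_isRoot.2 ht
    have hQ : Q ≠ 0 := right_ne_zero_of_mul hP
    rw [natDegree_mul (X_sub_C_ne_zero t) hQ, natDegree_X_sub_C] at hn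
    rw [map_mul, mul_add, mul_one, add_comm]
    refine (LinearMap.finrank_ker_mul_le _ _).trans (add_le_add ?_ (ih Q hQ (by omega)))
    have : aeval A (X - C t) = A - algebraMap k _ t := by rw [map_sub, aeval_X, aeval_C]
    rw [this]
    exact hd t

/-- The eigenspace is the radical of the alternating polar form of $q'+tq$; on an even-dimensional
space a nonzero radical has dimension at least $2$. -/
lemma two_le_finrank_eigenspace [CharP k 2] [FiniteDimensional k V]
    (hV : Even (Module.finrank k V))
    (hq : ∀ x, (∀ y, polar q x y = 0) → x = 0)
    (hA : ∀ x y, polar q (A x) y = polar q' x y) {t : k} (ht : A.HasEigenvalue t) :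
    2 ≤ Module.finrank k (LinearMap.ker (A - algebraMap k _ t)) := by
  have hker : LinearMap.ker (polarBilin (q' + t • q)) = LinearMap.ker (A - algebraMap k _ t) := by
    ext x
    refine ⟨fun hx => ?_, fun hx => LinearMap.ext fun y => polar_eq_zero_of_mem_ker hA t x hx y⟩
    refine hq _ fun y => ?_
    have h0 : polar (q' + t • q) x y = 0 := LinearMap.congr_fun (LinearMap.mem_ker.1 hx) y
    rw [LinearMap.sub_apply, polar_sub_left, hA, Module.algebraMap_end_apply, polar_smul_left,
      smul_eq_mul, CharTwo.sub_eq_add, ← QuadraticForm.polar_add_smul, h0]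
  rw [← hker]
  refine LinearMap.BilinForm.two_le_finrank_ker
    (fun x => QuadraticForm.polar_self_of_charTwo _ x) hV ?_
  rw [hker]
  intro hb
  apply ht
  rw [← hb]
  exact Module.End.eigenspace_def

variable [IsAlgClosed k]

/-- A quadratic form on a space of dimension `≥ 2` is isotropic. -/
lemma QuadraticForm.exists_ne_zero_eq_zero (q : QuadraticForm k V)
    (h : 2 ≤ Module.finrank k V) : ∃ w, w ≠ 0 ∧ q w = 0 := by
  have : Module.Finite k V := Module.finite_of_finrank_pos (by omega)
  obtain ⟨u, v, huv⟩ : ∃ u v : V, LinearIndependent k ![u, v] := by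
    have b := Module.finBasis k V
    refine ⟨b ⟨0, by omega⟩, b ⟨1, by omega⟩, ?_⟩
    have := b.linearIndependent.comp ![⟨0, by omega⟩, ⟨1, by omega⟩] (by
      intro i j; fin_cases i <;> fin_cases j <;> simp)
    convert this using 1
    ext i; fin_cases i <;> rfl
  by_cases hv : q v = 0
  · exact ⟨v, huv.ne_zero 1, hv⟩
  · obtain ⟨t, ht⟩ := exists_quadratic_root (polar q u v) (q u) hv
    refine ⟨u + t • v, fun h0 => ?_, by rw [QuadraticForm.map_add_smul, ht]⟩
    have := LinearIndependent.pair_iff.1 huv 1 t (by simpa using h0)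
    exact one_ne_zero this.1

variable [CharP k 2]

/-- An additive quadratic form in characteristic two is the square of a linear form. -/
lemma QuadraticForm.exists_sq_eq (q : QuadraticForm k V) (hq : ∀ x y, polar q x y = 0) :
    ∃ ρ : V →ₗ[k] k, ∀ x, ρ x ^ 2 = q x := by
  -- Square roots are unique in characteristic $2$, so the pointwise choice is automatically linear.
  choose r hr using fun x => IsAlgClosed.exists_pow_nat_eq (q x) two_pos
  refine ⟨{ toFun := r, map_add' := fun x y => ?_, map_smul' := fun a x => ?_ }, hr⟩
  · apply frobenius_inj k 2
    simp only [frobenius_def, add_pow_char, hr, QuadraticMap.map_add q, hq, add_zero]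
  · apply frobenius_inj k 2
    simp only [frobenius_def, mul_pow, hr, QuadraticMap.map_smul, smul_eq_mul, RingHom.id_apply]
    ring

lemma QuadraticForm.exists_linearForm_sq_eq {q' : QuadraticForm k V} {W : Submodule k V}
    (hW : ∀ x ∈ W, ∀ y, polar q' x y = 0) :
    ∃ ρ : W →ₗ[k] k, ∀ x : W, ρ x ^ 2 = q' x := by
  exact QuadraticForm.exists_sq_eq (q'.comp W.subtype) fun x y => hW x x.2 y

variable [FiniteDimensional k V]

/-- The members of a nonsingular pencil have radicals of dimension at most two. -/
lemma IsNonsingularPencil.finrank_radical_le {q q' : QuadraticForm k V}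
    (h : IsNonsingularPencil q q') {W : Submodule k V}
    (hW : ∀ x ∈ W, ∀ y, polar q' x y = 0) : Module.finrank k W ≤ 2 := by
  by_contra! hlt
  -- On $W$ one has $q'=\rho^2$. If $\dim W\ge3$, then $\ker\rho$ has dimension at least $2$ and
  -- contains a nonzero zero of $q$: a base point in the radical of $q'$, which nonsingularity
  -- forbids.
  obtain ⟨ρ, hρ⟩ := QuadraticForm.exists_linearForm_sq_eq hW
  obtain ⟨w, hw, hqw⟩ := QuadraticForm.exists_ne_zero_eq_zero
    (q.comp (W.subtype ∘ₗ (LinearMap.ker ρ).subtype))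
    (by have := le_finrank_ker_add_one ρ; omega)
  refine hw (Subtype.ext (Subtype.ext (h w.1.1 0 1 (by simp) hqw ?_ fun y => ?_)))
  · rw [← hρ, LinearMap.mem_ker.1 w.2]; simp
  · simp [hW w.1 w.1.2]

/-- Translating by a two-dimensional radical, every vector can be moved into the
intersection of the two quadrics. -/
lemma IsNonsingularPencil.exists_add_mem {q q' : QuadraticForm k V}
    (h : IsNonsingularPencil q q') {W : Submodule k V}
    (hW : ∀ x ∈ W, ∀ y, polar q' x y = 0) (h2 : 2 ≤ Module.finrank k W) (y : V) :
    ∃ z ∈ W, q (y + z) = 0 ∧ q' (y + z) = 0 := by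
  obtain ⟨ρ, hρ⟩ := QuadraticForm.exists_linearForm_sq_eq hW
  have hzero : ∀ w : W, q w = 0 → q' w = 0 → w = 0 := fun w hw hw' =>
    Subtype.ext (h w 0 1 (by simp) hw hw' fun y => by simp [hW w w.2])
  -- Since $q$ and $q'$ have no common nonzero zero on $W$, there are $e,f\in W$ with $q'(e)\ne0$,
  -- $q'(f)=0$ and $q(f)\ne0$.
  obtain ⟨e, he⟩ : ∃ e : W, q' e ≠ 0 := by
    by_contra! he
    obtain ⟨w, hw, hqw⟩ := QuadraticForm.exists_ne_zero_eq_zero (q.comp W.subtype) h2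
    exact hw (hzero w hqw (he w))
  obtain ⟨f, hf, hf0⟩ : ∃ f : W, f ≠ 0 ∧ ρ f = 0 := by
    have : LinearMap.ker ρ ≠ ⊥ := fun hb => by
      have := le_finrank_ker_add_one ρ
      rw [hb, finrank_bot] at this
      omega
    obtain ⟨f, hf, hf0⟩ := (LinearMap.ker ρ).exists_mem_ne_zero_of_ne_bot this
    exact ⟨f, hf0, hf⟩
  have hqf' : q' f = 0 := by rw [← hρ, hf0]; simp
  have hqf : q f ≠ 0 := fun hqf => hf (hzero f hqf hqf')
  have hpol : ∀ x w : V, w ∈ W → polar q' x w = 0 := fun x w hw => by rw [polar_comm, hW w hw]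
  -- Because $W$ is in the radical of $q'$, $q'(y+\alpha e+\beta f)=q'(y)+\alpha^2q'(e)$ does not
  -- involve $\beta$. So $\alpha$ is chosen to kill $q'$, and then $\beta$ to kill $q$.
  obtain ⟨α, hα⟩ := exists_quadratic_root 0 (q' y) he
  obtain ⟨β, hβ⟩ := exists_quadratic_root (polar q (y + α • e.1) f) (q (y + α • e.1)) hqf
  refine ⟨α • e.1 + β • f.1, W.add_mem (W.smul_mem _ e.2) (W.smul_mem _ f.2), ?_, ?_⟩
  · rw [← add_assoc, QuadraticForm.map_add_smul, hβ]
  · rw [← add_assoc, QuadraticForm.map_add_smul, QuadraticForm.map_add_smul, hqf',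
      hpol _ _ f.2, hpol _ _ e.2]
    linear_combination hα

/-! ### Polynomials in the self-adjoint operator of the pencil -/

lemma IsNonsingularPencil.finrank_eigenspace_le (h : IsNonsingularPencil q q')
    (hA : ∀ x y, polar q (A x) y = polar q' x y) (t : k) :
    Module.finrank k (LinearMap.ker (A - algebraMap k _ t)) ≤ 2 :=
  (h.add_smul t).finrank_radical_le (polar_eq_zero_of_mem_ker hA t)

/-- A polynomial of degree less than half the dimension, evaluated at the operator of a nonsingular
pencil, is not scalar on all the vectors of the base locus, unless it is constant. -/
lemma IsNonsingularPencil.eq_C_of_forall_eigenvector (h : IsNonsingularPencil q q')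
    (hV : Even (Module.finrank k V)) (hq : ∀ x, (∀ y, polar q x y = 0) → x = 0)
    (hA : ∀ x y, polar q (A x) y = polar q' x y) (P : k[X])
    (hP : 2 * P.natDegree < Module.finrank k V)
    (hev : ∀ x, x ≠ 0 → q x = 0 → q' x = 0 → ∃ c : k, aeval A P x = c • x) : ∃ c, P = C c := by
  have hnt : Nontrivial V := Module.nontrivial_of_finrank_pos (R := k) (by omega)
  obtain ⟨t, ht⟩ := Module.End.exists_eigenvalue A
  -- For one fixed eigenvalue $t$, translation by the $t$-eigenspace moves any vector into the base
  -- locus.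
  have hmove : ∀ y, ∃ z, A z = t • z ∧ q (y + z) = 0 ∧ q' (y + z) = 0 := fun y => by
    obtain ⟨z, hz, hz1, hz2⟩ := (h.add_smul t).exists_add_mem (polar_eq_zero_of_mem_ker hA t)
      (two_le_finrank_eigenspace hV hq hA ht) y
    refine ⟨z, by simpa [sub_eq_zero, Module.algebraMap_end_apply] using hz, hz1, ?_⟩
    simpa [hz1] using hz2
  have hev' : ∀ x, q x = 0 → q' x = 0 → ∃ c : k, aeval A P x = c • x := fun x h1 h2 => by
    by_cases hx : x = 0
    · exact ⟨0, by simp [hx]⟩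
    · exact hev x hx h1 h2
  have haev : ∀ {s : k} {x : V}, A x = s • x → aeval A P x = P.eval s • x := fun {s x} hx =>
    Module.End.aeval_apply_of_mem_apply_eq_smul hx
  -- Move an $s$-eigenvector $y$ to a base point $y+z$. Here $z\ne0$, as otherwise $y$ would be a
  -- singular base point. If $P(s)\ne P(t)$, then $y$ and $z$ are independent, and $y+z$ cannot be
  -- an eigenvector of $P(A)$.
  have hroot : ∀ s, A.HasEigenvalue s → P.eval s = P.eval t := by
    intro s hs
    by_contra hst
    obtain ⟨y, hy⟩ := hs.exists_hasEigenvector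
    obtain ⟨z, hz, hz1, hz2⟩ := hmove y
    have hz0 : z ≠ 0 := by
      rintro rfl
      rw [add_zero] at hz1 hz2
      refine hy.2 (h y s 1 (by simp) hz1 hz2 fun w => ?_)
      rw [one_mul, ← hA, hy.apply_eq_smul, polar_smul_left]
      exact CharTwo.add_self_eq_zero _
    obtain ⟨c, hc⟩ := hev' _ hz1 hz2
    rw [map_add, haev hz, haev hy.apply_eq_smul] at hc
    have hc1 : (P.eval s - c) • y = (c - P.eval t) • z := by
      rw [sub_smul, sub_smul, sub_eq_sub_iff_add_eq_add, hc, smul_add, add_comm]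
    have hc2 := congrArg (aeval A P) hc1
    rw [map_smul, map_smul, haev hz, haev hy.apply_eq_smul, smul_comm, hc1, smul_comm,
      ← sub_eq_zero, ← smul_sub, ← sub_smul, smul_smul, smul_eq_zero] at hc2
    have hc3 := hc2.resolve_right hz0
    have hct : c = P.eval t := by
      rcases mul_eq_zero.1 hc3 with h0 | h0
      · exact sub_eq_zero.1 h0
      · exact absurd (sub_eq_zero.1 h0) hst
    rw [hct, sub_self, zero_smul, smul_eq_zero] at hc1
    exact hc1.elim (fun h0 => hst (sub_eq_zero.1 h0)) hy.2
  -- By spectral mapping, the eigenvalue of $P(A)$ at a base point is $P(s)$ for some eigenvalue $s$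
  -- of $A$, hence equals $P(t)$.
  have hkill : ∀ x, q x = 0 → q' x = 0 → aeval A P x = P.eval t • x := by
    intro x h1 h2
    by_cases hx : x = 0
    · simp [hx]
    obtain ⟨c, hc⟩ := hev' x h1 h2
    have hce : (aeval A P).HasEigenvalue c :=
      Module.End.hasEigenvalue_of_hasEigenvector (x := x)
        ⟨Module.End.mem_eigenspace_iff.2 hc, hx⟩
    rw [Module.End.hasEigenvalue_iff_mem_spectrum,
      spectrum.map_polynomial_aeval_of_nonempty A P
        ⟨t, Module.End.hasEigenvalue_iff_mem_spectrum.1 ht⟩] at hce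
    obtain ⟨s, hs, hsc⟩ := hce
    rw [hc, ← hsc]
    exact congrArg (· • x) (hroot s (Module.End.hasEigenvalue_iff_mem_spectrum.2 hs))
  refine ⟨P.eval t, ?_⟩
  by_contra hne
  -- Every vector is the difference of a base point and a $t$-eigenvector, and $P(A)$ is
  -- multiplication by $P(t)$ on both.
  have hker : aeval A (P - C (P.eval t)) = 0 := by
    ext y
    obtain ⟨z, hz, hz1, hz2⟩ := hmove y
    have h3 := hkill _ hz1 hz2
    rw [map_add, haev hz, smul_add, add_left_inj] at h3
    simp [h3, Module.algebraMap_end_apply]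
  have hle := finrank_ker_aeval_le (h.finrank_eigenspace_le hA) _ (sub_ne_zero.2 hne)
  rw [hker, LinearMap.ker_zero, finrank_top, natDegree_sub_C] at hle
  omega

end Pencil
end

/-! ### A common radical in the pencil, and quadratic forms given by matrices. -/

noncomputable section

section Degenerate

open QuadraticMap Polynomial Matrix

variable {k V : Type*} [Field k] [AddCommGroup V] [Module k V]

/-- A pencil of quadratic forms of rank at least four is singular, if it contains a suitable
two-dimensional subspace in the radicals of all its members. -/
lemma IsNonsingularPencil.false_of_radical [IsAlgClosed k] [CharP k 2] [FiniteDimensional k V]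
    {q q' : QuadraticForm k V} (h : IsNonsingularPencil q q') (hV : 3 ≤ Module.finrank k V)
    {y₀ y₁ : V} {c : k} (hc : c ≠ 0) (h0 : ∀ x, polar q y₀ x = 0) (h0' : ∀ x, polar q' y₀ x = 0)
    (h1 : ∀ x, polar q y₁ x = 0) (h1' : ∀ x, polar q' y₁ x = 0) (hq0 : q y₀ = 0)
    (hq0' : q' y₀ = c) (hq1 : q y₁ = c) (hq1' : q' y₁ = 0) : False := by
  set U := Submodule.span k {y₀, y₁} with hU
  have hUrad : ∀ u ∈ U, ∀ x, polar q x u = 0 ∧ polar q' x u = 0 := by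
    intro u hu x
    obtain ⟨s, t, rfl⟩ := Submodule.mem_span_pair.1 hu
    simp only [polar_add_right, polar_smul_right]
    rw [polar_comm q x, polar_comm q x, polar_comm q' x, polar_comm q' x, h0, h0', h1, h1']
    simp
  have hmem : ∀ z, ∀ a b : k, a ≠ 0 ∨ b ≠ 0 → (∀ x, a * polar q z x + b * polar q' z x = 0) →
      z ∈ U := by
    intro z a b hab hz
    -- As $y_0,y_1$ lie in all radicals, with values $(0,c)$ and $(c,0)$ under $(q,q')$, they
    -- correct $q'(z)$ and $q(z)$ independently. The corrected vector is a base point, still in the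
    -- radical of $aq+bq'$, hence zero.
    obtain ⟨α, hα⟩ := exists_quadratic_root 0 (q' z) hc
    obtain ⟨β, hβ⟩ := exists_quadratic_root 0 (q z) hc
    have hx : z + α • y₀ + β • y₁ = 0 := by
      refine h _ a b hab ?_ ?_ fun x => ?_
      · rw [QuadraticForm.map_add_smul, QuadraticForm.map_add_smul, polar_comm, h1, polar_comm, h0,
          hq1, hq0]
        linear_combination hβ
      · rw [QuadraticForm.map_add_smul, QuadraticForm.map_add_smul, polar_comm, h1', polar_comm,
          h0', hq1', hq0']
        linear_combination hα
      · simp only [polar_add_left, polar_smul_left, h0, h0', h1, h1']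
        simpa using hz x
    rw [hU, Submodule.mem_span_pair]
    refine ⟨-α, -β, ?_⟩
    rw [neg_smul, neg_smul, ← neg_add, neg_eq_iff_add_eq_zero, ← hx]
    abel
  obtain ⟨W, hW⟩ := U.exists_isCompl
  have hdim := Submodule.finrank_add_eq_of_isCompl hW
  have hU2 : Module.finrank k U ≤ 2 := by
    classical
    refine (finrank_span_le_card (R := k) ({y₀, y₁} : Set V)).trans ?_
    simpa using Finset.card_le_two
  -- On a complement of $U$ every nonzero member has a nondegenerate polar form. This is impossible
  -- on a nonzero space, because an eigenvector of the operator $A$ with eigenvalue $t$ lies in the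
  -- radical of $tq+q'$.
  have hext : ∀ z : W, ∀ a b : k, a ≠ 0 ∨ b ≠ 0 →
      (∀ x : W, a * polar q z x + b * polar q' z x = 0) → z = 0 := by
    intro z a b hab hz
    have hzU : z.1 ∈ U := hmem z a b hab fun x => by
      obtain ⟨u, hu, w, hw, rfl⟩ : ∃ u ∈ U, ∃ w ∈ W, u + w = x := by
        rw [← Submodule.mem_sup, hW.sup_eq_top]; trivial
      rw [polar_add_right, polar_add_right, (hUrad u hu z).1, (hUrad u hu z).2, zero_add, zero_add]
      exact hz ⟨w, hw⟩
    exact Subtype.ext ((Submodule.disjoint_def.1 hW.disjoint) _ hzU z.2)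
  obtain ⟨A, hA⟩ := exists_polar_operator (q := q.comp W.subtype)
    (fun z hz => hext z 1 0 (by simp) fun x => by
      rw [one_mul, zero_mul, add_zero]; exact hz x) (q'.comp W.subtype)
  have hnt : Nontrivial W := Module.nontrivial_of_finrank_pos (R := k) (by omega)
  obtain ⟨t, ht⟩ := Module.End.exists_eigenvalue A
  obtain ⟨z, hz⟩ := ht.exists_hasEigenvector
  refine hz.2 (hext z t 1 (by simp) fun x => ?_)
  have h3 := hA z x
  rw [hz.apply_eq_smul, polar_smul_left, smul_eq_mul] at h3
  rw [one_mul, show polar q' z.1 x.1 = t * polar q z.1 x.1 from h3.symm]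
  exact CharTwo.add_self_eq_zero _

lemma Matrix.coeff_map_C_mulVec {ι : Type*} [Fintype ι] (M : Matrix ι ι k) (y : ι → k[X]) (d : ℕ)
    (i : ι) :
    ((M.map C *ᵥ y) i).coeff d = (M *ᵥ fun i => (y i).coeff d) i := by
  simp [mulVec, dotProduct, finsetSum_coeff]

variable {ι R S : Type*} [Fintype ι] [DecidableEq ι] [CommRing R] [CommRing S]

lemma Matrix.toQuadraticForm'_apply (M : Matrix ι ι R) (x : ι → R) :
    M.toQuadraticForm' x = x ⬝ᵥ M *ᵥ x := by
  exact Matrix.toLinearMap₂'_apply' M x x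

lemma Matrix.polar_toQuadraticForm' (M : Matrix ι ι R) (x y : ι → R) :
    polar M.toQuadraticForm' x y = y ⬝ᵥ (M + Mᵀ) *ᵥ x := by
  refine (LinearMap.BilinMap.polar_toQuadraticMap x y).trans ?_
  rw [Matrix.toLinearMap₂'_apply', Matrix.toLinearMap₂'_apply', add_mulVec, dotProduct_add,
    mulVec_transpose, dotProduct_comm y (x ᵥ* M), ← dotProduct_mulVec, add_comm]

lemma Matrix.polar_toQuadraticForm'_eq_zero_iff (M : Matrix ι ι R) (x : ι → R) :
    (∀ y, polar M.toQuadraticForm' x y = 0) ↔ (M + Mᵀ) *ᵥ x = 0 := by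
  simp only [Matrix.polar_toQuadraticForm']
  refine ⟨fun h => funext fun i => ?_, fun h y => by rw [h, dotProduct_zero]⟩
  simpa using h (Pi.single i 1)

lemma Matrix.map_toQuadraticForm'_apply (f : R →+* S) (M : Matrix ι ι R) (x : ι → R) :
    (M.map f).toQuadraticForm' (f ∘ x) = f (M.toQuadraticForm' x) := by
  rw [toQuadraticForm'_apply, toQuadraticForm'_apply, RingHom.map_dotProduct,
    show f ∘ (M *ᵥ x) = M.map f *ᵥ (f ∘ x) from funext fun i => RingHom.map_mulVec f M x i]

lemma Matrix.toQuadraticForm'_add_apply (M M' : Matrix ι ι R) (x : ι → R) :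
    (M + M').toQuadraticForm' x = M.toQuadraticForm' x + M'.toQuadraticForm' x := by
  simp [toQuadraticForm'_apply, add_mulVec]

lemma Matrix.toQuadraticForm'_smul_apply (a : R) (M : Matrix ι ι R) (x : ι → R) :
    (a • M).toQuadraticForm' x = a * M.toQuadraticForm' x := by
  simp [toQuadraticForm'_apply, smul_mulVec]

/-- Coefficients of a quadratic form at a vector of polynomials: the leading term. -/
lemma Matrix.coeff_toQuadraticForm'_map_C (M : Matrix ι ι k) (y : ι → k[X]) (d : ℕ)
    (hd : ∀ i, (y i).natDegree ≤ d) :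
    ((M.map C).toQuadraticForm' y).coeff (d + d) =
      M.toQuadraticForm' (fun i => (y i).coeff d) := by
  simp only [toQuadraticForm'_apply, dotProduct, mulVec, finsetSum_coeff, Finset.mul_sum,
    Matrix.map_apply]
  refine Finset.sum_congr rfl fun i _ => Finset.sum_congr rfl fun j _ => ?_
  rw [mul_left_comm, coeff_C_mul, coeff_mul_add_eq_of_natDegree_le (hd i) (hd j)]
  ring

end Degenerate
end

/-! ### Existence of a member with nondegenerate polar form. -/

noncomputable section

section GenericRank

open QuadraticMap Polynomial Matrix

variable {k : Type*} [Field k] {ι : Type*} [Fintype ι] [DecidableEq ι]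

/-- A singular matrix of linear polynomials `N + Nᵀ` of even size has two independent vectors of
polynomials in its kernel. -/
lemma Matrix.exists_pair_mulVec_eq_zero [CharP k 2] (N : Matrix ι ι k[X])
    (hι : Even (Fintype.card ι)) (hN : (N + Nᵀ).det = 0) :
    ∃ (x₁ x₂ : ι → k[X]) (i₀ : ι), (N + Nᵀ) *ᵥ x₁ = 0 ∧ (N + Nᵀ) *ᵥ x₂ = 0 ∧ x₁ i₀ ≠ 0 ∧
      x₂ i₀ = 0 ∧ x₂ ≠ 0 := by
  -- Over $k(X)$ the alternating form has a nonzero kernel of even dimension, so of dimension at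
  -- least $2$. It contains a nonzero vector whose $i_0$-th coordinate vanishes, and clearing
  -- denominators preserves the zero coordinates.
  let K := FractionRing k[X]
  let f : k[X] →+* K := algebraMap k[X] K
  have hf : Function.Injective f := IsFractionRing.injective k[X] K
  have : CharP K 2 := charP_of_injective_ringHom hf 2
  have hmap : (N.map f) + (N.map f)ᵀ = (N + Nᵀ).map f := by
    ext i j; simp
  set B := polarBilin (N.map f).toQuadraticForm' with hB
  have hker : ∀ x, x ∈ LinearMap.ker B ↔ (N + Nᵀ).map f *ᵥ x = 0 := fun x => by
    rw [← hmap, ← Matrix.polar_toQuadraticForm'_eq_zero_iff, LinearMap.mem_ker]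
    exact ⟨fun h y => LinearMap.congr_fun h y, fun h => LinearMap.ext h⟩
  have hne : LinearMap.ker B ≠ ⊥ := by
    intro hb
    obtain ⟨v, hv, hv0⟩ := Matrix.exists_mulVec_eq_zero_iff.2
      (show ((N + Nᵀ).map f).det = 0 by
        rw [← RingHom.mapMatrix_apply, ← RingHom.map_det, hN, map_zero])
    exact hv ((LinearMap.ker_eq_bot'.1 hb) v ((hker v).2 hv0))
  have h2 : 2 ≤ Module.finrank K (LinearMap.ker B) :=
    LinearMap.BilinForm.two_le_finrank_ker
      (fun x => QuadraticForm.polar_self_of_charTwo _ x) (by simpa using hι) hne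
  have hclear : ∀ x : ι → K, x ∈ LinearMap.ker B → ∃ (w : ι → k[X]), (N + Nᵀ) *ᵥ w = 0 ∧
      ∀ i, w i = 0 ↔ x i = 0 := by
    intro x hx
    obtain ⟨b, hb⟩ := IsLocalization.exist_integer_multiples_of_finite (nonZeroDivisors k[X]) x
    choose w hw using hb
    have hw' : f ∘ w = (f b) • x := funext fun i => by
      rw [Function.comp_apply, hw, Pi.smul_apply, Algebra.smul_def, smul_eq_mul]
    refine ⟨w, funext fun i => hf ?_, fun i => ?_⟩
    · rw [RingHom.map_mulVec, hw', mulVec_smul, (hker x).1 hx]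
      simp
    · have hb0 : f b ≠ 0 := by
        rw [Ne, map_eq_zero_iff f hf]; exact nonZeroDivisors.coe_ne_zero b
      rw [← map_eq_zero_iff f hf, show f (w i) = f b * x i from congrFun hw' i, mul_eq_zero]
      simp [hb0]
  obtain ⟨u, hu, hu0⟩ := (LinearMap.ker B).exists_mem_ne_zero_of_ne_bot hne
  obtain ⟨i₀, hi₀⟩ := Function.ne_iff.1 hu0
  obtain ⟨v, hv, hv0, hvi⟩ : ∃ v ∈ LinearMap.ker B, v ≠ 0 ∧ v i₀ = 0 := by
    let ρ : LinearMap.ker B →ₗ[K] K := LinearMap.proj i₀ ∘ₗ (LinearMap.ker B).subtype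
    have hρ : LinearMap.ker ρ ≠ ⊥ := fun hb => by
      have := le_finrank_ker_add_one ρ
      rw [hb, finrank_bot] at this
      omega
    obtain ⟨v, hv, hv0⟩ := (LinearMap.ker ρ).exists_mem_ne_zero_of_ne_bot hρ
    exact ⟨v, v.2, fun h => hv0 (Subtype.ext h), hv⟩
  obtain ⟨x₁, hx₁, h₁⟩ := hclear u hu
  obtain ⟨x₂, hx₂, h₂⟩ := hclear v hv
  refine ⟨x₁, x₂, i₀, hx₁, hx₂, fun h => hi₀ ((h₁ _).1 h), (h₂ _).2 hvi, fun h => hv0 ?_⟩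
  exact funext fun i => (h₂ i).1 (congrFun h i)

/-- The field $k$ is perfect, so $f(X^2)$ is the square of the polynomial whose coefficients are the
square roots of those of $f$. This is why the pencil is reparametrised by $X^2$. -/
lemma Polynomial.exists_sq_eq_expand [IsAlgClosed k] [CharP k 2] (f : k[X]) :
    ∃ g, g ^ 2 = expand k 2 f := by
  obtain ⟨g, hg⟩ := Polynomial.map_surjective (frobenius k 2)
    (fun x => by
      obtain ⟨z, hz⟩ := IsAlgClosed.exists_pow_nat_eq x two_pos
      exact ⟨z, hz⟩) f
  exact ⟨g, by rw [← map_frobenius_expand, map_expand, hg]⟩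

/-- The member `M + X² M'` of the pencil spanned by `M` and `M'`. -/
def sqPencil (M M' : Matrix ι ι k) : Matrix ι ι k[X] :=
  M.map C + (X ^ 2 : k[X]) • M'.map C

/-- If all members of the pencil are degenerate, then there is an isotropic vector of polynomials
in the radical of the generic member. -/
lemma exists_isotropic_radical [IsAlgClosed k] [CharP k 2] (M M' : Matrix ι ι k)
    (hι : Even (Fintype.card ι)) (hdeg : ∀ a : k, ((M + a • M') + (M + a • M')ᵀ).det = 0) :
    ∃ y : ι → k[X], y ≠ 0 ∧ (sqPencil M M' + (sqPencil M M')ᵀ) *ᵥ y = 0 ∧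
      (sqPencil M M').toQuadraticForm' y = 0 := by
  set N : Matrix ι ι k[X] := M.map C + (X : k[X]) • M'.map C with hN
  have hdet : (N + Nᵀ).det = 0 := by
    -- A polynomial vanishing at every point of the infinite field $k$ is zero.
    refine Polynomial.funext fun a => ?_
    rw [← coe_evalRingHom, RingHom.map_det, map_zero, ← hdeg a]
    congr 1
    ext i j
    simp [N]
    ring
  obtain ⟨x₁, x₂, i₀, h₁, h₂, h₁0, h₂0, hx₂⟩ := Matrix.exists_pair_mulVec_eq_zero N hι hdet
  let σ : k[X] →+* k[X] := (expand k 2).toRingHom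
  have hσ : Function.Injective σ := expand_injective two_pos
  have hNσ : N.map σ = sqPencil M M' := by
    ext i j : 2
    simp [N, sqPencil, σ]
  have hrad : ∀ x, (N + Nᵀ) *ᵥ x = 0 →
      (sqPencil M M' + (sqPencil M M')ᵀ) *ᵥ (σ ∘ x) = 0 := fun x hx => by
    have : sqPencil M M' + (sqPencil M M')ᵀ = (N + Nᵀ).map σ := by
      rw [← hNσ]; ext i j : 2; simp
    rw [this]
    refine funext fun i => ?_
    rw [← RingHom.map_mulVec, hx]
    exact map_zero _
  obtain ⟨g₁, hg₁⟩ := Polynomial.exists_sq_eq_expand (N.toQuadraticForm' x₁)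
  obtain ⟨g₂, hg₂⟩ := Polynomial.exists_sq_eq_expand (N.toQuadraticForm' x₂)
  have hval : ∀ x, (sqPencil M M').toQuadraticForm' (σ ∘ x) =
      expand k 2 (N.toQuadraticForm' x) := fun x => by
    rw [← hNσ, Matrix.map_toQuadraticForm'_apply]; rfl
  by_cases hg : g₂ = 0
  · refine ⟨σ ∘ x₂, fun h => hx₂ (funext fun i => hσ ?_), hrad _ h₂, ?_⟩
    · simpa using congrFun h i
    · rw [hval, ← hg₂, hg]; simp
  -- The form is additive on the radical and takes the values $g_1^2,g_2^2$ at the two vectors, so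
  -- this combination has value $2g_1^2g_2^2=0$. It is nonzero because its $i_0$-th coordinate only
  -- comes from $x_1$.
  · refine ⟨g₂ • (σ ∘ x₁) + g₁ • (σ ∘ x₂), fun h => ?_, ?_, ?_⟩
    · have h3 : g₂ * σ (x₁ i₀) = 0 := by simpa [h₂0] using congrFun h i₀
      exact h₁0 (hσ (by rw [(mul_eq_zero.1 h3).resolve_left hg, map_zero]))
    · rw [mulVec_add, mulVec_smul, mulVec_smul, hrad _ h₁, hrad _ h₂]; simp
    · rw [QuadraticMap.map_add (sqPencil M M').toQuadraticForm', polar_smul_left,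
        (Matrix.polar_toQuadraticForm'_eq_zero_iff _ _).2 (hrad _ h₁), QuadraticMap.map_smul,
        QuadraticMap.map_smul, hval, hval, ← hg₁, ← hg₂, smul_zero, add_zero, smul_eq_mul,
        smul_eq_mul, ← CharTwo.add_self_eq_zero (g₁ ^ 2 * g₂ ^ 2)]
      ring

/-- A vector of polynomials can be divided by its content, so that it vanishes nowhere. -/
lemma exists_isotropic_radical_nowhere_zero [IsAlgClosed k] (N : Matrix ι ι k[X])
    (y : ι → k[X]) (hy : y ≠ 0) (hr : (N + Nᵀ) *ᵥ y = 0) (hq : N.toQuadraticForm' y = 0) :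
    ∃ y : ι → k[X], (∀ a : k, ∃ i, (y i).eval a ≠ 0) ∧ (N + Nᵀ) *ᵥ y = 0 ∧
      N.toQuadraticForm' y = 0 := by
  -- At a common zero $a$ of the coordinates one divides by $X-a$; both equations are homogeneous in
  -- $y$ and survive the division.
  induction hn : ∑ i, (y i).natDegree using Nat.strong_induction_on generalizing y with
  | _ n ih =>
  by_cases h : ∀ a : k, ∃ i, (y i).eval a ≠ 0
  · exact ⟨y, h, hr, hq⟩
  push Not at h
  obtain ⟨a, ha⟩ := h
  choose w hw using fun i => dvd_iff_isRoot.2 (ha i)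
  have hyw : y = (X - C a) • w := funext hw
  have hX : (X - C a : k[X]) ≠ 0 := X_sub_C_ne_zero a
  have hw0 : w ≠ 0 := by rintro rfl; exact hy (by rw [hyw, smul_zero])
  refine ih _ ?_ w hw0 ?_ ?_ rfl
  · rw [← hn]
    obtain ⟨i, hi⟩ := Function.ne_iff.1 hw0
    refine Finset.sum_lt_sum (fun j _ => ?_) ⟨i, Finset.mem_univ i, ?_⟩
    · by_cases hj : w j = 0
      · simp [hj]
      · rw [hw j, natDegree_mul hX hj]; omega
    · rw [hw i, natDegree_mul hX hi, natDegree_X_sub_C]; omega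
  · rw [hyw, mulVec_smul] at hr
    exact (smul_eq_zero.1 hr).resolve_left hX
  · rw [hyw, QuadraticMap.map_smul, smul_eq_mul] at hq
    exact (mul_eq_zero.1 hq).resolve_left (mul_ne_zero hX hX)

/-- A nonsingular pencil of quadratic forms on an even-dimensional space of dimension at least
four has a member whose polar form is nondegenerate. -/
lemma IsNonsingularPencil.exists_nondegenerate [IsAlgClosed k] [CharP k 2] {M M' : Matrix ι ι k}
    (h : IsNonsingularPencil M.toQuadraticForm' M'.toQuadraticForm')
    (hι : Even (Fintype.card ι)) (hι' : 3 ≤ Fintype.card ι) :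
    ∃ a : k, ∀ x, (∀ y, polar (M.toQuadraticForm' + a • M'.toQuadraticForm') x y = 0) → x = 0 := by
  by_contra! hcon
  obtain ⟨y, hy, hr, hq⟩ := exists_isotropic_radical M M' hι fun a => by
    obtain ⟨x, hx, hx0⟩ := hcon a
    refine Matrix.exists_mulVec_eq_zero_iff.1 ⟨x, hx0, ?_⟩
    rw [← Matrix.polar_toQuadraticForm'_eq_zero_iff]
    have : ⇑(M + a • M').toQuadraticForm' = ⇑(M.toQuadraticForm' + a • M'.toQuadraticForm') :=
      funext fun z => by
        rw [Matrix.toQuadraticForm'_add_apply, Matrix.toQuadraticForm'_smul_apply]; rfl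
    rwa [this]
  obtain ⟨y, hy, hr, hq⟩ := exists_isotropic_radical_nowhere_zero _ y hy hr hq
  have hr' : (M + Mᵀ).map C *ᵥ y + (X ^ 2 : k[X]) • ((M' + M'ᵀ).map C *ᵥ y) = 0 := by
    rw [← smul_mulVec, ← add_mulVec, ← hr]
    congr 1
    ext i j : 2
    simp only [sqPencil, Matrix.add_apply, Matrix.map_apply, Matrix.smul_apply,
      Matrix.transpose_apply, smul_eq_mul, map_add]
    ring_nf
  have hq' : (M.map C).toQuadraticForm' y + X ^ 2 * (M'.map C).toQuadraticForm' y = 0 := by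
    rw [← hq, sqPencil, Matrix.toQuadraticForm'_add_apply, Matrix.toQuadraticForm'_smul_apply]
  have heval : ∀ (L : Matrix ι ι k) (a : k), eval a ((L.map C).toQuadraticForm' y) =
      L.toQuadraticForm' (fun i => (y i).eval a) := fun L a => by
    rw [← coe_evalRingHom, ← Matrix.map_toQuadraticForm'_apply, Matrix.map_map]
    congr
    ext; simp
  have hevalB : ∀ (L : Matrix ι ι k) (a : k) i, eval a ((L.map C *ᵥ y) i) =
      (L *ᵥ (fun i => (y i).eval a)) i := fun L a i => by
    simp [mulVec, dotProduct, eval_finsetSum]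
  -- The polynomial $q'(y)$ has no root: at a root $a$, the relation $q(y)+X^2q'(y)=0$ makes
  -- $y(a)\ne0$ a base point, and it lies in the radical of $q+a^2q'$. Hence $q'(y)=c$ and
  -- $q(y)=cX^2$.
  obtain ⟨c, hc⟩ : ∃ c, C c = (M'.map C).toQuadraticForm' y := by
    rw [← natDegree_eq_zero, natDegree_eq_zero_iff_degree_le_zero]
    by_contra hdeg
    obtain ⟨a, ha⟩ := IsAlgClosed.exists_root _ (fun h0 => hdeg h0.le)
    rw [IsRoot.def] at ha
    obtain ⟨i, hi⟩ := hy a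
    have h1 := congrArg (eval a) hq'
    rw [eval_add, eval_mul, ha, mul_zero, add_zero, heval, eval_zero] at h1
    rw [heval] at ha
    refine hi (congrFun (h _ 1 (a ^ 2) (by simp) h1 ha fun z => ?_) i)
    rw [Matrix.polar_toQuadraticForm', Matrix.polar_toQuadraticForm', ← smul_eq_mul,
      ← smul_eq_mul, ← dotProduct_smul, ← dotProduct_smul, ← dotProduct_add]
    convert dotProduct_zero z
    refine funext fun j => ?_
    have h2 := congrArg (eval a) (congrFun hr' j)
    simpa [hevalB] using h2
  have hc' : (M.map C).toQuadraticForm' y = C c * X ^ 2 := by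
    rw [← hc] at hq'
    rw [eq_neg_of_add_eq_zero_left hq', CharTwo.neg_eq, mul_comm]
  -- If $c=0$, then $y(0)$ is a nonzero base point in the radical of $q$.
  have hc0 : c ≠ 0 := by
    rintro rfl
    obtain ⟨i, hi⟩ := hy 0
    have h1 := heval M 0
    have h2 := heval M' 0
    rw [← hc, eval_C] at h2
    rw [hc', map_zero, zero_mul, eval_zero] at h1
    refine hi (congrFun (h _ 1 0 (by simp) h1.symm h2.symm fun z => ?_) i)
    rw [one_mul, zero_mul, add_zero, (Matrix.polar_toQuadraticForm'_eq_zero_iff _ _).2]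
    refine funext fun j => ?_
    have h3 := congrArg (eval 0) (congrFun hr' j)
    simpa [hevalB] using h3
  obtain ⟨i₀, -, hmax⟩ := Finset.exists_max_image Finset.univ (fun i => (y i).natDegree)
    (Finset.univ_nonempty_iff.2 (Fintype.card_pos_iff.1 (by omega)))
  set d := (y i₀).natDegree with hd
  replace hmax : ∀ i, (y i).natDegree ≤ d := fun i => hmax i (Finset.mem_univ i)
  let Y : ℕ → ι → k := fun j i => (y i).coeff j
  have hY : ∀ j, d < j → Y j = 0 := fun j hj => funext fun i =>
    coeff_eq_zero_of_natDegree_lt ((hmax i).trans_lt hj)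
  -- In the radical relation the second term starts in degree $2$, so the two lowest coefficients of
  -- $y$ lie in the radical of $q$. Dually, the two highest lie in the radical of $q'$.
  have hB0 : ∀ j < 2, (M + Mᵀ) *ᵥ Y j = 0 := fun j hj => funext fun i => by
    have h1 := congrArg (fun p => coeff p j) (congrFun hr' i)
    simp only [Pi.add_apply, Pi.smul_apply, coeff_add, smul_eq_mul, coeff_X_pow_mul',
      Pi.zero_apply, coeff_zero, Matrix.coeff_map_C_mulVec, not_le.2 hj, if_false, add_zero] at h1
    exact h1
  have hB' : ∀ j, d < j + 2 → (M' + M'ᵀ) *ᵥ Y j = 0 := fun j hj => funext fun i => by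
    have h1 := congrArg (fun p => coeff p (j + 2)) (congrFun hr' i)
    simp only [Pi.add_apply, Pi.smul_apply, coeff_add, smul_eq_mul, coeff_X_pow_mul,
      Pi.zero_apply, coeff_zero, Matrix.coeff_map_C_mulVec] at h1
    change ((M + Mᵀ) *ᵥ Y (j + 2)) i + ((M' + M'ᵀ) *ᵥ Y j) i = 0 at h1
    rwa [hY _ hj, mulVec_zero, Pi.zero_apply, zero_add] at h1
  have htop : M.toQuadraticForm' (Y d) = (C c * X ^ 2).coeff (d + d) := by
    rw [← hc', Matrix.coeff_toQuadraticForm'_map_C _ _ _ hmax]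
  have htop' : M'.toQuadraticForm' (Y d) = (C c : k[X]).coeff (d + d) := by
    rw [hc, Matrix.coeff_toQuadraticForm'_map_C _ _ _ hmax]
  rw [coeff_C_mul_X_pow] at htop
  rw [coeff_C] at htop'
  have hYd : Y d ≠ 0 := fun h0 => by
    have h1 : (y i₀).coeff d = 0 := congrFun h0 i₀
    rw [hd, coeff_natDegree, leadingCoeff_eq_zero] at h1
    have h2 : ∀ i, y i = C ((y i).coeff 0) := fun i => eq_C_of_natDegree_le_zero (by
      have := hmax i
      rwa [hd, h1, natDegree_zero] at this)
    obtain ⟨i, hi⟩ := hy 0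
    apply hi
    rw [h2 i, eval_C]
    have : d = 0 := by rw [hd, h1, natDegree_zero]
    rw [this] at h0
    exact congrFun h0 i
  -- The coefficient of $X^{2d}$ gives $q(Y_d)$ and $q'(Y_d)$. For $d=1$ both coefficients of $y$
  -- lie in both radicals, with values $(0,c)$ and $(c,0)$, the case excluded by
  -- `IsNonsingularPencil.false_of_radical`. For $d=0$ the vector $y$ is constant, against
  -- $q(y)=cX^2$. For $d\ge2$ the leading coefficient is a singular base point.
  by_cases hd2 : d = 1
  · rw [hd2] at htop htop'
    have h00 : (fun i => (y i).eval 0) = Y 0 := funext fun i => (coeff_zero_eq_eval_zero _).symm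
    have hq0 := heval M 0
    have hq0' := heval M' 0
    rw [hc', h00] at hq0
    rw [← hc, h00] at hq0'
    refine h.false_of_radical (y₀ := Y 0) (y₁ := Y 1) (by simpa using hι') hc0 ?_ ?_ ?_ ?_ ?_ ?_
      ?_ ?_
    · exact (Matrix.polar_toQuadraticForm'_eq_zero_iff _ _).2 (hB0 0 (by omega))
    · exact (Matrix.polar_toQuadraticForm'_eq_zero_iff _ _).2 (hB' 0 (by omega))
    · exact (Matrix.polar_toQuadraticForm'_eq_zero_iff _ _).2 (hB0 1 (by omega))
    · exact (Matrix.polar_toQuadraticForm'_eq_zero_iff _ _).2 (hB' 1 (by omega))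
    · simpa using hq0.symm
    · simpa using hq0'.symm
    · simpa using htop
    · simpa using htop'
  · rw [if_neg (by omega)] at htop
    by_cases hd0 : d = 0
    · rw [hd0] at htop
      have h1 : ∀ a, (fun i => (y i).eval a) = Y 0 := fun a => funext fun i => by
        rw [eq_C_of_natDegree_le_zero ((hmax i).trans hd0.le), eval_C]
      have h2 := heval M 1
      rw [h1, htop, hc'] at h2
      exact hc0 (by simpa using h2)
    · rw [if_neg (by omega)] at htop'
      refine hYd (h _ 0 1 (by simp) htop htop' fun z => ?_)
      rw [(Matrix.polar_toQuadraticForm'_eq_zero_iff M' _).2 (hB' d (by omega))]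
      simp

/-- The algebra of operators attached to a nonsingular pencil of quadratic forms. -/
theorem IsNonsingularPencil.exists_operator [IsAlgClosed k] [CharP k 2] {M M' : Matrix ι ι k}
    (h : IsNonsingularPencil M.toQuadraticForm' M'.toQuadraticForm')
    (hι : Even (Fintype.card ι)) (hι' : 3 ≤ Fintype.card ι) :
    ∃ A : Module.End k (ι → k),
      (∀ (P : k[X]) x, polar M.toQuadraticForm' x (aeval A P x) = 0) ∧
      (∀ (P : k[X]) x, polar M'.toQuadraticForm' x (aeval A P x) = 0) ∧
      ∀ P : k[X], 2 * P.natDegree < Fintype.card ι →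
        (∀ x, x ≠ 0 → M.toQuadraticForm' x = 0 → M'.toQuadraticForm' x = 0 →
          ∃ c : k, aeval A P x = c • x) → ∃ c, P = C c := by
  obtain ⟨a, ha⟩ := h.exists_nondegenerate hι hι'
  set q := M.toQuadraticForm'
  set q' := M'.toQuadraticForm'
  -- The operator is built from the nondegenerate member $q+aq'$; the pencil and its base locus are
  -- unchanged, and the statements for $q$ follow by subtracting those for $aq'$.
  have h' : IsNonsingularPencil (q + a • q') q' := (h.symm.add_smul a).symm
  obtain ⟨A, hA⟩ := exists_polar_operator ha q'
  have h2 : ∀ (P : k[X]) x, polar q' x (aeval A P x) = 0 := polar_self_aeval' hA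
  refine ⟨A, fun P x => ?_, h2, fun P hP hev => ?_⟩
  · have h1 := polar_self_aeval hA P x
    rwa [QuadraticForm.polar_add_smul, h2, mul_zero, add_zero] at h1
  · refine h'.eq_C_of_forall_eigenvector (by simpa using hι) ha hA P (by simpa using hP)
      fun x hx hq hq' => hev x hx ?_ hq'
    rw [_root_.add_apply, _root_.smul_apply, hq', smul_zero, add_zero] at hq
    exact hq

end GenericRank
end

/-! ### Derivations of the structure sheaf and first-order perturbations of morphisms. -/

noncomputable section

namespace AlgebraicGeometry

open Opposite TopologicalSpace

/-- A derivation of the structure sheaf of a scheme. -/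
structure SheafDerivation (X : Scheme.{u}) where
  /-- the action on sections -/
  app : ∀ U : X.Opens, Γ(X, U) → Γ(X, U)
  app_add : ∀ U a b, app U (a + b) = app U a + app U b
  app_mul : ∀ U a b, app U (a * b) = a * app U b + b * app U a
  app_map : ∀ {U V : X.Opens} (i : op U ⟶ op V) a,
    app V ((X.presheaf.map i).hom a) = (X.presheaf.map i).hom (app U a)

namespace SheafDerivation

variable {X Y Z : Scheme.{u}} (δ : SheafDerivation X)

lemma app_zero (U : X.Opens) : δ.app U 0 = 0 := by
  simpa using δ.app_add U 0 0

lemma app_one (U : X.Opens) : δ.app U 1 = 0 := by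
  simpa using δ.app_mul U 1 1

/-- Restriction of a global function. -/
abbrev _root_.AlgebraicGeometry.Scheme.resTop (X : Scheme.{u}) (U : X.Opens) :
    Γ(X, ⊤) →+* Γ(X, U) :=
  (X.presheaf.map (homOfLE le_top).op).hom

/-- The ring homomorphism `a ↦ p^# a + e p^# (δ a)`, for `e² = 0`. -/
def perturbApp (p : Y ⟶ X) {e : Γ(Y, ⊤)} (he : e * e = 0) (U : X.Opens) :
    Γ(X, U) →+* Γ(Y, p ⁻¹ᵁ U) where
  toFun a := (p.app U).hom a + Y.resTop _ e * (p.app U).hom (δ.app U a)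
  map_one' := by simp [app_one]
  map_zero' := by simp [app_zero]
  map_add' a b := by simp only [δ.app_add, map_add]; ring
  map_mul' a b := by
    have h : Y.resTop (p ⁻¹ᵁ U) e * Y.resTop _ e = 0 := by rw [← map_mul, he, map_zero]
    simp only [δ.app_mul, map_add, map_mul]
    linear_combination -((p.app U).hom (δ.app U a) * (p.app U).hom (δ.app U b)) * h

/-- The morphism of presheafed spaces `p + e δ`. -/
def perturbPsh (p : Y ⟶ X) {e : Γ(Y, ⊤)} (he : e * e = 0) :
    Y.toPresheafedSpace.Hom X.toPresheafedSpace where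
  base := p.base
  c :=
    { app := fun U => CommRingCat.ofHom (δ.perturbApp p he U.unop)
      naturality := fun U V i => by
        ext a
        have h1 := fun b => congr($(p.naturality i).hom b)
        simp only [CommRingCat.hom_comp, RingHom.comp_apply] at h1
        change (p.app V.unop).hom ((X.presheaf.map i).hom a) + Y.resTop _ e *
          (p.app V.unop).hom (δ.app V.unop ((X.presheaf.map i).hom a)) =
          (Y.presheaf.map ((Opens.map p.base).map i.unop).op).hom
            ((p.app U.unop).hom a + Y.resTop _ e * (p.app U.unop).hom (δ.app U.unop a))
        rw [δ.app_map i, h1, h1, map_add, map_mul]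
        congr 2
        exact (congr($(Y.presheaf.map_comp (homOfLE le_top).op
          ((Opens.map p.base).map i.unop).op).hom e)) }

/-- On stalks the perturbed map differs from that of $p$ by elements of square zero, so both detect
the same units. -/
lemma isLocalHom_perturbPsh (p : Y ⟶ X) {e : Γ(Y, ⊤)} (he : e * e = 0) (y : Y) :
    IsLocalHom ((δ.perturbPsh p he).stalkMap y).hom := by
  refine ⟨fun t ht => ?_⟩
  obtain ⟨U, hU, a, rfl⟩ := X.presheaf.exists_germ_eq t
  have h1 := PresheafedSpace.stalkMap_germ_apply (δ.perturbPsh p he) U y hU a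
  have h2 := PresheafedSpace.stalkMap_germ_apply p.toPshHom U y hU a
  refine (isUnit_map_iff (p.stalkMap y).hom _).1 ?_
  have h3 : IsUnit ((Y.presheaf.germ (p ⁻¹ᵁ U) y hU).hom ((δ.perturbApp p he U) a)) := by
    rw [← show _ = (Y.presheaf.germ (p ⁻¹ᵁ U) y hU).hom ((δ.perturbApp p he U) a) from h1]
    exact ht
  refine (congrArg IsUnit h2).mpr ?_
  have h4 : (δ.perturbApp p he U) a = (p.app U).hom a +
    Y.resTop _ e * (p.app U).hom (δ.app U a) := rfl
  have h5 : (p.app U).hom a = (δ.perturbApp p he U) a -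
    Y.resTop _ e * (p.app U).hom (δ.app U a) := by rw [h4]; ring
  refine (congrArg (fun b => IsUnit ((Y.presheaf.germ (p ⁻¹ᵁ U) y hU).hom b)) h5).mpr ?_
  rw [map_sub, sub_eq_add_neg]
  refine IsNilpotent.isUnit_add_left_of_commute (IsNilpotent.neg ?_) h3 (Commute.all _ _)
  refine ⟨2, ?_⟩
  rw [← map_pow, mul_pow, pow_two (Y.resTop _ e), ← map_mul, he, map_zero, zero_mul, map_zero]

/-- The morphism `p + e δ`, which agrees with `p` on points and
is given by `a ↦ p^# a + e p^# (δ a)` on functions. -/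
def perturb (p : Y ⟶ X) {e : Γ(Y, ⊤)} (he : e * e = 0) : Y ⟶ X where
  toHom := δ.perturbPsh p he
  prop := δ.isLocalHom_perturbPsh p he

lemma perturb_appLE (p : Y ⟶ X) {e : Γ(Y, ⊤)} (he : e * e = 0) {U : X.Opens} {V : Y.Opens}
    (h : V ≤ δ.perturb p he ⁻¹ᵁ U) (a : Γ(X, U)) :
    ((δ.perturb p he).appLE U V h).hom a =
      (p.appLE U V (show V ≤ p ⁻¹ᵁ U from h)).hom a +
        Y.resTop V e * (p.appLE U V (show V ≤ p ⁻¹ᵁ U from h)).hom (δ.app U a) := by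
  replace h : V ≤ p ⁻¹ᵁ U := h
  change (Y.presheaf.map (homOfLE h).op).hom ((p.app U).hom a + Y.resTop _ e *
    (p.app U).hom (δ.app U a)) = _
  rw [map_add, map_mul]
  congr 2
  exact (congr($(Y.presheaf.map_comp (homOfLE le_top).op (homOfLE h).op).hom e)).symm

lemma _root_.AlgebraicGeometry.Scheme.Hom.ext_appLE {f g : Y ⟶ X} (hb : f.base = g.base)
    (h : ∀ (U : X.Opens) (V : Y.Opens) (hf : V ≤ f ⁻¹ᵁ U) (hg : V ≤ g ⁻¹ᵁ U) (a : Γ(X, U)),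
      (f.appLE U V hf).hom a = (g.appLE U V hg).hom a) : f = g := by
  refine Scheme.Hom.ext hb fun U => ?_
  ext a
  have h1 := h U (g ⁻¹ᵁ U) (by rw [hb]) le_rfl a
  rw [Scheme.Hom.appLE_eq_app] at h1
  rw [← h1]
  rfl

/-- Only the product of $e$ with the derivation matters, so a scalar can be moved from one factor to
the other. -/
lemma perturb_congr {δ' : SheafDerivation X} {p p' : Y ⟶ X} {e e' : Γ(Y, ⊤)} (he : e * e = 0)
    (he' : e' * e' = 0) (hp : p = p')
    (h : ∀ (U : X.Opens) (V : Y.Opens) (hV : V ≤ p ⁻¹ᵁ U) (a : Γ(X, U)),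
      Y.resTop V e * (p.appLE U V hV).hom (δ.app U a) =
        Y.resTop V e' * (p.appLE U V hV).hom (δ'.app U a)) :
    δ.perturb p he = δ'.perturb p' he' := by
  subst hp
  refine Scheme.Hom.ext_appLE rfl fun U V hf hg a => ?_
  rw [perturb_appLE, perturb_appLE, h U V hf a]

lemma perturb_zero (p : Y ⟶ X) {e : Γ(Y, ⊤)} (he : e * e = 0)
    (h : ∀ (U : X.Opens) (V : Y.Opens) (hV : V ≤ p ⁻¹ᵁ U) (a : Γ(X, U)),
      Y.resTop V e * (p.appLE U V hV).hom (δ.app U a) = 0) : δ.perturb p he = p := by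
  refine Scheme.Hom.ext_appLE rfl fun U V hf hg a => ?_
  rw [perturb_appLE, h U V hf a, add_zero]

lemma comp_perturb (f : Z ⟶ Y) (p : Y ⟶ X) {e : Γ(Y, ⊤)} (he : e * e = 0) :
    f ≫ δ.perturb p he = δ.perturb (f ≫ p) (e := f.appTop.hom e)
      (by rw [← map_mul, he, map_zero]) := by
  refine Scheme.Hom.ext_appLE rfl fun U V hf hg a => ?_
  have h1 : V ≤ f ⁻¹ᵁ (p ⁻¹ᵁ U) := hf
  have h2 : ∀ b, ((f ≫ p).appLE U V hg).hom b = (f.appLE _ V h1).hom ((p.app U).hom b) :=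
    fun b => congr($(Scheme.Hom.comp_appLE f p U V hg).hom b)
  have h3 : ((f ≫ δ.perturb p he).appLE U V hf).hom a =
      (f.appLE _ V h1).hom (((δ.perturb p he).app U).hom a) :=
    congr($(Scheme.Hom.comp_appLE f (δ.perturb p he) U V hf).hom a)
  rw [h3, perturb_appLE, h2, h2]
  change (f.appLE _ V h1).hom ((p.app U).hom a + Y.resTop _ e * (p.app U).hom (δ.app U a)) = _
  rw [map_add, map_mul]
  congr 2
  have h4 := Scheme.Hom.map_appLE f h1 (homOfLE le_top : p ⁻¹ᵁ U ⟶ ⊤).op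
  have h5 : Z.resTop V (f.appTop.hom e) = (f.appLE ⊤ V le_top).hom e := rfl
  rw [h5]
  exact congr(($h4).hom e)

/-- The sum of two derivations. -/
instance : Add (SheafDerivation X) where
  add δ δ' :=
    { app := fun U a => δ.app U a + δ'.app U a
      app_add := fun U a b => by rw [δ.app_add, δ'.app_add]; ring
      app_mul := fun U a b => by rw [δ.app_mul, δ'.app_mul]; ring
      app_map := fun i a => by rw [δ.app_map i, δ'.app_map i, map_add] }

lemma add_app (δ δ' : SheafDerivation X) (U : X.Opens) (a : Γ(X, U)) :
    (δ + δ').app U a = δ.app U a + δ'.app U a := rfl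

/-- The cross term carries the factor $e^2=0$; this turns addition of vector fields into
composition. -/
lemma perturb_perturb (δ' : SheafDerivation X) (p : Y ⟶ X) {e : Γ(Y, ⊤)} (he : e * e = 0) :
    δ'.perturb (δ.perturb p he) he = (δ + δ').perturb p he := by
  refine Scheme.Hom.ext_appLE rfl fun U V hf hg a => ?_
  have h : Y.resTop V e * Y.resTop V e = 0 := by rw [← map_mul, he, map_zero]
  rw [perturb_appLE, perturb_appLE, perturb_appLE, perturb_appLE, add_app, map_add]
  linear_combination (p.appLE U V hf).hom (δ.app U (δ'.app U a)) * h

end SheafDerivation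

end AlgebraicGeometry
end

/-! ### Derivations of degree zero on localizations and on Proj. -/

noncomputable section

section Localization

variable {R A : Type*} [CommRing R] [CommRing A] [Algebra R A] (d : Derivation R A A)
  (S : Submonoid A)

/-- The ring homomorphism `a / s ↦ a / s + ε d(a / s)`. -/
def Derivation.localizationDual : Localization S →+* DualNumber (Localization S) :=
  IsLocalization.lift (M := S)
    (g :=
      { toFun := fun a => TrivSqZeroExt.inl (algebraMap A (Localization S) a) +
          TrivSqZeroExt.inr (algebraMap A (Localization S) (d a))
        map_one' := by ext <;> simp
        map_zero' := by ext <;> simp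
        map_add' := fun a b => TrivSqZeroExt.ext (by simp) (by
          simp only [TrivSqZeroExt.snd_add, TrivSqZeroExt.snd_inl, TrivSqZeroExt.snd_inr, zero_add,
            map_add])
        map_mul' := fun a b => TrivSqZeroExt.ext (by simp) (by
          simp only [TrivSqZeroExt.snd_add, TrivSqZeroExt.snd_inl, TrivSqZeroExt.snd_inr, zero_add,
            TrivSqZeroExt.snd_mul,
            TrivSqZeroExt.fst_add, TrivSqZeroExt.fst_inl, TrivSqZeroExt.fst_inr, add_zero,
            Derivation.leibniz, smul_eq_mul, map_add, map_mul, MulOpposite.smul_eq_mul_unop,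
            MulOpposite.unop_op]
          ring) })
    fun s => by
      rw [TrivSqZeroExt.isUnit_iff_isUnit_fst]
      simpa using IsLocalization.map_units (Localization S) s

/-- The extension of a derivation to a localization. -/
def Derivation.localization (z : Localization S) : Localization S :=
  (d.localizationDual S z).snd

lemma Derivation.localizationDual_algebraMap (a : A) :
    d.localizationDual S (algebraMap A _ a) =
      TrivSqZeroExt.inl (algebraMap A (Localization S) a) +
          TrivSqZeroExt.inr (algebraMap A (Localization S) (d a)) :=
  IsLocalization.lift_eq _ a

lemma Derivation.localization_algebraMap (a : A) :
    d.localization S (algebraMap A _ a) = algebraMap A _ (d a) := by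
  rw [Derivation.localization, Derivation.localizationDual_algebraMap,
    TrivSqZeroExt.snd_add, TrivSqZeroExt.snd_inl, TrivSqZeroExt.snd_inr, zero_add]

lemma Derivation.fst_localizationDual (z : Localization S) :
    (d.localizationDual S z).fst = z := by
  have : (TrivSqZeroExt.fstHom (Localization S) (Localization S) (Localization S)).toRingHom.comp
      (d.localizationDual S) = RingHom.id _ := by
    refine IsLocalization.ringHom_ext S ?_
    ext a
    simp [Derivation.localizationDual_algebraMap]
  exact congr($this z)

lemma Derivation.localization_add (z w : Localization S) :
    d.localization S (z + w) = d.localization S z + d.localization S w := by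
  simp [Derivation.localization]

lemma Derivation.localization_mul (z w : Localization S) :
    d.localization S (z * w) = z * d.localization S w + w * d.localization S z := by
  simp [Derivation.localization, Derivation.fst_localizationDual, mul_comm w]

lemma Derivation.localization_mk (a : A) (s : S) :
    d.localization S (Localization.mk a s) =
      Localization.mk (s * d a - a * d s) (s * s) := by
  have h1 : algebraMap A (Localization S) s * Localization.mk a s = algebraMap A _ a := by
    rw [Localization.mk_eq_mk', mul_comm, IsLocalization.mk'_spec]
  have h2 := congrArg (d.localization S) h1
  rw [Derivation.localization_mul, Derivation.localization_algebraMap,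
    Derivation.localization_algebraMap] at h2
  rw [show Localization.mk (s * d a - a * d s) (s * s) =
    IsLocalization.mk' (Localization S) (s * d a - a * d s) (s * s) from
    congr($(Localization.mk_eq_mk' (M := S)) _ _), eq_comm, IsLocalization.mk'_eq_iff_eq_mul]
  simp only [Submonoid.coe_mul, map_mul, map_sub]
  linear_combination (algebraMap A (Localization S) (d s)) * h1 -
    algebraMap A (Localization S) s * h2

end Localization

namespace HomogeneousLocalization

variable {R A : Type*} [CommRing R] [CommRing A] [Algebra R A] {𝒜 : ℕ → Submodule R A}
  [GradedAlgebra 𝒜] (d : Derivation R A A) (hd : ∀ n, ∀ a ∈ 𝒜 n, d a ∈ 𝒜 n)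
  {S : Submonoid A}

/-- The fraction `d(a / s) = (s d a - a d s) / s²`, for a derivation `d` of degree zero. -/
def NumDenSameDeg.derivation (c : NumDenSameDeg 𝒜 S) : NumDenSameDeg 𝒜 S where
  deg := c.deg + c.deg
  num := ⟨c.den * d c.num - c.num * d c.den, sub_mem
    (SetLike.mul_mem_graded c.den.2 (hd _ _ c.num.2))
    (SetLike.mul_mem_graded c.num.2 (hd _ _ c.den.2))⟩
  den := ⟨c.den * c.den, SetLike.mul_mem_graded c.den.2 c.den.2⟩
  den_mem := S.mul_mem c.den_mem c.den_mem

lemma NumDenSameDeg.val_derivation (c : NumDenSameDeg 𝒜 S) :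
    (HomogeneousLocalization.mk (c.derivation d hd)).val =
      d.localization S (HomogeneousLocalization.mk c).val := by
  rw [val_mk, val_mk, Derivation.localization_mk]
  rfl

/-- A derivation of degree zero acts on the homogeneous localizations. -/
def derivation (z : HomogeneousLocalization 𝒜 S) : HomogeneousLocalization 𝒜 S :=
  mk (z.mk_surjective.choose.derivation d hd)

/-- Comparison with the full localization shows that the chosen representative is irrelevant; the
rules for derivations then follow from injectivity of `val`. -/
lemma val_derivation (z : HomogeneousLocalization 𝒜 S) :
    (derivation d hd z).val = d.localization S z.val := by
  conv_rhs => rw [← z.mk_surjective.choose_spec]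
  exact NumDenSameDeg.val_derivation d hd _

lemma derivation_mk (c : NumDenSameDeg 𝒜 S) :
    derivation d hd (mk c) = mk (c.derivation d hd) :=
  val_injective _ (by rw [val_derivation, NumDenSameDeg.val_derivation])

lemma derivation_add (z w : HomogeneousLocalization 𝒜 S) :
    derivation d hd (z + w) = derivation d hd z + derivation d hd w :=
  val_injective _ (by simp [val_derivation, Derivation.localization_add])

lemma derivation_mul (z w : HomogeneousLocalization 𝒜 S) :
    derivation d hd (z * w) = z * derivation d hd w + w * derivation d hd z :=
  val_injective _ (by simp [val_derivation, Derivation.localization_mul])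

end HomogeneousLocalization

namespace AlgebraicGeometry

open Opposite TopologicalSpace

variable {R A : Type u} [CommRing R] [CommRing A] [Algebra R A] {𝒜 : ℕ → Submodule R A}
  [GradedAlgebra 𝒜] (d : Derivation R A A) (hd : ∀ n, ∀ a ∈ 𝒜 n, d a ∈ 𝒜 n)

/-- The derivation of the structure sheaf of `Proj` given by a derivation of degree zero. -/
def Proj.sheafDerivation : SheafDerivation (Proj 𝒜) where
  app U s :=
    (⟨fun x => HomogeneousLocalization.derivation d hd (s.1 x), fun x => by
      obtain ⟨V, hx, i, n, r, t, ht, h⟩ := s.2 x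
      refine ⟨V, hx, i, n + n, ⟨t * d r - r * d t, sub_mem
        (SetLike.mul_mem_graded t.2 (hd _ _ r.2)) (SetLike.mul_mem_graded r.2 (hd _ _ t.2))⟩,
        ⟨t * t, SetLike.mul_mem_graded t.2 t.2⟩,
        fun y hy => (y.1.isPrime.mem_or_mem hy).elim (ht y) (ht y), fun y => ?_⟩
      refine (congrArg (HomogeneousLocalization.derivation d hd) (h y)).trans ?_
      rw [HomogeneousLocalization.derivation_mk]
      rfl⟩ : (ProjectiveSpectrum.Proj.structureSheaf 𝒜).1.obj (op U))
  app_add U a b := Subtype.ext (funext fun x => HomogeneousLocalization.derivation_add d hd _ _)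
  app_mul U a b := Subtype.ext (funext fun x => HomogeneousLocalization.derivation_mul d hd _ _)
  app_map i a := rfl

end AlgebraicGeometry
end

/-! ### Linear vector fields, quadrics and points of projective space. -/

noncomputable section

namespace AlgebraicGeometry

section toSpecZero

variable {A : Type u} [CommRing A] {σ : Type*} [SetLike σ A] [AddSubgroupClass σ A] (𝒜 : ℕ → σ)
  [GradedRing 𝒜]

/-- This form makes the effect on global functions explicit, so that constants can be computed as
fractions $c/1$. -/
lemma Proj.toSpecZero_eq_toSpecΓ : Proj.toSpecZero 𝒜 = (Proj 𝒜).toSpecΓ ≫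
    Spec.map (CommRingCat.ofHom (HomogeneousLocalization.fromZeroRingHom 𝒜 _) ≫
      Proj.awayToSection 𝒜 1 ≫
      (Proj 𝒜).presheaf.map (homOfLE (Proj.basicOpen_one 𝒜).ge).op) := by
  rw [Proj.toSpecZero, Proj.basicOpenToSpec, Scheme.isoOfEq_inv, Spec.map_comp, Spec.map_comp]
  have h := Scheme.Opens.toSpecΓ_SpecMap_presheaf_map (X := Proj 𝒜) ⊤ (Proj.basicOpen 𝒜 1)
    (Proj.basicOpen_one 𝒜).ge
  rw [← Category.assoc ((Proj 𝒜).homOfLE _), ← Category.assoc ((Proj 𝒜).homOfLE _), ← h,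
    Scheme.Opens.toSpecΓ_top]
  simp only [Category.assoc, Scheme.toIso_inv_ι_assoc]

end toSpecZero

namespace ProjSpace

variable (N : ℕ) (k : Type u) [Field k]

/-- The constant functions on projective space. -/
def scalar : k →+* Γ(ProjSpace N k, ⊤) :=
  ((Scheme.ΓSpecIso (.of k)).inv ≫ (toSpec N k).appTop).hom

lemma scalar_eq : scalar N k = (CommRingCat.ofHom (algebraMap k (polyGrading N k 0)) ≫
    CommRingCat.ofHom (HomogeneousLocalization.fromZeroRingHom (polyGrading N k) _) ≫
      Proj.awayToSection (polyGrading N k) 1 ≫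
      (ProjSpace N k).presheaf.map (homOfLE (Proj.basicOpen_one (polyGrading N k)).ge).op).hom := by
  rw [scalar, toSpec, Proj.toSpecZero_eq_toSpecΓ, Category.assoc, ← Spec.map_comp,
    Scheme.Hom.comp_appTop, ← Scheme.ΓSpecIso_inv_naturality_assoc, Scheme.toSpecΓ_appTop]
  simp only [Iso.inv_hom_id, Category.comp_id]

variable {N k}

lemma val_scalar (c : k) (p : (⊤ : (ProjSpace N k).Opens)) :
    ((scalar N k c).1 p).val = Localization.mk (MvPolynomial.C c) 1 := by
  rw [scalar_eq]
  have := ProjectiveSpectrum.Proj.awayToSection_apply (polyGrading N k) 1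
    (HomogeneousLocalization.fromZeroRingHom (polyGrading N k) _ (algebraMap k (polyGrading N k 0)
      c))
    ⟨p.1, (Proj.basicOpen_one (polyGrading N k)).ge p.2⟩
  refine this.trans ?_
  rw [show (HomogeneousLocalization.fromZeroRingHom (polyGrading N k) (Submonoid.powers 1)
    (algebraMap k (polyGrading N k 0) c)).val = Localization.mk (MvPolynomial.C c) 1 from rfl]
  rw [Localization.mk_eq_mk', IsLocalization.map_mk', Localization.mk_eq_mk']
  simp only [RingHom.id_apply, OneMemClass.coe_one]
  rfl

lemma val_res_dehomog {d : ℕ} (F : MvPolynomial (Fin (N + 1)) k) (hF : F ∈ polyGrading N k d)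
    (j : Fin (N + 1)) {W : (ProjSpace N k).Opens} (h : W ≤ chart N k j) (p : W) :
    ((((ProjSpace N k).presheaf.map (homOfLE h).op).hom (dehomog F hF j)).1 p).val =
      Localization.mk F ⟨.X j ^ d, Submonoid.pow_mem _ (h p.2) d⟩ := by
  have := ProjectiveSpectrum.Proj.awayToSection_apply (polyGrading N k) (MvPolynomial.X j)
    (HomogeneousLocalization.Away.mk (polyGrading N k) (X_mem N j) d F
      (by simpa using hF)) ⟨p.1, h p.2⟩
  refine this.trans ?_
  rw [HomogeneousLocalization.Away.val_mk, Localization.mk_eq_mk', IsLocalization.map_mk',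
    Localization.mk_eq_mk']
  simp

/-- The derivation of the polynomial ring given by an endomorphism of `k ^ (N + 1)`. -/
def linearDerivation (D : Module.End k (Fin (N + 1) → k)) :
    Derivation k (MvPolynomial (Fin (N + 1)) k) (MvPolynomial (Fin (N + 1)) k) :=
  MvPolynomial.mkDerivation k fun i => ∑ j, MvPolynomial.C (D (Pi.single j 1) i) * MvPolynomial.X j

variable (D : Module.End k (Fin (N + 1) → k))

lemma linearDerivation_X (i : Fin (N + 1)) : linearDerivation D (.X i) =
    ∑ j, MvPolynomial.C (D (Pi.single j 1) i) * MvPolynomial.X j :=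
  MvPolynomial.mkDerivation_X _ _ _

lemma linearDerivation_X_mem (i : Fin (N + 1)) :
    linearDerivation D (.X i) ∈ polyGrading N k 1 := by
  rw [linearDerivation_X]
  refine sum_mem fun j _ => ?_
  rw [← MvPolynomial.smul_eq_C_mul]
  exact Submodule.smul_mem _ _ (X_mem N j)

lemma linearDerivation_apply (F : MvPolynomial (Fin (N + 1)) k) :
    linearDerivation D F = ∑ i, linearDerivation D (.X i) * MvPolynomial.pderiv i F := by
  have hsum (E : Fin (N + 1) → Derivation k (MvPolynomial (Fin (N + 1)) k)
      (MvPolynomial (Fin (N + 1)) k)) (G : MvPolynomial (Fin (N + 1)) k) :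
      (∑ i, E i) G = ∑ i, E i G := by
    rw [← Derivation.coeFnAddMonoidHom_apply, map_sum, Finset.sum_apply]
    rfl
  have : linearDerivation D = ∑ i, linearDerivation D (.X i) • MvPolynomial.pderiv i := by
    refine MvPolynomial.derivation_ext fun l => ?_
    rw [hsum]
    simp [MvPolynomial.pderiv_X, Pi.single_apply]
  conv_lhs => rw [this, hsum]
  simp

lemma linearDerivation_mem (n : ℕ) (F : MvPolynomial (Fin (N + 1)) k) (hF : F ∈ polyGrading N k n) :
    linearDerivation D F ∈ polyGrading N k n := by
  rw [linearDerivation_apply]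
  refine sum_mem fun i _ => ?_
  -- Degree zero is separate: a partial derivative lowers the degree only when it is positive, and
  -- constants are killed.
  obtain - | n := n
  · obtain ⟨c, rfl⟩ : ∃ c, F = MvPolynomial.C c :=
      ⟨_, MvPolynomial.totalDegree_eq_zero_iff_eq_C.1 ((MvPolynomial.IsHomogeneous.totalDegree_le
        hF).antisymm zero_le)⟩
    simp
  · rw [add_comm n 1]
    exact SetLike.mul_mem_graded (linearDerivation_X_mem D i) (MvPolynomial.IsHomogeneous.pderiv hF)

lemma eval_linearDerivation_X (x : Fin (N + 1) → k) (i : Fin (N + 1)) :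
    MvPolynomial.eval x (linearDerivation D (.X i)) = D x i := by
  rw [linearDerivation_X]
  conv_rhs => rw [← Finset.univ_sum_single x]
  simp only [map_sum, map_mul, MvPolynomial.eval_C, MvPolynomial.eval_X, Finset.sum_apply]
  refine Finset.sum_congr rfl fun j _ => ?_
  rw [show Pi.single j (x j) = x j • (Pi.single j (1 : k) : Fin (N + 1) → k) by
    rw [← Pi.single_smul, smul_eq_mul, mul_one], map_smul, Pi.smul_apply, smul_eq_mul, mul_comm]

lemma linearDerivation_add (E : Module.End k (Fin (N + 1) → k)) :
    linearDerivation (D + E) = linearDerivation D + linearDerivation E := by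
  refine MvPolynomial.derivation_ext fun i => ?_
  simp [linearDerivation_X, add_mul, Finset.sum_add_distrib]

lemma linearDerivation_smul (a : k) :
    linearDerivation (a • D) = a • linearDerivation D := by
  refine MvPolynomial.derivation_ext fun i => ?_
  simp [linearDerivation_X, Finset.smul_sum, MvPolynomial.smul_eq_C_mul, mul_assoc]

/-- The linear vector field on projective space given by an endomorphism of `k ^ (N + 1)`. -/
def vectorField : SheafDerivation (ProjSpace N k) :=
  Proj.sheafDerivation (linearDerivation D) (linearDerivation_mem D)

lemma section_ext {U : (ProjSpace N k).Opens} {s t : Γ(ProjSpace N k, U)}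
    (h : ∀ p : U, (s.1 p).val = (t.1 p).val) : s = t :=
  Subtype.ext (funext fun p => HomogeneousLocalization.val_injective _ (h p))

lemma val_vectorField {U : (ProjSpace N k).Opens} (s : Γ(ProjSpace N k, U)) (p : U) :
    (((vectorField D).app U s).1 p).val = (linearDerivation D).localization _ (s.1 p).val :=
  HomogeneousLocalization.val_derivation _ _ _

lemma vectorField_add (E : Module.End k (Fin (N + 1) → k)) :
    ∀ U s, (vectorField (D + E)).app U s = (vectorField D + vectorField E).app U s := by
  intro U s
  refine section_ext fun p => ?_
  refine (val_vectorField _ _ _).trans (Eq.trans ?_ (HomogeneousLocalization.val_add _ _).symm)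
  refine Eq.trans ?_ (congrArg₂ (· + ·) (val_vectorField D _ _) (val_vectorField E _ _)).symm
  induction (s.1 p).val using Localization.induction_on with | H z =>
  obtain ⟨a, b⟩ := z
  rw [Derivation.localization_mk, Derivation.localization_mk, Derivation.localization_mk,
    Localization.add_mk_self, linearDerivation_add]
  congr 1
  simp only [Derivation.add_apply]
  ring

lemma vectorField_smul (a : k) (U : (ProjSpace N k).Opens) (s : Γ(ProjSpace N k, U)) :
    (vectorField (a • D)).app U s = (ProjSpace N k).resTop U (scalar N k a) * (vectorField D).app U
      s := by
  refine section_ext fun p => ?_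
  refine (val_vectorField _ _ _).trans (Eq.trans ?_ (HomogeneousLocalization.val_mul _ _).symm)
  refine Eq.trans ?_ (congrArg₂ (· * ·) (val_scalar a _) (val_vectorField D _ _)).symm
  induction (s.1 p).val using Localization.induction_on with | H z =>
  obtain ⟨a, b⟩ := z
  rw [Derivation.localization_mk, Derivation.localization_mk, Localization.mk_mul,
    linearDerivation_smul, one_mul]
  congr 1
  simp only [Derivation.smul_apply, MvPolynomial.smul_eq_C_mul]
  ring

lemma vectorField_scalar (a : k) : (vectorField D).app ⊤ (scalar N k a) = 0 := by
  refine section_ext fun p => ?_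
  refine (val_vectorField _ _ _).trans (Eq.trans ?_ HomogeneousLocalization.val_zero.symm)
  rw [val_scalar, Derivation.localization_mk]
  rw [← MvPolynomial.algebraMap_eq, Derivation.map_algebraMap]
  simpa using Localization.mk_zero 1

lemma res_dehomog_eq_ratio_mul (F : MvPolynomial (Fin (N + 1)) k) (hF : F ∈ polyGrading N k 1)
    (i j : Fin (N + 1)) {W : (ProjSpace N k).Opens} (hi : W ≤ chart N k i)
    (hj : W ≤ chart N k j) :
    ((ProjSpace N k).presheaf.map (homOfLE hi).op).hom (dehomog F hF i) =
      ((ProjSpace N k).presheaf.map (homOfLE hi).op).hom (ratio j i) *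
      ((ProjSpace N k).presheaf.map (homOfLE hj).op).hom (dehomog F hF j) := by
  refine section_ext fun p => ?_
  refine (val_res_dehomog F hF i hi p).trans (Eq.trans ?_ (HomogeneousLocalization.val_mul _
    _).symm)
  refine Eq.trans ?_ (congrArg₂ (· * ·) (res_ratio_apply j i hi p) (val_res_dehomog F hF j hj
    p)).symm
  simp only [Localization.mk_mul, Localization.mk_eq_mk_iff, Localization.r_iff_exists]
  refine ⟨1, ?_⟩
  change 1 * (MvPolynomial.X i * (MvPolynomial.X j ^ 1) * F) =
    1 * (MvPolynomial.X i ^ 1 * (MvPolynomial.X j * F))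
  ring

lemma val_dehomog {d : ℕ} (F : MvPolynomial (Fin (N + 1)) k) (hF : F ∈ polyGrading N k d)
    (j : Fin (N + 1)) (p : chart N k j) :
    ((dehomog F hF j).1 p).val =
      Localization.mk F ⟨.X j ^ d, Submonoid.pow_mem _ p.2 d⟩ := by
  have := val_res_dehomog F hF j le_rfl p
  rwa [show (homOfLE (le_refl (chart N k j))).op = 𝟙 _ from rfl,
    CategoryTheory.Functor.map_id] at this

/-- This is the quotient rule for $F/X_j$, with the negative term moved to the left. -/
lemma vectorField_dehomog_of_degree_one (F : MvPolynomial (Fin (N + 1)) k)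
    (hF : F ∈ polyGrading N k 1) (j : Fin (N + 1)) :
    (vectorField D).app _ (dehomog F hF j) +
        dehomog F hF j * dehomog _ (linearDerivation_X_mem D j) j =
      dehomog _ (linearDerivation_mem D 1 F hF) j := by
  refine section_ext fun p => ?_
  refine (HomogeneousLocalization.val_add _ _).trans (Eq.trans ?_
    (val_dehomog _ (linearDerivation_mem D 1 F hF) j p).symm)
  refine (congrArg₂ (· + ·)
    ((val_vectorField D _ p).trans (congrArg _ (val_dehomog F hF j p)))
    ((HomogeneousLocalization.val_mul _ _).trans (congrArg₂ (· * ·) (val_dehomog F hF j p)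
      (val_dehomog _ (linearDerivation_X_mem D j) j p)))).trans ?_
  rw [Derivation.localization_mk]
  simp only [pow_one, Localization.mk_mul, Localization.add_mk, Localization.mk_eq_mk_iff,
    Localization.r_iff_exists]
  refine ⟨1, ?_⟩
  simp only [Submonoid.coe_mul]
  ring

/-- In characteristic $2$ the denominator $X_j^2$ is itself killed by every derivation. -/
lemma vectorField_dehomog_of_degree_two [CharP k 2] (F : MvPolynomial (Fin (N + 1)) k)
    (hF : F ∈ polyGrading N k 2) (hD : linearDerivation D F = 0) (j : Fin (N + 1)) :
    (vectorField D).app _ (dehomog F hF j) = 0 := by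
  refine section_ext fun p => ?_
  refine (val_vectorField D _ p).trans (Eq.trans ?_ HomogeneousLocalization.val_zero.symm)
  rw [val_dehomog, Derivation.localization_mk, hD, Derivation.leibniz_pow, two_smul,
    CharTwo.add_self_eq_zero, mul_zero, mul_zero, sub_zero]
  exact Localization.mk_zero _

/-- The quadratic form with coefficient matrix `M`, as a polynomial. -/
def quadric (M : Matrix (Fin (N + 1)) (Fin (N + 1)) k) : MvPolynomial (Fin (N + 1)) k :=
  ∑ i, ∑ j, MvPolynomial.C (M i j) * (.X i * .X j)

lemma exists_eq_quadric {q : MvPolynomial (Fin (N + 1)) k} (hq : q ∈ polyGrading N k 2) :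
    ∃ M, q = quadric M := by
  rw [polyGrading, ← MvPolynomial.homogeneousSubmodule_one_pow,
    MvPolynomial.homogeneousSubmodule_one_eq_span_X, pow_two, Submodule.span_mul_span] at hq
  induction hq using Submodule.span_induction with
  | mem x hx =>
    obtain ⟨_, ⟨i, rfl⟩, _, ⟨j, rfl⟩, rfl⟩ := hx
    refine ⟨Matrix.single i j 1, ?_⟩
    dsimp only [quadric]
    rw [Finset.sum_eq_single i, Finset.sum_eq_single j]
    · simp
    · intro b _ hb
      simp [Matrix.single_apply_of_col_ne _ _ hb.symm]
    · simp
    · intro b _ hb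
      simp [Matrix.single_apply_of_row_ne hb.symm]
    · simp
  | zero => exact ⟨0, by simp [quadric]⟩
  | add x y _ _ hx hy =>
    obtain ⟨M, rfl⟩ := hx
    obtain ⟨M', rfl⟩ := hy
    exact ⟨M + M', by simp [quadric, add_mul, Finset.sum_add_distrib]⟩
  | smul a x _ hx =>
    obtain ⟨M, rfl⟩ := hx
    exact ⟨a • M, by simp [quadric, MvPolynomial.smul_eq_C_mul, Finset.mul_sum, mul_assoc]⟩

lemma toQuadraticForm'_apply_eq_sum {R : Type*} [CommRing R]
   (M : Matrix (Fin (N + 1)) (Fin (N + 1)) R) (x : Fin (N + 1) → R) :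
   M.toQuadraticForm' x = ∑ i, ∑ j, M i j * (x i * x j) := by
  rw [Matrix.toQuadraticForm'_apply]
  simp only [dotProduct, Matrix.mulVec, Finset.mul_sum]
  exact Finset.sum_congr rfl fun i _ => Finset.sum_congr rfl fun j _ => by ring

lemma polar_toQuadraticForm'_eq_sum {R : Type*} [CommRing R]
   (M : Matrix (Fin (N + 1)) (Fin (N + 1)) R) (x y : Fin (N + 1) → R) :
   QuadraticMap.polar M.toQuadraticForm' x y = ∑ i, ∑ j, M i j * (x i * y j + y i * x j) := by
  simp only [QuadraticMap.polar, toQuadraticForm'_apply_eq_sum, ← Finset.sum_sub_distrib]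
  exact Finset.sum_congr rfl fun i _ => Finset.sum_congr rfl fun j _ => by
    simp only [Pi.add_apply]; ring

variable (M : Matrix (Fin (N + 1)) (Fin (N + 1)) k)

lemma eval_quadric (x : Fin (N + 1) → k) :
    MvPolynomial.eval x (quadric M) = M.toQuadraticForm' x := by
  simp [quadric, toQuadraticForm'_apply_eq_sum]

/-- The derivative of a quadratic form at $x$ in the direction $Dx$ is the polar form. This links
the vector field to the identities satisfied by $P(A)$. -/
lemma eval_linearDerivation_quadric (D : Module.End k (Fin (N + 1) → k)) (x : Fin (N + 1) → k) :
    MvPolynomial.eval x (linearDerivation D (quadric M)) =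
      QuadraticMap.polar M.toQuadraticForm' x (D x) := by
  simp only [quadric, map_sum, Derivation.leibniz, MvPolynomial.derivation_C, smul_eq_mul,
    map_add, map_mul, MvPolynomial.eval_C, MvPolynomial.eval_X, eval_linearDerivation_X,
    polar_toQuadraticForm'_eq_sum, mul_zero, add_zero]
  exact Finset.sum_congr rfl fun i _ => Finset.sum_congr rfl fun j _ => by ring

lemma linearDerivation_quadric [Infinite k] (D : Module.End k (Fin (N + 1) → k))
    (h : ∀ x, QuadraticMap.polar M.toQuadraticForm' x (D x) = 0) :
    linearDerivation D (quadric M) = 0 :=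
  MvPolynomial.funext fun x => by rw [eval_linearDerivation_quadric, h, map_zero]

lemma aeval_quadric_dualNumber (x v : Fin (N + 1) → k) :
    MvPolynomial.aeval (fun i => (TrivSqZeroExt.inl (x i) + TrivSqZeroExt.inr (v i) : DualNumber k))
      (quadric M) = TrivSqZeroExt.inl (M.toQuadraticForm' x) +
        TrivSqZeroExt.inr (QuadraticMap.polar M.toQuadraticForm' x v) := by
  ext
  · simp [quadric, toQuadraticForm'_apply_eq_sum, TrivSqZeroExt.fst_sum,
      TrivSqZeroExt.algebraMap_eq_inl]
  · simp only [quadric, polar_toQuadraticForm'_eq_sum, map_sum, map_mul, MvPolynomial.aeval_X,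
      MvPolynomial.algHom_C, TrivSqZeroExt.snd_sum, TrivSqZeroExt.algebraMap_eq_inl,
      TrivSqZeroExt.snd_mul, TrivSqZeroExt.snd_add, TrivSqZeroExt.snd_inl, TrivSqZeroExt.snd_inr,
      TrivSqZeroExt.fst_mul, TrivSqZeroExt.fst_add, TrivSqZeroExt.fst_inl, TrivSqZeroExt.fst_inr]
    rw [zero_add]
    refine Finset.sum_congr rfl fun i _ => Finset.sum_congr rfl fun j _ => ?_
    simp

lemma resTop_scalar (c : k) (j : Fin (N + 1)) :
    (ProjSpace N k).resTop (chart N k j) (scalar N k c) =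
      dehomog (.C c) (MvPolynomial.isHomogeneous_C _ c) j := by
  refine section_ext fun p => ?_
  exact (val_scalar c _).trans (val_dehomog (.C c) (MvPolynomial.isHomogeneous_C _ c) j p).symm

section evalChart

variable {R : Type*} [CommRing R] [Algebra k R] (x : Fin (N + 1) → R) (j : Fin (N + 1))
  (hx : IsUnit (x j))

/-- Evaluation of fractions of degree zero at `x`, where `x j` is invertible. -/
def evalAway : HomogeneousLocalization.Away (polyGrading N k) (MvPolynomial.X j) →+* R :=
  (IsLocalization.Away.lift
    (S := Localization.Away (MvPolynomial.X j : MvPolynomial (Fin (N + 1)) k))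
    (MvPolynomial.X j) (g := (MvPolynomial.aeval x : _ →ₐ[k] R).toRingHom)
    (by simpa using hx)).comp (algebraMap _ _)

lemma evalAway_mk {d : ℕ} (F : MvPolynomial (Fin (N + 1)) k) (hF) :
    evalAway x j hx (HomogeneousLocalization.Away.mk (polyGrading N k) (X_mem N j) d F hF) *
      x j ^ d = MvPolynomial.aeval x F := by
  have h (G : MvPolynomial (Fin (N + 1)) k) : IsLocalization.Away.lift
      (S := Localization.Away (MvPolynomial.X j : MvPolynomial (Fin (N + 1)) k))
      (MvPolynomial.X j) (g := (MvPolynomial.aeval x : _ →ₐ[k] R).toRingHom)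
      (by simpa using hx) (algebraMap _ _ G) = MvPolynomial.aeval x G :=
    IsLocalization.Away.lift_eq _ _ _
  have hj : x j ^ d = MvPolynomial.aeval (R := k) x (.X j ^ d) := by simp
  rw [← h F, evalAway, RingHom.comp_apply, HomogeneousLocalization.algebraMap_apply,
    HomogeneousLocalization.Away.val_mk, Localization.mk_eq_mk', hj, ← h, ← map_mul]
  congr 1
  exact IsLocalization.mk'_spec (Localization.Away (MvPolynomial.X j)) F
    (⟨MvPolynomial.X j ^ d, _, rfl⟩ : Submonoid.powers (MvPolynomial.X j))

/-- Evaluation of functions on `D₊(X_j)` at an `R`-valued point with homogeneous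
coordinates `x`, where `x j` is invertible. -/
def evalChart : Γ(ProjSpace N k, chart N k j) →+* R :=
  (evalAway x j hx).comp (Proj.basicOpenIsoAway (polyGrading N k) (MvPolynomial.X j) (X_mem N j)
    one_pos).inv.hom

/-- Multiplying by $x_j^d$ avoids division in $R$, which may be the ring of dual numbers. -/
lemma evalChart_dehomog {d : ℕ} (F : MvPolynomial (Fin (N + 1)) k) (hF : F ∈ polyGrading N k d) :
    evalChart x j hx (dehomog F hF j) * x j ^ d = MvPolynomial.aeval x F := by
  rw [← evalAway_mk x j hx F (by simpa using hF)]
  have h := Proj.basicOpenIsoAway_hom (polyGrading N k) (MvPolynomial.X j) (X_mem N j) one_pos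
  have h' := (Proj.basicOpenIsoAway (polyGrading N k) (MvPolynomial.X j) (X_mem N j)
    one_pos).hom_inv_id
  rw [h] at h'
  exact congr(evalAway x j hx (($h').hom (HomogeneousLocalization.Away.mk (polyGrading N k)
    (X_mem N j) d F (by simpa using hF))) * x j ^ d)

lemma evalChart_dehomog_C (c : k) : evalChart x j hx (dehomog (.C c) (MvPolynomial.isHomogeneous_C
    _ c) j) =
      algebraMap k R c := by
  have := evalChart_dehomog x j hx (.C c) (MvPolynomial.isHomogeneous_C _ c)
  simpa using this

lemma evalChart_dehomog_eq_zero_iff {d : ℕ} (F : MvPolynomial (Fin (N + 1)) k) (hF : F ∈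
    polyGrading N k d) :
    evalChart x j hx (dehomog F hF j) = 0 ↔ MvPolynomial.aeval x F = 0 := by
  rw [← evalChart_dehomog x j hx F hF, (hx.pow d).mul_left_eq_zero]

end evalChart
end ProjSpace
end AlgebraicGeometry
end

/-! ### Tangent spaces of smooth algebras and the Jacobian criterion. -/

noncomputable section

section TangentSpace

variable {k A : Type u} [Field k] [CommRing A] [Algebra k A]

/-- The derivation at a rational point given by a point over the dual numbers. -/
def AlgHom.tangentDerivation [Module A k] [IsScalarTower k A k] (ψ : A →ₐ[k] DualNumber k)
    (hψ : ∀ (a : A) (z : k), a • z = (ψ a).fst * z) : Derivation k A k :=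
  Derivation.mk' ((TrivSqZeroExt.sndHom k k).comp ψ.toLinearMap) fun a b => by
    simp only [hψ]
    simp [mul_comm]

/-- Dual-number points over the rational point $\varphi$ are derivations $A\to k$, that is, linear
maps on $\Omega_{A/k}$, which is free of rank $n$. Their values on the functions $a_l$ therefore
span at most $n$ dimensions. -/
lemma finrank_le_of_isStandardSmoothOfRelativeDimension {n : ℕ}
    [Algebra.IsStandardSmoothOfRelativeDimension n k A] (φ : A →ₐ[k] k) {ι : Type*} [Finite ι]
    (a : ι → A) (V : Submodule k (ι → k))
    (hV : ∀ v ∈ V, ∃ ψ : A →ₐ[k] DualNumber k, (∀ b, (ψ b).fst = φ b) ∧ ∀ l, (ψ (a l)).snd = v l) :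
    Module.finrank k V ≤ n := by
  have : Nontrivial A := φ.toRingHom.domain_nontrivial
  let : Algebra A k := φ.toRingHom.toAlgebra
  have hsmul (b : A) (z : k) : b • z = φ b * z := rfl
  have : IsScalarTower k A k := ⟨fun c b z => by simp [hsmul, mul_assoc]⟩
  have : Algebra.IsStandardSmooth k A :=
    Algebra.IsStandardSmoothOfRelativeDimension.isStandardSmooth n
  have hrank := Algebra.IsStandardSmoothOfRelativeDimension.rank_kaehlerDifferential (R := k) (S :=
    A) n
  let b := Module.Free.chooseBasis A Ω[A⁄k]
  have hcard : Fintype.card (Module.Free.ChooseBasisIndex A Ω[A⁄k]) = n := by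
    rw [← Module.finrank_eq_card_basis b, Module.finrank, hrank, Cardinal.toNat_natCast]
  let e := b.constr k (M' := k)
  let L : (Ω[A⁄k] →ₗ[A] k) →ₗ[k] ι → k :=
    { toFun := fun f l => f (KaehlerDifferential.D k A (a l))
      map_add' := fun _ _ => rfl
      map_smul' := fun _ _ => rfl }
  have hVL : V ≤ LinearMap.range (L ∘ₗ e.toLinearMap) := fun v hv => by
    obtain ⟨ψ, h1, h2⟩ := hV v hv
    let d := ψ.tangentDerivation fun b z => by rw [h1, hsmul]
    refine ⟨e.symm d.liftKaehlerDifferential, funext fun l => ?_⟩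
    simp only [LinearMap.comp_apply, LinearEquiv.coe_coe, LinearEquiv.apply_symm_apply]
    exact (d.liftKaehlerDifferential_comp_D (a l)).trans (h2 l)
  calc Module.finrank k V ≤ Module.finrank k (LinearMap.range (L ∘ₗ e.toLinearMap)) :=
        Submodule.finrank_mono hVL
    _ ≤ Module.finrank k (Module.Free.ChooseBasisIndex A Ω[A⁄k] → k) :=
        LinearMap.finrank_range_le _
    _ = n := by rw [Module.finrank_fintype_fun_eq_card, hcard]

/-- Some $g$ of the covering family does not vanish at the rational point, and all the dual-number
points extend to $A_g$. -/
lemma finrank_le_of_locally_isStandardSmoothOfRelativeDimension {n : ℕ}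
    (h : RingHom.Locally (RingHom.IsStandardSmoothOfRelativeDimension n) (algebraMap k A))
    (φ : A →ₐ[k] k) {ι : Type*} [Finite ι]
    (a : ι → A) (V : Submodule k (ι → k))
    (hV : ∀ v ∈ V, ∃ ψ : A →ₐ[k] DualNumber k, (∀ b, (ψ b).fst = φ b) ∧ ∀ l, (ψ (a l)).snd = v l) :
    Module.finrank k V ≤ n := by
  obtain ⟨s, hs, h⟩ := h
  obtain ⟨g, hg, hφ⟩ : ∃ g ∈ s, φ g ≠ 0 := by
    by_contra! hc
    have : (1 : A) ∈ RingHom.ker φ := by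
      have h1 : Ideal.span s ≤ RingHom.ker φ := Ideal.span_le.2 hc
      exact h1 (hs ▸ trivial)
    simp at this
  have := h g hg
  rw [← IsScalarTower.algebraMap_eq, RingHom.isStandardSmoothOfRelativeDimension_algebraMap] at this
  have hu (y : Submonoid.powers g) : IsUnit (φ y) := by
    obtain ⟨_, m, rfl⟩ := y
    simpa using IsUnit.pow m hφ.isUnit
  refine finrank_le_of_isStandardSmoothOfRelativeDimension
    (IsLocalization.liftAlgHom (M := .powers g) (S := Localization.Away g) hu)
    (fun l => algebraMap A _ (a l)) V fun v hv => ?_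
  · obtain ⟨ψ, h1, h2⟩ := hV v hv
    have hψ (y : Submonoid.powers g) : IsUnit (ψ y) := by
      rw [TrivSqZeroExt.isUnit_iff_isUnit_fst, h1]
      exact hu y
    refine ⟨IsLocalization.liftAlgHom (M := .powers g) hψ, ?_, ?_⟩
    · have : (TrivSqZeroExt.fstHom k k k).comp (IsLocalization.liftAlgHom (M := .powers g)
          (S := Localization.Away g) (f := ψ) hψ) =
            IsLocalization.liftAlgHom (M := .powers g) hu := by
        refine IsLocalization.algHom_ext (.powers g) (AlgHom.ext fun b => ?_)
        exact (congrArg TrivSqZeroExt.fst (IsLocalization.lift_eq _ b)).trans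
          ((h1 b).trans (IsLocalization.lift_eq hu b).symm)
      exact fun b => congr($this b)
    · intro l
      simp [h2]

end TangentSpace

namespace AlgebraicGeometry

namespace ProjSpace

variable {N : ℕ} {k : Type u} [Field k]

lemma exists_eq_dehomog (j : Fin (N + 1)) (s : Γ(ProjSpace N k, chart N k j)) :
    ∃ (d : ℕ) (F : MvPolynomial (Fin (N + 1)) k) (hF : F ∈ polyGrading N k d),
      s = dehomog F hF j := by
  have h := (Proj.basicOpenIsoAway (polyGrading N k) (MvPolynomial.X j) (X_mem N j)
    one_pos).inv_hom_id
  rw [Proj.basicOpenIsoAway_hom] at h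
  obtain ⟨d, F, hF, h'⟩ := HomogeneousLocalization.Away.mk_surjective (polyGrading N k)
    (X_mem N j) ((Proj.basicOpenIsoAway (polyGrading N k) (MvPolynomial.X j) (X_mem N j)
    one_pos).inv.hom s)
  refine ⟨d, F, by simpa using hF, ?_⟩
  rw [dehomog, h']
  exact congr(($h).hom s).symm

lemma map_evalChart {R S : Type*} [CommRing R] [Algebra k R] [CommRing S] [Algebra k S]
    (g : R →ₐ[k] S) (x : Fin (N + 1) → R) (j : Fin (N + 1)) (hx : IsUnit (x j))
    (s : Γ(ProjSpace N k, chart N k j)) :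
    g (evalChart x j hx s) = evalChart (fun l => g (x l)) j (hx.map g) s := by
  obtain ⟨d, F, hF, rfl⟩ := exists_eq_dehomog j s
  refine (((hx.map g).pow d).mul_left_inj).1 ?_
  rw [evalChart_dehomog, ← map_pow, ← map_mul, evalChart_dehomog, MvPolynomial.comp_aeval_apply]

/-- A polynomial point over the dual numbers. -/
def dualPoint (x v : Fin (N + 1) → k) (l : Fin (N + 1)) : DualNumber k :=
  TrivSqZeroExt.inl (x l) + TrivSqZeroExt.inr (v l)

lemma isUnit_dualPoint {x : Fin (N + 1) → k} {j : Fin (N + 1)} (hx : x j ≠ 0)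
    (v : Fin (N + 1) → k) : IsUnit (dualPoint x v j) := by
  rw [TrivSqZeroExt.isUnit_iff_isUnit_fst]
  simpa [dualPoint] using hx

lemma fst_evalChart_dualPoint {x : Fin (N + 1) → k} {j : Fin (N + 1)} (hx : x j ≠ 0)
    (v : Fin (N + 1) → k) (s : Γ(ProjSpace N k, chart N k j)) :
    (evalChart (k := k) (dualPoint x v) j (isUnit_dualPoint hx v) s).fst =
      evalChart (k := k) x j hx.isUnit s := by
  have := map_evalChart (TrivSqZeroExt.fstHom k k k) (dualPoint x v) j (isUnit_dualPoint hx v) s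
  refine this.trans ?_
  congr 2
  ext l
  simp [dualPoint]

lemma evalChart_dualPoint_quadric_eq_zero {x : Fin (N + 1) → k} {j : Fin (N + 1)} (hx : x j ≠ 0)
    (v : Fin (N + 1) → k) {M : Matrix (Fin (N + 1)) (Fin (N + 1)) k}
    (hM : quadric M ∈ polyGrading N k 2) (h : M.toQuadraticForm' x = 0)
    (h' : QuadraticMap.polar M.toQuadraticForm' x v = 0) :
    evalChart (k := k) (dualPoint x v) j (isUnit_dualPoint hx v) (dehomog (quadric M) hM j) = 0 :=
      by
  rw [evalChart_dehomog_eq_zero_iff]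
  refine (aeval_quadric_dualNumber M x v).trans ?_
  rw [h, h']
  simp

lemma snd_evalChart_dualPoint_ratio {x : Fin (N + 1) → k} {j : Fin (N + 1)} (hx : x j ≠ 0)
    {v : Fin (N + 1) → k} (hv : v j = 0) (l : Fin (N + 1)) :
    x j * (evalChart (k := k) (dualPoint x v) j (isUnit_dualPoint hx v) (ratio l j)).snd = v l := by
  have := congrArg TrivSqZeroExt.snd
    (evalChart_dehomog (k := k) (dualPoint x v) j (isUnit_dualPoint hx v) (.X l) (X_mem N l))
  rw [MvPolynomial.aeval_X] at this
  rw [mul_comm]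
  simpa [dualPoint, hv, ratio] using this

end ProjSpace

namespace IsSmoothIntersectionOfTwoQuadrics

variable {N : ℕ} {k : Type u} [Field k] {Z : Scheme.{u}} {i : Z ⟶ ProjSpace N k}

open ProjSpace

lemma exists_matrices (hi : IsSmoothIntersectionOfTwoQuadrics i) :
    ∃ (M M' : Matrix (Fin (N + 1)) (Fin (N + 1)) k) (hM : quadric M ∈ polyGrading N k 2)
      (hM' : quadric M' ∈ polyGrading N k 2), ∀ j : Fin (N + 1),
      RingHom.ker (i.app (chart N k j)).hom =
        Ideal.span {dehomog (quadric M) hM j, dehomog (quadric M') hM' j} := by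
  obtain ⟨q, q', hq, hq', h⟩ := hi.exists_equations
  obtain ⟨M, rfl⟩ := exists_eq_quadric hq
  obtain ⟨M', rfl⟩ := exists_eq_quadric hq'
  have := hi.isClosedImmersion
  refine ⟨M, M', hq, hq', fun j => ?_⟩
  rw [← h j, Scheme.Hom.ker_apply]

/-- The constants in the functions on the standard open sets of `Z`. -/
def constants (i : Z ⟶ ProjSpace N k) (j : Fin (N + 1)) : k →+* Γ(Z, i ⁻¹ᵁ chart N k j) :=
  (i.app (chart N k j)).hom.comp (((ProjSpace N k).resTop (chart N k j)).comp (scalar N k))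

lemma constants_eq (i : Z ⟶ ProjSpace N k) (j : Fin (N + 1)) :
    constants i j = ((Scheme.ΓSpecIso (.of k)).inv ≫
      (i ≫ toSpec N k).appLE ⊤ (i ⁻¹ᵁ chart N k j) le_top).hom := by
  have h1 := Scheme.Hom.map_appLE i (le_refl (i ⁻¹ᵁ chart N k j))
    (homOfLE le_top : chart N k j ⟶ ⊤).op
  rw [Scheme.Hom.appLE_eq_app] at h1
  have h2 := Scheme.Hom.comp_appLE i (toSpec N k) ⊤ (i ⁻¹ᵁ chart N k j) le_top
  exact congr(((Scheme.ΓSpecIso (.of k)).inv ≫ (toSpec N k).appTop ≫ $h1).hom).trans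
    congr(((Scheme.ΓSpecIso (.of k)).inv ≫ $h2).hom).symm

lemma locally_constants (hi : IsSmoothIntersectionOfTwoQuadrics i) (j : Fin (N + 1)) :
    RingHom.Locally (RingHom.IsStandardSmoothOfRelativeDimension (N - 2)) (constants i j) := by
  have := hi.isClosedImmersion
  have h := HasRingHomProperty.appLE (P := @SmoothOfRelativeDimension (N - 2)) _ hi.smooth
    ⟨⊤, isAffineOpen_top _⟩ ⟨i ⁻¹ᵁ chart N k j, (isAffineOpen_chart j).preimage i⟩ le_top
  rw [constants_eq]
  exact (RingHom.locally_respectsIso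
    RingHom.isStandardSmoothOfRelativeDimension_respectsIso).2 _
    (Scheme.ΓSpecIso (.of k)).symm.commRingCatIsoToRingEquiv h

/-- At a singular base point the two linear conditions $\beta(x,v)=\beta'(x,v)=0$ follow from a
single one, $B(v)=0$. With the normalisation $v_j=0$ this leaves tangent vectors in a space of
dimension at least $N-1$, more than the relative dimension $N-2$. -/
theorem isNonsingularPencil (hi : IsSmoothIntersectionOfTwoQuadrics i) (hN : 2 ≤ N)
    {M M' : Matrix (Fin (N + 1)) (Fin (N + 1)) k} {hM : quadric M ∈ polyGrading N k 2}
    {hM' : quadric M' ∈ polyGrading N k 2} (h : ∀ j : Fin (N + 1),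
      RingHom.ker (i.app (chart N k j)).hom =
        Ideal.span {dehomog (quadric M) hM j, dehomog (quadric M') hM' j}) :
    IsNonsingularPencil M.toQuadraticForm' M'.toQuadraticForm' := by
  intro x a c hac hq hq' hp
  by_contra hx
  obtain ⟨j, hj⟩ : ∃ j, x j ≠ 0 := Function.ne_iff.1 hx
  have := hi.isClosedImmersion
  obtain ⟨B, hB⟩ : ∃ B : (Fin (N + 1) → k) →ₗ[k] k, ∀ v, B v = 0 →
      QuadraticMap.polar M.toQuadraticForm' x v = 0 ∧
        QuadraticMap.polar M'.toQuadraticForm' x v = 0 := by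
    rcases hac with ha | hc
    · refine ⟨QuadraticMap.polarBilin M'.toQuadraticForm' x, fun v hv => ?_⟩
      have := hp v
      rw [QuadraticMap.polarBilin_apply_apply] at hv
      simp_all
    · refine ⟨QuadraticMap.polarBilin M.toQuadraticForm' x, fun v hv => ?_⟩
      have := hp v
      rw [QuadraticMap.polarBilin_apply_apply] at hv
      simp_all
  let A := Γ(Z, i ⁻¹ᵁ chart N k j)
  let : Algebra k A := (constants i j).toAlgebra
  have hsurj : Function.Surjective (i.app (chart N k j)).hom :=
    i.app_surjective _ (isAffineOpen_chart j)
  have hpt (v : Fin (N + 1) → k) (hv : B v = 0) : ∃ ψ : A →ₐ[k] DualNumber k,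
      ∀ s, ψ ((i.app (chart N k j)).hom s) =
        evalChart (k := k) (dualPoint x v) j (isUnit_dualPoint hj v) s := by
    have hker : RingHom.ker (i.app (chart N k j)).hom ≤
        RingHom.ker (evalChart (k := k) (dualPoint x v) j (isUnit_dualPoint hj v)) := by
      rw [h j, Ideal.span_le]
      rintro _ (rfl | rfl)
      · exact evalChart_dualPoint_quadric_eq_zero hj v hM hq (hB v hv).1
      · exact evalChart_dualPoint_quadric_eq_zero hj v hM' hq' (hB v hv).2
    let f := RingHom.liftOfSurjective (i.app (chart N k j)).hom hsurj ⟨_, hker⟩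
    have hf (s) : f ((i.app (chart N k j)).hom s) =
        evalChart (k := k) (dualPoint x v) j (isUnit_dualPoint hj v) s :=
      RingHom.liftOfRightInverse_comp_apply _ _ _ ⟨_, hker⟩ s
    refine ⟨{ f with commutes' := fun r => ?_ }, hf⟩
    refine (hf _).trans ?_
    rw [RingHom.comp_apply, resTop_scalar, evalChart_dehomog_C]
  obtain ⟨ψ₀, hψ₀⟩ := hpt 0 (map_zero B)
  let V := LinearMap.ker ((LinearMap.proj j).prod B)
  have hle := finrank_le_of_locally_isStandardSmoothOfRelativeDimension (k := k) (A := A)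
    (n := N - 2) (hi.locally_constants j) ((TrivSqZeroExt.fstHom k k k).comp ψ₀)
    -- The factor $x_j$ makes the $\varepsilon$-part of these functions at $x+\varepsilon v$ exactly
    -- $v_l$, given $v_j=0$.
    (fun l => x j • (i.app (chart N k j)).hom (ratio l j)) V fun v hv => by
      have hv1 : v j = 0 := congrArg Prod.fst hv
      obtain ⟨ψ, hψ⟩ := hpt v (congrArg Prod.snd hv)
      refine ⟨ψ, fun b => ?_, fun l => ?_⟩
      · obtain ⟨s, rfl⟩ := hsurj b
        rw [AlgHom.comp_apply, hψ, hψ₀]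
        exact (fst_evalChart_dualPoint hj v s).trans (fst_evalChart_dualPoint hj 0 s).symm
      · rw [map_smul, hψ]
        exact snd_evalChart_dualPoint_ratio hj hv1 l
  have := LinearMap.finrank_range_add_finrank_ker ((LinearMap.proj j).prod B)
  have h2 := Submodule.finrank_le (LinearMap.range ((LinearMap.proj j).prod B))
  simp only [Module.finrank_fintype_fun_eq_card, Fintype.card_fin, Module.finrank_prod,
    Module.finrank_self] at this h2
  change Module.finrank k (LinearMap.ker ((LinearMap.proj j).prod B)) ≤ _ at hle
  omega

end IsSmoothIntersectionOfTwoQuadrics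

end AlgebraicGeometry
end

/-! ### Vector fields tangent to $Z$ and the endomorphisms $1+eD$ of $Z_T$. -/

noncomputable section

namespace AlgebraicGeometry

namespace ProjSpace

variable {N : ℕ} {k : Type u} [Field k]

lemma perturb_vectorField_toSpec {Y : Scheme.{u}} (p : Y ⟶ ProjSpace N k) {e : Γ(Y, ⊤)} (he : e * e
    = 0)
    (D : Module.End k (Fin (N + 1) → k)) :
    (vectorField D).perturb p he ≫ toSpec N k = p ≫ toSpec N k := by
  refine ext_of_isAffine ?_
  rw [Scheme.Hom.comp_appTop, Scheme.Hom.comp_appTop]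
  refine (cancel_epi (Scheme.ΓSpecIso (.of k)).inv).1 ?_
  ext c
  change (p.app ⊤).hom (scalar N k c) + Y.resTop _ e *
    (p.app ⊤).hom ((vectorField D).app ⊤ (scalar N k c)) = (p.app ⊤).hom (scalar N k c)
  rw [vectorField_scalar, map_zero, mul_zero, add_zero]

variable {Z : Scheme.{u}} (i : Z ⟶ ProjSpace N k)

/-- The linear vector field given by `D` is tangent to the closed subscheme `i : Z ⟶ ℙ^N`. -/
def IsTangentTo (D : Module.End k (Fin (N + 1) → k)) : Prop :=
  ∀ (j : Fin (N + 1)) (s : Γ(ProjSpace N k, chart N k j)), (i.app _).hom s = 0 →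
    (i.app _).hom ((vectorField D).app _ s) = 0

variable {i}

lemma vectorField_zero (U : (ProjSpace N k).Opens) (s : Γ(ProjSpace N k, U)) :
    (vectorField 0).app U s = 0 := by
  have := vectorField_smul (N := N) (k := k) 0 0 U s
  rwa [map_zero, map_zero, zero_mul, smul_zero] at this

lemma IsTangentTo.add {D E : Module.End k (Fin (N + 1) → k)} (hD : IsTangentTo i D)
    (hE : IsTangentTo i E) : IsTangentTo i (D + E) := fun j s hs => by
  rw [vectorField_add, SheafDerivation.add_app, map_add, hD j s hs, hE j s hs, add_zero]

lemma IsTangentTo.smul (a : k) {D : Module.End k (Fin (N + 1) → k)} (hD : IsTangentTo i D) :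
    IsTangentTo i (a • D) := fun j s hs => by
  rw [vectorField_smul, map_mul, hD j s hs, mul_zero]

/-- The field kills both equations, so by the Leibniz rule it sends a combination $aq+bq'$ to
$qD(a)+q'D(b)$, which vanishes on $Z$. -/
lemma isTangentTo_of_polar_eq_zero [CharP k 2] [Infinite k]
    {M M' : Matrix (Fin (N + 1)) (Fin (N + 1)) k} {hM : quadric M ∈ polyGrading N k 2}
    {hM' : quadric M' ∈ polyGrading N k 2} (h : ∀ j : Fin (N + 1),
      RingHom.ker (i.app (chart N k j)).hom =
        Ideal.span {dehomog (quadric M) hM j, dehomog (quadric M') hM' j})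
    {D : Module.End k (Fin (N + 1) → k)}
    (hD : ∀ x, QuadraticMap.polar M.toQuadraticForm' x (D x) = 0)
    (hD' : ∀ x, QuadraticMap.polar M'.toQuadraticForm' x (D x) = 0) : IsTangentTo i D := by
  intro j s hs
  have hq : (i.app _).hom (dehomog (quadric M) hM j) = 0 := by
    rw [← RingHom.mem_ker, h j]
    exact Ideal.subset_span (Set.mem_insert _ _)
  have hq' : (i.app _).hom (dehomog (quadric M') hM' j) = 0 := by
    rw [← RingHom.mem_ker, h j]
    exact Ideal.subset_span (Set.mem_insert_of_mem _ rfl)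
  rw [← RingHom.mem_ker, h j, Ideal.mem_span_pair] at hs
  obtain ⟨a, b, rfl⟩ := hs
  rw [SheafDerivation.app_add, SheafDerivation.app_mul, SheafDerivation.app_mul,
    vectorField_dehomog_of_degree_two D _ hM (linearDerivation_quadric M D hD),
    vectorField_dehomog_of_degree_two D _ hM' (linearDerivation_quadric M' D hD')]
  simp [hq, hq']

variable {Y : Scheme.{u}}

/-- This is the condition under which the perturbed morphism to $\mathbb{P}^N$ factors through $Z$.
-/
lemma IsTangentTo.ker_le_ker_perturb [IsClosedImmersion i] {D : Module.End k (Fin (N + 1) → k)}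
    (hD : IsTangentTo i D) (f : Y ⟶ Z) [QuasiCompact f] {e : Γ(Y, ⊤)} (he : e * e = 0) :
    i.ker ≤ ((vectorField D).perturb (f ≫ i) he).ker := by
  have hqc : QuasiCompact ((vectorField D).perturb (f ≫ i) he) :=
    ⟨(inferInstance : QuasiCompact (f ≫ i)).isCompact_preimage⟩
  refine Scheme.IdealSheafData.le_of_iSup_eq_top
    (fun j : ULift.{u} (Fin (N + 1)) => ⟨chart N k j.down, isAffineOpen_chart j.down⟩)
    (iSup_chart N k) fun j => ?_
  rw [Scheme.Hom.ker_apply, Scheme.Hom.ker_apply]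
  intro s hs
  have hs' : (i.app (chart N k j.down)).hom s = 0 := hs
  have h (a : Γ(ProjSpace N k, chart N k j.down)) (ha : (i.app (chart N k j.down)).hom a = 0) :
      ((f ≫ i).app (chart N k j.down)).hom a = 0 := by
    refine congr($(Scheme.Hom.comp_app f i (chart N k j.down)).hom a).trans ?_
    exact (congrArg _ ha).trans (map_zero (f.app _).hom)
  change ((f ≫ i).app (chart N k j.down)).hom s + Y.resTop _ e *
    ((f ≫ i).app (chart N k j.down)).hom ((vectorField D).app _ s) = 0
  rw [h s hs', h _ (hD _ s hs'), mul_zero, add_zero]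

end ProjSpace

open ProjSpace

variable {N : ℕ} {k : Type u} [Field k] {Z : Scheme.{u}} {i : Z ⟶ ProjSpace N k}
  {T : Over (Spec (.of k))}

variable (i) in
/-- A closed subscheme of projective space, as a scheme over `k`. -/
abbrev overSpec : Over (Spec (.of k)) := Over.mk (i ≫ toSpec N k)

variable (T) in
/-- Functions on `T`, as functions on `Z_T`. -/
abbrev pullFun : Γ(T.left, ⊤) →+* Γ((overProd (overSpec i) T).left, ⊤) :=
  (overProd (overSpec i) T).hom.appTop.hom

lemma pullFun_mul_self {e : Γ(T.left, ⊤)} (he : e * e = 0) :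
    pullFun (i := i) T e * pullFun T e = 0 := by rw [← map_mul, he, map_zero]

/-- Identities between endomorphisms of $Z_T$ are thereby reduced to identities between perturbed
morphisms to $\mathbb{P}^N$. -/
lemma overProd_hom_ext [Mono i] {T' : Over T.left} {f g : T' ⟶ overProd (overSpec i) T}
    (h : f.left ≫ overProdFst (overSpec i) T ≫ i = g.left ≫ overProdFst (overSpec i) T ≫ i) :
    f = g := by
  refine Over.OverMorphism.ext (pullback.hom_ext ?_ ?_)
  · rw [← cancel_mono i, Category.assoc, Category.assoc]
    exact h
  · exact (Over.w f).trans (Over.w g).symm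

variable [IsClosedImmersion i] [QuasiCompact T.hom]

/-- The endomorphism `1 + e D` of `Z_T`, for a vector field `D` tangent to `Z` and a function
`e` on `T` of square zero. -/
def fieldHom {D : Module.End k (Fin (N + 1) → k)} (hD : IsTangentTo i D) {e : Γ(T.left, ⊤)}
    (he : e * e = 0) : overProd (overSpec i) T ⟶ overProd (overSpec i) T :=
  Over.homMk (pullback.lift (IsClosedImmersion.lift i _
    (hD.ker_le_ker_perturb (overProdFst (overSpec i) T) (pullFun_mul_self he)))
      (pullback.snd _ _) (by
        refine (IsClosedImmersion.lift_fac_assoc _ _ _ _).trans ?_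
        rw [perturb_vectorField_toSpec, Category.assoc]
        exact pullback.condition)) (pullback.lift_snd _ _ _)

lemma fieldHom_left_fst {D : Module.End k (Fin (N + 1) → k)} (hD : IsTangentTo i D)
    {e : Γ(T.left, ⊤)} (he : e * e = 0) :
    (fieldHom hD he).left ≫ overProdFst (overSpec i) T ≫ i =
      (vectorField D).perturb (overProdFst (overSpec i) T ≫ i) (pullFun_mul_self he) := by
  exact (pullback.lift_fst_assoc _ _ _ _).trans (IsClosedImmersion.lift_fac _ _ _)

variable {D E : Module.End k (Fin (N + 1) → k)}

lemma fieldHom_eq_id (hD : IsTangentTo i D) {e : Γ(T.left, ⊤)} (he : e * e = 0)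
    (h : D = 0 ∨ e = 0) : fieldHom hD he = 𝟙 _ := by
  refine overProd_hom_ext ?_
  rw [fieldHom_left_fst, Over.id_left, Category.id_comp]
  refine SheafDerivation.perturb_zero _ _ _ fun U V hV a => ?_
  rcases h with rfl | rfl
  · rw [vectorField_zero, map_zero, mul_zero]
  · rw [map_zero, map_zero, zero_mul]

lemma fieldHom_comp_fieldHom (hD : IsTangentTo i D) (hE : IsTangentTo i E) {e : Γ(T.left, ⊤)}
    (he : e * e = 0) : fieldHom hD he ≫ fieldHom hE he = fieldHom (hD.add hE) he := by
  refine overProd_hom_ext ?_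
  rw [Over.comp_left, Category.assoc, fieldHom_left_fst, SheafDerivation.comp_perturb]
  refine Eq.trans ?_ (fieldHom_left_fst _ _).symm
  have h1 : (fieldHom hD he).left.appTop.hom (pullFun T e) = pullFun T e := by
    have := congrArg Scheme.Hom.appTop (Over.w (fieldHom hD he))
    exact congr(($this).hom e)
  have h2 : (fieldHom hD he).left ≫ overProdFst (overSpec i) T ≫ i =
      (vectorField D).perturb (overProdFst (overSpec i) T ≫ i) (pullFun_mul_self he) :=
    fieldHom_left_fst hD he
  refine (SheafDerivation.perturb_congr (δ' := vectorField E) (p' := (vectorField D).perturb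
    (overProdFst (overSpec i) T ≫ i) (pullFun_mul_self he)) (e' := pullFun T e) _ _
    (pullFun_mul_self he) h2 fun U V hV a => ?_).trans ?_
  · rw [h1]
  · rw [SheafDerivation.perturb_perturb]
    exact SheafDerivation.perturb_congr _ _ _ rfl fun U V hV a => by rw [vectorField_add]

lemma baseChangeHom_fieldHom (hD : IsTangentTo i D) {e : Γ(T.left, ⊤)} (he : e * e = 0)
    {T' : Over (Spec (.of k))} [QuasiCompact T'.hom] (σ : T' ⟶ T) {e' : Γ(T'.left, ⊤)}
    (he' : e' * e' = 0) (h : e' = σ.left.appTop.hom e) :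
    baseChangeHom (overSpec i) σ (fieldHom hD he) = fieldHom hD he' := by
  refine overProd_hom_ext ?_
  have h0 := baseChangeHom_fst (overSpec i) σ (fieldHom hD he)
  rw [← Category.assoc, h0, Category.assoc, Category.assoc, fieldHom_left_fst, fieldHom_left_fst,
    SheafDerivation.comp_perturb]
  refine SheafDerivation.perturb_congr _ _ _ ?_ fun U V hV a => ?_
  · rw [← Category.assoc, pullback.lift_fst, Category.comp_id]
  · have h1 : (overProdMap (overSpec i) σ).appTop.hom (pullFun T e) = pullFun T' e' := by
      rw [h]
      have h2 : overProdMap (overSpec i) σ ≫ pullback.snd _ _ = pullback.snd _ _ ≫ σ.left :=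
        pullback.lift_snd _ _ _
      exact congr(($(congrArg Scheme.Hom.appTop h2)).hom e)
    rw [h1]

lemma fieldHom_smul (hD : IsTangentTo i D) (a : k) {e e' : Γ(T.left, ⊤)} (he : e * e = 0)
    (he' : e' * e' = 0)
    (h : e' = T.hom.appTop.hom ((Scheme.ΓSpecIso (.of k)).inv.hom a) * e) :
    fieldHom (hD.smul a) he = fieldHom hD he' := by
  refine overProd_hom_ext ?_
  rw [fieldHom_left_fst, fieldHom_left_fst]
  refine SheafDerivation.perturb_congr _ _ _ rfl fun U V hV s => ?_
  have h1 : ((overProdFst (overSpec i) T ≫ i).appLE U V hV).hom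
      ((ProjSpace N k).resTop U (scalar N k a)) =
        Scheme.resTop _ V (pullFun T (T.hom.appTop.hom ((Scheme.ΓSpecIso (.of k)).inv.hom a))) := by
    have h2 : (overProdFst (overSpec i) T ≫ i) ≫ toSpec N k = pullback.snd _ _ ≫ T.hom := by
      rw [Category.assoc]
      exact pullback.condition
    have h3 := congr(($(congrArg Scheme.Hom.appTop h2)).hom ((Scheme.ΓSpecIso (.of k)).inv.hom a))
    have h4 := Scheme.Hom.map_appLE (overProdFst (overSpec i) T ≫ i) hV (homOfLE le_top : U ⟶ ⊤).op
    exact congr(($h4).hom (scalar N k a)).trans (congrArg (Scheme.resTop _ V) h3)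
  rw [vectorField_smul, map_mul, h1, h, map_mul, map_mul]
  ring

end AlgebraicGeometry
end

/-! ### The automorphisms $1+eD$ preserve the class of $O(1)$. -/

noncomputable section

namespace AlgebraicGeometry

lemma Scheme.Hom.appLE_congr_hom {X Y : Scheme.{u}} {f g : X ⟶ Y} (h : f = g) {U : Y.Opens}
    {V : X.Opens} (hf : V ≤ f ⁻¹ᵁ U) (hg : V ≤ g ⁻¹ᵁ U) (a : Γ(Y, U)) :
    (f.appLE U V hf).hom a = (g.appLE U V hg).hom a := by
  subst h
  rfl

lemma Scheme.Hom.res_appLE_apply {X Y : Scheme.{u}} (f : X ⟶ Y) {U : Y.Opens} {V W : X.Opens}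
    (hf : V ≤ f ⁻¹ᵁ U) (h : W ≤ V) (a : Γ(Y, U)) :
    (X.presheaf.map (homOfLE h).op).hom ((f.appLE U V hf).hom a) =
      (f.appLE U W (h.trans hf)).hom a :=
  congr(($(Scheme.Hom.appLE_map f hf (homOfLE h).op)).hom a)

lemma Scheme.Hom.appLE_res_apply {X Y : Scheme.{u}} (f : X ⟶ Y) {U U' : Y.Opens} {V : X.Opens}
    (hf : V ≤ f ⁻¹ᵁ U) (h : U ≤ U') (a : Γ(Y, U')) :
    (f.appLE U V hf).hom ((Y.presheaf.map (homOfLE h).op).hom a) =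
      (f.appLE U' V (hf.trans fun _ hx => h hx)).hom a :=
  congr(($(Scheme.Hom.map_appLE f hf (homOfLE h).op)).hom a)

lemma Scheme.res_res_top (X : Scheme.{u}) {V W : X.Opens} (h : W ≤ V) (e : Γ(X, ⊤)) :
    (X.presheaf.map (homOfLE h).op).hom (X.resTop V e) = X.resTop W e :=
  congr($(X.presheaf.map_comp (homOfLE le_top).op (homOfLE h).op).hom e).symm

/-- The trivial line bundle. -/
def LineBundle.trivial (X : Scheme.{u}) : LineBundle X where
  ι := PUnit
  U _ := ⊤
  cover := iSup_const
  g _ _ := 1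
  cocycle _ _ _ := by simp only [map_one, mul_one]

lemma LineBundle.tensor_trivial_g {X T : Scheme.{u}} (L : LineBundle X) (f : X ⟶ T)
    (a b : L.ι × PUnit) : (L.tensor ((LineBundle.trivial T).pullback f)).g a b =
      X.resUnits (le_inf (inf_le_left.trans inf_le_left) (inf_le_right.trans inf_le_left))
        (L.g a.1 b.1) := by
  have h : ((LineBundle.trivial T).pullback f).g a.2 b.2 = 1 := map_one (LineBundle.pullUnits f _)
  have h' := congrArg (X.resUnits (V := (L.U a.1 ⊓ (f ⁻¹ᵁ ⊤)) ⊓ (L.U b.1 ⊓ (f ⁻¹ᵁ ⊤)))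
    (le_inf (inf_le_left.trans inf_le_right) (inf_le_right.trans inf_le_right))) h
  exact (congrArg (X.resUnits (V := (L.U a.1 ⊓ (f ⁻¹ᵁ ⊤)) ⊓ (L.U b.1 ⊓ (f ⁻¹ᵁ ⊤)))
    (le_inf (inf_le_left.trans inf_le_left) (inf_le_right.trans inf_le_left))
    (L.g a.1 b.1) * ·) (h'.trans (map_one _))).trans (mul_one _)

namespace ProjSpace

variable {N : ℕ} {k : Type u} [Field k] {Y : Scheme.{u}} (p : Y ⟶ ProjSpace N k)

/-- The pullback of the function `X_l / X_j`. -/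
def pullRatio (W : Y.Opens) (l j : Fin (N + 1)) (h : W ≤ p ⁻¹ᵁ chart N k j) : Γ(Y, W) :=
  (p.appLE _ W h).hom (ratio l j)

lemma pullRatio_self (W : Y.Opens) (j : Fin (N + 1)) (h : W ≤ p ⁻¹ᵁ chart N k j) :
    pullRatio p W j j h = 1 := by
  rw [pullRatio, ratio_self, map_one]

lemma pullRatio_mul (W : Y.Opens) (i j l : Fin (N + 1)) (hi : W ≤ p ⁻¹ᵁ chart N k i)
    (hj : W ≤ p ⁻¹ᵁ chart N k j) :
    pullRatio p W j i hi * pullRatio p W l j hj = pullRatio p W l i hi := by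
  have h : W ≤ p ⁻¹ᵁ (chart N k i ⊓ chart N k j) := fun x hx => ⟨hi hx, hj hx⟩
  have := congrArg (p.appLE _ W h).hom
    (ratio_mul_ratio (k := k) i j l (W := chart N k i ⊓ chart N k j) inf_le_left inf_le_right)
  rwa [map_mul, Scheme.Hom.appLE_res_apply, Scheme.Hom.appLE_res_apply,
    Scheme.Hom.appLE_res_apply] at this

/-- The pullback of the function `X_l / X_j`, as an invertible function. -/
def pullRatioUnit (W : Y.Opens) (l j : Fin (N + 1)) (hl : W ≤ p ⁻¹ᵁ chart N k l)
    (hj : W ≤ p ⁻¹ᵁ chart N k j) : Γ(Y, W)ˣ where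
  val := pullRatio p W l j hj
  inv := pullRatio p W j l hl
  val_inv := by rw [pullRatio_mul, pullRatio_self]
  inv_val := by rw [pullRatio_mul, pullRatio_self]

variable {D : Module.End k (Fin (N + 1) → k)}

variable (D) in
/-- The pullback of the function `D X_j / X_j`. -/
def pullLog (W : Y.Opens) (j : Fin (N + 1)) (h : W ≤ p ⁻¹ᵁ chart N k j) : Γ(Y, W) :=
  (p.appLE _ W h).hom (dehomog _ (linearDerivation_X_mem D j) j)

/-- The invertible function `1 + e D X_j / X_j`. -/
def pullLogUnit {e : Γ(Y, ⊤)} (he : e * e = 0) (W : Y.Opens) (j : Fin (N + 1))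
    (h : W ≤ p ⁻¹ᵁ chart N k j) : Γ(Y, W)ˣ where
  val := 1 + Y.resTop W e * pullLog p D W j h
  inv := 1 - Y.resTop W e * pullLog p D W j h
  val_inv := by
    have h : Y.resTop W e * Y.resTop W e = 0 := by rw [← map_mul, he, map_zero]
    linear_combination (-(pullLog p D W j _)^2) * h
  inv_val := by
    have h : Y.resTop W e * Y.resTop W e = 0 := by rw [← map_mul, he, map_zero]
    linear_combination (-(pullLog p D W j _)^2) * h

/-- The perturbation acts as $X_l\mapsto X_l(1+e\,DX_l/X_l)$, so a ratio changes by the quotient of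
two such factors, computed modulo $e^2=0$. -/
lemma perturb_appLE_ratio {e : Γ(Y, ⊤)} (he : e * e = 0) (W : Y.Opens) (l j : Fin (N + 1))
    (hl : W ≤ p ⁻¹ᵁ chart N k l) (hj : W ≤ p ⁻¹ᵁ chart N k j) :
    (((vectorField D).perturb p he).appLE _ W hj).hom (ratio l j) =
      pullRatio p W l j hj * (1 + Y.resTop W e * (pullLog p D W l hl - pullLog p D W j hj)) := by
  refine (SheafDerivation.perturb_appLE _ p he hj _).trans ?_
  have h1 := congrArg (p.appLE _ W hj).hom
    (vectorField_dehomog_of_degree_one D (.X l) (X_mem N l) j)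
  have h : W ≤ p ⁻¹ᵁ (chart N k j ⊓ chart N k l) := fun x hx => ⟨hj hx, hl hx⟩
  have h2 := congrArg (p.appLE _ W h).hom (res_dehomog_eq_ratio_mul _
    (linearDerivation_X_mem D l) j l (W := chart N k j ⊓ chart N k l) inf_le_left inf_le_right)
  rw [map_mul, Scheme.Hom.appLE_res_apply, Scheme.Hom.appLE_res_apply,
    Scheme.Hom.appLE_res_apply] at h2
  rw [map_add, map_mul, h2] at h1
  simp only [pullRatio, pullLog, ratio] at h1 ⊢
  linear_combination (Y.resTop W e) * h1

lemma val_resUnits_pullback_O1 (W : Y.Opens) (a b : (O1 N k).ι)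
    (ha : W ≤ p ⁻¹ᵁ chart N k a.down) (hb : W ≤ p ⁻¹ᵁ chart N k b.down) :
    (Y.resUnits (le_inf ha hb) (((O1 N k).pullback p).g a b)).val =
      pullRatio p W b.down a.down ha :=
  Scheme.Hom.appLE_res_apply p (U := chart N k a.down ⊓ chart N k b.down)
    (le_inf ha hb) inf_le_left (ratio b.down a.down)

lemma val_resUnits_pullRatioUnit_mul_pullLogUnit {e : Γ(Y, ⊤)} (he : e * e = 0)
    {V W : Y.Opens} (hW : W ≤ V) (l j : Fin (N + 1)) (hl : V ≤ p ⁻¹ᵁ chart N k l)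
    (hj : V ≤ p ⁻¹ᵁ chart N k j) :
    (Y.resUnits hW (pullRatioUnit p V l j hl hj * pullLogUnit p (D := D) he V l hl)).val =
      pullRatio p W l j (hW.trans hj) *
        (1 + Y.resTop W e * pullLog p D W l (hW.trans hl)) := by
  rw [map_mul, Units.val_mul]
  refine congrArg₂ (· * ·) (Scheme.Hom.res_appLE_apply p hj hW _) ?_
  change (Y.presheaf.map (homOfLE hW).op).hom (1 + Y.resTop V e * pullLog p D V l hl) = _
  rw [map_add, map_one, map_mul, Scheme.res_res_top]
  exact congrArg (1 + Y.resTop W e * ·) (Scheme.Hom.res_appLE_apply p hl hW _)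

variable (D) in
-- The isomorphism rescales the trivialising section $X_a$ by $1+e\,DX_a/X_a$ and then changes chart
-- by the usual ratio. No twist by a nontrivial bundle from $T$ is needed.
lemma isomorphic_pullback_perturb {e : Γ(Y, ⊤)} (he : e * e = 0) {T : Scheme.{u}} (f : Y ⟶ T) :
    ((O1 N k).pullback ((vectorField D).perturb p he)).Isomorphic
      (((O1 N k).pullback p).tensor ((LineBundle.trivial T).pullback f)) := by
  refine ⟨fun a b => pullRatioUnit p _ a.down b.1.down inf_le_left
    (inf_le_right.trans inf_le_left) * pullLogUnit p (D := D) he _ a.down inf_le_left, ?_⟩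
  intro a a' b b' W ha ha' hb hb'
  have ha1 : W ≤ p ⁻¹ᵁ chart N k a.down := ha
  have ha1' : W ≤ p ⁻¹ᵁ chart N k a'.down := ha'
  have hb1 : W ≤ p ⁻¹ᵁ chart N k b.1.down := hb.trans inf_le_left
  have hb1' : W ≤ p ⁻¹ᵁ chart N k b'.1.down := hb'.trans inf_le_left
  have hg := LineBundle.tensor_trivial_g ((O1 N k).pullback p) f b' b
  ext
  refine (val_resUnits_pullRatioUnit_mul_pullLogUnit p he (le_inf ha' hb') _ _ _ _).trans
    (Eq.trans ?_ (congrArg₂ (· * ·) (congrArg₂ (· * ·)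
      ((congrArg (fun t => (Y.resUnits (le_inf hb' hb) t).val) hg).trans
        ((congrArg Units.val (LineBundle.resUnits_resUnits _ _ _)).trans
          (val_resUnits_pullback_O1 p W b'.1 b.1 hb1' hb1)))
      (val_resUnits_pullRatioUnit_mul_pullLogUnit p he (le_inf ha hb) _ _ _ _))
      ((val_resUnits_pullback_O1 _ W a a' ha ha').trans
        (perturb_appLE_ratio p he W a'.down a.down ha1' ha1))).symm)
  have h4 := pullRatio_mul p W b'.1.down b.1.down a.down hb1' hb1
  have h5 := pullRatio_mul p W b'.1.down a.down a'.down hb1' ha1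
  have h6 : Y.resTop W e * Y.resTop W e = 0 := by rw [← map_mul, he, map_zero]
  rw [← h5, ← h4]
  linear_combination (-(pullRatio p W b.1.down b'.1.down hb1' * pullRatio p W a.down b.1.down hb1 *
    pullRatio p W a'.down a.down ha1 * pullLog p D W a.down ha1 *
      (pullLog p D W a'.down ha1' - pullLog p D W a.down ha1))) * h6

end ProjSpace

open ProjSpace

variable {N : ℕ} {k : Type u} [Field k] {Z : Scheme.{u}} {i : Z ⟶ ProjSpace N k}
  {T : Over (Spec (.of k))} [IsClosedImmersion i] [QuasiCompact T.hom]
  {D : Module.End k (Fin (N + 1) → k)}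

/-- The automorphism `1 + e D` of `Z_T`. -/
def fieldAut (hD : IsTangentTo i D) {e : Γ(T.left, ⊤)} (he : e * e = 0) :
    Aut (overProd (overSpec i) T) where
  hom := fieldHom hD he
  inv := fieldHom (hD.smul (-1)) he
  hom_inv_id := by
    rw [fieldHom_comp_fieldHom]
    exact fieldHom_eq_id _ _ (.inl (by module))
  inv_hom_id := by
    rw [fieldHom_comp_fieldHom]
    exact fieldHom_eq_id _ _ (.inl (by module))

lemma fieldAut_mem_polarizedAut (hD : IsTangentTo i D) {e : Γ(T.left, ⊤)} (he : e * e = 0) :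
    fieldAut hD he ∈ polarizedAut (overSpec i) ((O1 N k).pullback i) T := by
  refine ⟨LineBundle.trivial _, ?_⟩
  have h := isomorphic_pullback_perturb (overProdFst (overSpec i) T ≫ i) D (pullFun_mul_self he)
    (overProd (overSpec i) T).hom
  rw [← fieldHom_left_fst hD he] at h
  exact h

end AlgebraicGeometry
end

/-! ### A trivial automorphism forces eigenvectors along the base locus. -/

noncomputable section

namespace AlgebraicGeometry

lemma IsAffineOpen.top_le_preimage_SpecMap_fromSpec {X : Scheme.{u}} {U : X.Opens}
    (hU : IsAffineOpen U) {R : CommRingCat.{u}} (φ : Γ(X, U) ⟶ R) :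
    ⊤ ≤ (Spec.map φ ≫ hU.fromSpec) ⁻¹ᵁ U := by
  rw [Scheme.Hom.comp_preimage, hU.fromSpec_preimage_self]
  rfl

lemma IsAffineOpen.SpecMap_fromSpec_appLE {X : Scheme.{u}} {U : X.Opens} (hU : IsAffineOpen U)
    {R : CommRingCat.{u}} (φ : Γ(X, U) ⟶ R) (h : ⊤ ≤ (Spec.map φ ≫ hU.fromSpec) ⁻¹ᵁ U) :
    (Spec.map φ ≫ hU.fromSpec).appLE U ⊤ h = φ ≫ (Scheme.ΓSpecIso R).inv := by
  rw [Scheme.Hom.comp_appLE, hU.fromSpec_app_self, Category.assoc,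
    Scheme.ΓSpecIso_inv_naturality]
  refine congrArg ((Scheme.ΓSpecIso Γ(X, U)).inv ≫ ·)
    ((Scheme.Hom.map_appLE (Spec.map φ) h _).trans ?_)
  exact Scheme.Hom.appLE_eq_app _

lemma SheafDerivation.mul_appLE_eq_zero_of_perturb_eq {X Y : Scheme.{u}} {δ : SheafDerivation X}
    {p : Y ⟶ X} {e : Γ(Y, ⊤)} {he : e * e = 0} (h : δ.perturb p he = p) (U : X.Opens) (V : Y.Opens)
    (hV : V ≤ p ⁻¹ᵁ U) (a : Γ(X, U)) :
    Y.resTop V e * (p.appLE U V hV).hom (δ.app U a) = 0 := by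
  have h1 := (δ.perturb_appLE p he (U := U) (V := V) hV a).symm.trans
    (Scheme.Hom.appLE_congr_hom h _ hV a)
  exact left_eq_add.1 h1.symm

lemma SheafDerivation.mul_eq_zero_of_perturb_fromSpec_eq {X : Scheme.{u}}
    {δ : SheafDerivation X} {U : X.Opens} (hU : IsAffineOpen U) {R : CommRingCat.{u}}
    (φ : Γ(X, U) ⟶ R) {e : R}
    {he : (Scheme.ΓSpecIso R).inv.hom e * (Scheme.ΓSpecIso R).inv.hom e = 0}
    (h : δ.perturb (Spec.map φ ≫ hU.fromSpec) he = Spec.map φ ≫ hU.fromSpec) (a : Γ(X, U)) :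
    e * φ.hom (δ.app U a) = 0 := by
  have h1 := mul_appLE_eq_zero_of_perturb_eq h U ⊤ (hU.top_le_preimage_SpecMap_fromSpec φ) a
  rw [IsAffineOpen.SpecMap_fromSpec_appLE] at h1
  have h2 : (Scheme.ΓSpecIso R).inv.hom (e * φ.hom (δ.app U a)) = 0 := by
    rw [map_mul]
    refine Eq.trans ?_ h1
    refine congrArg (· * (Scheme.ΓSpecIso R).inv.hom (φ.hom (δ.app U a))) ?_
    exact congr(($((Spec R).presheaf.map_id (.op ⊤))).hom ((Scheme.ΓSpecIso R).inv.hom e)).symm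
  have h3 := congr(($((Scheme.ΓSpecIso R).inv_hom_id)).hom (e * φ.hom (δ.app U a)))
  refine h3.symm.trans ?_
  change (Scheme.ΓSpecIso R).hom.hom ((Scheme.ΓSpecIso R).inv.hom _) = 0
  rw [h2, map_zero]

open ProjSpace

variable {N : ℕ} {k : Type u} [Field k] {Z : Scheme.{u}} {i : Z ⟶ ProjSpace N k}
  [IsClosedImmersion i] {D : Module.End k (Fin (N + 1) → k)}

instance (R : Type u) [CommRing R] [Algebra k R] : QuasiCompact (specOver k R).hom :=
  inferInstanceAs (QuasiCompact (Spec.map (CommRingCat.ofHom (algebraMap k R))))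

/-- The function `ε` on the spectrum of the dual numbers. -/
def dualEps (k : Type u) [Field k] : Γ((specOver k (DualNumber k)).left, ⊤) :=
  (Scheme.ΓSpecIso (.of (DualNumber k))).inv.hom DualNumber.eps

lemma dualEps_mul_self (k : Type u) [Field k] : dualEps k * dualEps k = 0 := by
  rw [dualEps, ← map_mul, DualNumber.eps_mul_eps, map_zero]

/-- The morphism to a closed subscheme of projective space given by an algebra homomorphism
on a standard open set. -/
lemma exists_overSpec_hom {R : Type u} [CommRing R] [Algebra k R] (j : Fin (N + 1))
    (φ : Γ(ProjSpace N k, chart N k j) ⟶ .of R)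
    (hφ : RingHom.ker (i.app (chart N k j)).hom ≤ RingHom.ker φ.hom)
    (hφ' : ∀ c, φ.hom ((ProjSpace N k).resTop _ (scalar N k c)) = algebraMap k R c) :
    ∃ y : Spec (.of R) ⟶ Z, y ≫ i = Spec.map φ ≫
      (isAffineOpen_chart j).fromSpec ∧ y ≫ i ≫ toSpec N k = (specOver k R).hom := by
  have hsurj : Function.Surjective (i.app (chart N k j)).hom :=
    i.app_surjective _ (isAffineOpen_chart j)
  let g : Γ(Z, i ⁻¹ᵁ chart N k j) →+* R :=
    RingHom.liftOfSurjective (i.app (chart N k j)).hom hsurj ⟨φ.hom, hφ⟩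
  have hg (s) : g ((i.app (chart N k j)).hom s) = φ.hom s :=
    RingHom.liftOfRightInverse_comp_apply _ _ _ ⟨φ.hom, hφ⟩ s
  refine ⟨Spec.map (CommRingCat.ofHom g) ≫ ((isAffineOpen_chart j).preimage i).fromSpec, ?_, ?_⟩
  · rw [Category.assoc, ← IsAffineOpen.SpecMap_appLE_fromSpec i (isAffineOpen_chart j)
      ((isAffineOpen_chart j).preimage i) le_rfl, Scheme.Hom.appLE_eq_app, ← Category.assoc,
      ← Spec.map_comp]
    congr 2
    ext s
    exact hg s
  · rw [Category.assoc, ← IsAffineOpen.SpecMap_appLE_fromSpec (i ≫ toSpec N k)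
      (isAffineOpen_top _) ((isAffineOpen_chart j).preimage i) le_top, IsAffineOpen.fromSpec_top,
      Scheme.isoSpec_Spec_inv, ← Spec.map_comp, ← Spec.map_comp]
    have h : (Scheme.ΓSpecIso (.of k)).inv ≫
        (i ≫ toSpec N k).appLE ⊤ (i ⁻¹ᵁ chart N k j) le_top = CommRingCat.ofHom
          (IsSmoothIntersectionOfTwoQuadrics.constants i j) := by
      rw [IsSmoothIntersectionOfTwoQuadrics.constants_eq]
      rfl
    rw [h]
    change _ = Spec.map (CommRingCat.ofHom (algebraMap k R))
    congr 1
    ext c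
    exact (hg _).trans (hφ' c)

/-- The automorphism is tested on the constant $k[\varepsilon]$-point given by $x\in Z(k)$.
Triviality gives $\varepsilon\cdot(Ds)(x)=0$ in $k[\varepsilon]$, and the $\varepsilon$-part is
$(Ds)(x)$. -/
lemma evalChart_vectorField_eq_zero (hD : IsTangentTo i D)
    (h : fieldHom (T := specOver k (DualNumber k)) hD (dualEps_mul_self k) = 𝟙 _)
    {x : Fin (N + 1) → k} {j : Fin (N + 1)} (hj : x j ≠ 0)
    (hx : RingHom.ker (i.app (chart N k j)).hom ≤
      RingHom.ker (evalChart (k := k) x j hj.isUnit)) (s : Γ(ProjSpace N k, chart N k j)) :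
    evalChart (k := k) x j hj.isUnit ((vectorField D).app _ s) = 0 := by
  obtain ⟨φ, hφ'⟩ : ∃ φ : Γ(ProjSpace N k, chart N k j) ⟶ CommRingCat.of (DualNumber k),
      ∀ s, φ.hom s = algebraMap k (DualNumber k) (evalChart (k := k) x j hj.isUnit s) :=
    ⟨CommRingCat.ofHom (R := Γ(ProjSpace N k, chart N k j))
      ((algebraMap k (DualNumber k)).comp (evalChart (k := k) x j hj.isUnit)), fun _ => rfl⟩
  have hφ : RingHom.ker (i.app (chart N k j)).hom ≤ RingHom.ker φ.hom := fun a ha => by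
    rw [RingHom.mem_ker, hφ', RingHom.mem_ker.1 (hx ha), map_zero]
  obtain ⟨y, hy, hy'⟩ := exists_overSpec_hom j φ hφ fun c => by
    rw [hφ', resTop_scalar, evalChart_dehomog_C, Algebra.algebraMap_self_apply]
  let z : Spec (.of (DualNumber k)) ⟶ (overProd (overSpec i) (specOver k (DualNumber k))).left :=
    pullback.lift y (𝟙 _) (by rw [Category.id_comp]; exact hy')
  have hz : z ≫ overProdFst (overSpec i) (specOver k (DualNumber k)) ≫ i =
      Spec.map φ ≫ (isAffineOpen_chart j).fromSpec := by
    rw [← hy]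
    exact pullback.lift_fst_assoc _ _ _ _
  have hz' : z.appTop.hom (pullFun (i := i) (specOver k (DualNumber k)) (dualEps k)) =
      dualEps k := by
    have : z ≫ pullback.snd _ _ = 𝟙 _ := pullback.lift_snd _ _ _
    exact congr(($(congrArg Scheme.Hom.appTop this)).hom (dualEps k))
  have h1 := fieldHom_left_fst (T := specOver k (DualNumber k)) hD (dualEps_mul_self k)
  rw [h, Over.id_left, Category.id_comp] at h1
  have h2 := congrArg (z ≫ ·) h1
  rw [SheafDerivation.comp_perturb] at h2
  have h3 : (vectorField D).perturb (Spec.map φ ≫ (isAffineOpen_chart j).fromSpec)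
      (dualEps_mul_self k) = Spec.map φ ≫ (isAffineOpen_chart j).fromSpec :=
    (SheafDerivation.perturb_congr _ _ _ hz.symm fun U V hV a =>
      congrArg (fun t => Scheme.resTop _ V t * _) hz'.symm).trans (h2.symm.trans hz)
  have h5 : (DualNumber.eps : DualNumber k) * φ.hom ((vectorField D).app _ s) = 0 :=
    SheafDerivation.mul_eq_zero_of_perturb_fromSpec_eq (X := ProjSpace N k)
      (isAffineOpen_chart j) φ h3 s
  rw [hφ'] at h5
  simpa [TrivSqZeroExt.algebraMap_eq_inl] using congrArg TrivSqZeroExt.snd h5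

/-- A linear vector field vanishes at a point of projective space only if that point is an
eigenline; the quotient rule for $X_l/X_j$ gives the eigenvalue $(Dx)_j/x_j$. -/
lemma apply_eq_smul_of_fieldHom_eq_id (hD : IsTangentTo i D)
    (h : fieldHom (T := specOver k (DualNumber k)) hD (dualEps_mul_self k) = 𝟙 _)
    {x : Fin (N + 1) → k} {j : Fin (N + 1)} (hj : x j ≠ 0)
    (hx : RingHom.ker (i.app (chart N k j)).hom ≤
      RingHom.ker (evalChart (k := k) x j hj.isUnit)) :
    D x = (D x j / x j) • x := by
  ext l
  have h1 := congrArg (evalChart (k := k) x j hj.isUnit)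
    (vectorField_dehomog_of_degree_one D (.X l) (X_mem N l) j)
  rw [map_add, map_mul, evalChart_vectorField_eq_zero hD h hj hx, zero_add] at h1
  have h2 := evalChart_dehomog (k := k) x j hj.isUnit (.X l) (X_mem N l)
  have h3 (l : Fin (N + 1)) := evalChart_dehomog (k := k) x j hj.isUnit _ (linearDerivation_X_mem D
    l)
  have h4 (l : Fin (N + 1)) : MvPolynomial.aeval (R := k) x (linearDerivation D (.X l)) = D x l :=
    eval_linearDerivation_X D x l
  simp only [MvPolynomial.aeval_X, h4, pow_one] at h2 h3
  rw [← h3 l, ← h1, Pi.smul_apply, ← h3 j, ← h2]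
  simp only [smul_eq_mul]
  field_simp

end AlgebraicGeometry
end

/-! ### The linear family of tangent vectors and the conclusion. -/

noncomputable section

namespace AlgebraicGeometry

open ProjSpace

variable {N : ℕ} {k : Type u} [Field k] {Z : Scheme.{u}} {i : Z ⟶ ProjSpace N k}

lemma specOverMap_appTop {R R' : Type u} [CommRing R] [CommRing R'] [Algebra k R] [Algebra k R']
    (φ : R →ₐ[k] R') (r : R) :
    (specOverMap φ).left.appTop.hom ((Scheme.ΓSpecIso (.of R)).inv.hom r) =
      (Scheme.ΓSpecIso (.of R')).inv.hom (φ r) :=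
  congr(($(Scheme.ΓSpecIso_inv_naturality (CommRingCat.ofHom φ.toRingHom))).hom r).symm

lemma specOver_hom_appTop {R : Type u} [CommRing R] [Algebra k R] (a : k) :
    (specOver k R).hom.appTop.hom ((Scheme.ΓSpecIso (.of k)).inv.hom a) =
      (Scheme.ΓSpecIso (.of R)).inv.hom (algebraMap k R a) :=
  congr(($(Scheme.ΓSpecIso_inv_naturality (CommRingCat.ofHom (algebraMap k R)))).hom a).symm

section fieldAut

variable [IsClosedImmersion i] {D E : Module.End k (Fin (N + 1) → k)}

lemma fieldAut_congr {T : Over (Spec (.of k))} [QuasiCompact T.hom] {hD : IsTangentTo i D}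
    {hE : IsTangentTo i E} {e : Γ(T.left, ⊤)} {he : e * e = 0} (h : D = E) :
    fieldAut hD he = fieldAut hE he := by
  subst h
  rfl

/-- The summands are swapped because multiplication in `Aut` is composition in the reverse order. -/
lemma fieldAut_mul_fieldAut {T : Over (Spec (.of k))} [QuasiCompact T.hom] (hD : IsTangentTo i D)
    (hE : IsTangentTo i E) {e : Γ(T.left, ⊤)} (he : e * e = 0) :
    fieldAut hD he * fieldAut hE he = fieldAut (hE.add hD) he :=
  Iso.ext (fieldHom_comp_fieldHom hE hD he)

lemma fieldAut_mem_polarizedAutTangent (hD : IsTangentTo i D) :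
    fieldAut hD (dualEps_mul_self k) ∈ polarizedAutTangent (overSpec i) ((O1 N k).pullback i) := by
  refine ⟨fieldAut_mem_polarizedAut hD _, Iso.ext ?_⟩
  refine (baseChangeHom_fieldHom hD (dualEps_mul_self k) _ (e' := 0) (mul_zero 0) ?_).trans
    (fieldHom_eq_id _ _ (.inr rfl))
  rw [dualEps, specOverMap_appTop]
  simp

/-- Both sides are $1+a\varepsilon D$: the scalar is absorbed by the field on one side and by
$\varepsilon$ on the other. -/
lemma fieldAut_smul (hD : IsTangentTo i D) (a : k) :
    fieldAut (hD.smul a) (dualEps_mul_self k) =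
      autBaseChange (overSpec i) (specOverMap (dualScale a))
        (fieldAut hD (dualEps_mul_self k)) := by
  have h : (specOverMap (dualScale a)).left.appTop.hom (dualEps k) =
      (specOver k (DualNumber k)).hom.appTop.hom ((Scheme.ΓSpecIso (.of k)).inv.hom a) *
        dualEps k := by
    rw [dualEps, specOverMap_appTop, specOver_hom_appTop]
    refine Eq.trans ?_ (map_mul (Scheme.ΓSpecIso (.of (DualNumber k))).inv.hom _ _)
    congr 1
    ext <;> simp [dualScale, TrivSqZeroExt.algebraMap_eq_inl]
  have he : ∀ e' : Γ((specOver k (DualNumber k)).left, ⊤),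
      (specOverMap (dualScale a)).left.appTop.hom (dualEps k) = e' → e' * e' = 0 := by
    rintro _ rfl
    rw [← map_mul, dualEps_mul_self, map_zero]
  exact Iso.ext ((fieldHom_smul hD a (dualEps_mul_self k) (he _ rfl) h).trans
    (baseChangeHom_fieldHom hD (dualEps_mul_self k) _ (he _ rfl) rfl).symm)

end fieldAut

open _root_.Polynomial in
/-- The polynomial with coefficients `v` and without constant term. -/
def polynomialOfCoeffs (m : ℕ) : (Fin m → k) →ₗ[k] k[X] :=
  ∑ j : Fin m, (monomial (j.1 + 1)) ∘ₗ LinearMap.proj j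

open _root_.Polynomial in
lemma natDegree_polynomialOfCoeffs_le (m : ℕ) (v : Fin m → k) :
    (polynomialOfCoeffs m v).natDegree ≤ m := by
  rw [polynomialOfCoeffs, LinearMap.sum_apply]
  refine natDegree_sum_le_of_forall_le _ _ fun j _ => ?_
  exact (natDegree_monomial_le _).trans j.2

open _root_.Polynomial in
lemma eq_zero_of_polynomialOfCoeffs_eq_C {m : ℕ} {v : Fin m → k} {c : k}
    (h : polynomialOfCoeffs m v = C c) : v = 0 := by
  ext j
  have h1 := congrArg (fun p => coeff p (j.1 + 1)) h
  simp only [polynomialOfCoeffs, LinearMap.sum_apply, finsetSum_coeff, LinearMap.comp_apply,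
    LinearMap.proj_apply, coeff_monomial, coeff_C_succ] at h1
  rw [Finset.sum_eq_single j] at h1
  · simpa using h1
  · intro l _ hl
    rw [if_neg]
    intro h2
    exact hl (Fin.ext (by omega))
  · simp

end AlgebraicGeometry
end

theorem mainTheorem8 {k : Type u} [Field k] [IsAlgClosed k] [CharP k 2] (N : ℕ) (hN : 3 ≤ N)
    (hodd : Odd N) {Z : Scheme.{u}} (i : Z ⟶ ProjSpace N k)
    (hi : IsSmoothIntersectionOfTwoQuadrics i) :
    (((N - 1) / 2 : ℕ) : ℕ∞) ≤
      polarizedAutTangentDim (Over.mk (i ≫ ProjSpace.toSpec N k))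
        ((ProjSpace.O1 N k).pullback i) := by
  have := hi.isClosedImmersion
  obtain ⟨M, M', hM, hM', h⟩ := hi.exists_matrices
  obtain ⟨A, hA, hA', hA''⟩ := (hi.isNonsingularPencil (by omega) h).exists_operator
    (by rw [Fintype.card_fin]; exact hodd.add_one) (by rw [Fintype.card_fin]; omega)
  have hT (P : Polynomial k) : ProjSpace.IsTangentTo i (Polynomial.aeval A P) :=
    ProjSpace.isTangentTo_of_polar_eq_zero h (hA P) (hA' P)
  -- The coefficients are those of $X,\dots,X^{(N-1)/2}$, so $2\deg P\le N-1<N+1$. The constant term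
  -- is left out because scalars act trivially.
  let φ (v : Fin ((N - 1) / 2) → k) : Aut (overProd (overSpec i) (specOver k (DualNumber k))) :=
    fieldAut (hT (polynomialOfCoeffs _ v)) (dualEps_mul_self k)
  have hadd (v w) : φ (v + w) = φ v * φ w := by
    refine Eq.trans ?_ (fieldAut_mul_fieldAut _ _ _).symm
    exact fieldAut_congr (by rw [map_add, map_add]; exact add_comm _ _)
  -- If the automorphism is trivial, every base point is an eigenvector of $P(A)$, so $P$ is
  -- constant; having no constant term, it is zero.
  have hone (v) (hv : φ v = 1) : v = 0 := by
    have hid : fieldHom (hT (polynomialOfCoeffs _ v)) (dualEps_mul_self k) = 𝟙 _ :=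
      congrArg Iso.hom hv
    obtain ⟨c, hc⟩ := hA'' (polynomialOfCoeffs _ v)
      (by
        have := natDegree_polynomialOfCoeffs_le _ v
        rw [Fintype.card_fin]
        omega) fun x hx hq hq' => by
      obtain ⟨j, hj⟩ : ∃ j, x j ≠ 0 := Function.ne_iff.1 hx
      refine ⟨_, apply_eq_smul_of_fieldHom_eq_id _ hid hj ?_⟩
      rw [h j, Ideal.span_le]
      rintro _ (rfl | rfl)
      · exact (ProjSpace.evalChart_dehomog_eq_zero_iff ..).2 ((ProjSpace.eval_quadric M x).trans hq)
      · exact (ProjSpace.evalChart_dehomog_eq_zero_iff ..).2 ((ProjSpace.eval_quadric M' x).trans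
        hq')
    exact eq_zero_of_polynomialOfCoeffs_eq_C hc
  refine le_iSup₂_of_le ((N - 1) / 2) ⟨φ, fun v w hvw => ?_, fun v =>
    fieldAut_mem_polarizedAutTangent _, hadd, fun a v => ?_⟩ le_rfl
  · refine sub_eq_zero.1 (hone _ (mul_right_cancel (b := φ w) ?_))
    rw [← hadd, sub_add_cancel, one_mul, hvw]
  · refine Eq.trans ?_ (fieldAut_smul _ a)
    exact fieldAut_congr (by rw [map_smul, map_smul])
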